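/- Let $\mathfrak M_{n,m}$ be the space of real $n\times m$ matrices with Lebesgue measure $dx=\prod dx_{i,j}$, let $\mathcal P_m$ be the cone of positive definite symmetric $m\times m$ matrices with $da=\prod_{i\le j}da_{i,j}$ and invariant measure $d_*a=|a|^{-(m+1)/2}da$, $|a|=\det a$; write $r<s$ if $s-r\in\mathcal P_m$, let $x'$ be the transpose of $x$, and $|x|_m=\det(x'x)^{1/2}$. Let $V_{n,n-k}=\{\xi\in\mathfrak M_{n,n-k}:\xi'\xi=I\}$ carry its $O(n)$-invariant probability measure $d_*\xi$, and put $\sigma_{n,m}=2^m\pi^{nm/2}/\Gamma_m(n/2)$ with $\Gamma_m(\alpha)=\int_{\mathcal P_m}e^{-\operatorname{tr}r}|r|^{\alpha-(m+1)/2}dr$. For $1\le k\le n-m$, $m\ge 1$, and $f:\mathfrak M_{n,m}\to\mathbb C$, the Radon transform is $$\hat f(\xi,t)=\int_{\mathfrak M_{k,m}}f\Big(g_\xi\begin{bmatrix}\omega\\ t\end{bmatrix}\Big)d\omega,\qquad \xi\in V_{n,n-k},\ t\in\mathfrak M_{n-k,m},$$ where $g_\xi\in SO(n)$ satisfies $g_\xi\begin{bmatrix}0\\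 I_{n-k}\end{bmatrix}=\xi$. For $w:\mathfrak M_{n-k,m}\to\mathbb C$ and $a\in\mathcal P_m$ put $w_a(z)=|a|^{(k-n)/2}w(za^{-1/2})$; the dual ridgelet transform is $$(W_a^*\varphi)(x)=\int_{V_{n,n-k}}d_*\xi\int_{\mathfrak M_{n-k,m}}\varphi(\xi,t)\,w_a(\xi'x-t)\,dt .$$ Call $w$ admissible if (i) $w\in L^1(\mathfrak M_{n-k,m})$ and $w(z)=w_0(z'z)$ for some function $w_0$; (ii) its Fourier transform $(\tilde{\mathcal F}w)(y)=\int_{\mathfrak M_{n-k,m}} e^{i\operatorname{tr}(y'x)}w(x)\,dx$ satisfies $(\tilde{\mathcal F}w)(y)=u_0(y'y)$ for all $y$ of rank $m$, where $u_0:\mathcal P_m\to\mathbb C$ is symmetric: $u_0(s^{1/2}rs^{1/2})=u_0(r^{1/2}sr^{1/2})$ for all $r,s\in\mathcal P_m$; (iii) the integral $$c_w=\frac{2^{m(k+1)}\pi^{km}}{\sigma_{n,m}}\int_{\mathfrak M_{n-k,m}}\frac{(\tilde{\mathcal F}w)(\zeta)}{|\zeta|_m^{\,n}}\,d\zeta$$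 converges absolutely. **Theorem.** Let $m\ge 1$, $1\le k\le n-m$, let $f\in L^1(\mathfrak M_{n,m})\cap L^2(\mathfrak M_{n,m})$ and let $w$ be admissible. Then for all $0<\varepsilon<\rho<\infty$ the integral $$(I_{\varepsilon,\rho}f)(x)=\int_{\varepsilon I_m<a<\rho I_m}\frac{(W_a^*\hat f)(x)}{|a|^{k/2}}\,d_*a$$ converges absolutely for almost every $x$ (as an integral in $(a,\xi,t)$) and defines a function in $L^2(\mathfrak M_{n,m})$, and $$c_w f=\lim_{\varepsilon\to0,\ \rho\to\infty}I_{\varepsilon,\rho}f\qquad\text{in }L^2(\mathfrak M_{n,m}).$$ -/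

import Mathlib

open MeasureTheory Filter Topology

namespace MatrixRadon

noncomputable section

/-- Lebesgue measure `dx = ∏ dx_{i,j}` on the space of real `n × m` matrices. -/
instance matrixMeasureSpace (n m : ℕ) : MeasureSpace (Matrix (Fin n) (Fin m) ℝ) :=
  inferInstanceAs (MeasureSpace (Fin n → Fin m → ℝ))

instance matrixBorelSpace (n m : ℕ) : BorelSpace (Matrix (Fin n) (Fin m) ℝ) :=
  inferInstanceAs (BorelSpace (Fin n → Fin m → ℝ))

/-! ### The cone of positive definite matrices -/

/-- The symmetric matrix with prescribed entries `r_{i,j}`, `i ≤ j`. -/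
def symOfUpper (m : ℕ) (c : {p : Fin m × Fin m // p.1 ≤ p.2} → ℝ) :
    Matrix (Fin m) (Fin m) ℝ :=
  Matrix.of fun i j => c ⟨(min i j, max i j), min_le_max⟩

/-- The measure `dr = ∏_{i ≤ j} dr_{i,j}` of the space of symmetric matrices, as a measure on all
square matrices. -/
def symVolume (m : ℕ) : Measure (Matrix (Fin m) (Fin m) ℝ) :=
  Measure.map (symOfUpper m) volume

/-- The `GL(m, ℝ)`-invariant measure `d_* r = |r|^{-(m+1)/2} dr` on the cone of positive definite
matrices, as a measure on all square matrices. -/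
def coneMeasure (m : ℕ) : Measure (Matrix (Fin m) (Fin m) ℝ) :=
  ((symVolume m).restrict {r | r.PosDef}).withDensity
    fun r => ENNReal.ofReal (r.det ^ (-((m : ℝ) + 1) / 2))

/-- The set of `a` with `ε I < a < ρ I`. -/
def coneInterval (m : ℕ) (ε ρ : ℝ) : Set (Matrix (Fin m) (Fin m) ℝ) :=
  {a | (a - ε • (1 : Matrix (Fin m) (Fin m) ℝ)).PosDef ∧
    (ρ • (1 : Matrix (Fin m) (Fin m) ℝ) - a).PosDef}

section Sqrt

open scoped MatrixOrder

/-- The positive semidefinite square root `a^{1/2}` of a positive semidefinite matrix. -/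
def rootMat {m : ℕ} (a : Matrix (Fin m) (Fin m) ℝ) : Matrix (Fin m) (Fin m) ℝ :=
  CFC.sqrt a

end Sqrt

/-- The symmetry condition `u(s^{1/2} r s^{1/2}) = u(r^{1/2} s r^{1/2})` for a function on the cone
of positive definite matrices. -/
def IsSymmetricOnCone {m : ℕ} (u : Matrix (Fin m) (Fin m) ℝ → ℂ) : Prop :=
  ∀ r s : Matrix (Fin m) (Fin m) ℝ, r.PosDef → s.PosDef →
    u (rootMat s * r * rootMat s) = u (rootMat r * s * rootMat r)

/-- The Siegel gamma function of the cone of positive definite `m × m` matrices. -/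
def siegelGamma (m : ℕ) (α : ℝ) : ℝ :=
  ∫ r in {r : Matrix (Fin m) (Fin m) ℝ | r.PosDef},
    Real.exp (-r.trace) * r.det ^ (α - ((m : ℝ) + 1) / 2) ∂(symVolume m)

/-- `σ_{n,m} = 2^m π^{nm/2} / Γ_m(n/2)`. -/
def stiefelVolume (n m : ℕ) : ℝ :=
  2 ^ m * Real.pi ^ ((n : ℝ) * m / 2) / siegelGamma m ((n : ℝ) / 2)

/-! ### Fourier transform -/

/-- `|x|_m = det(xᵀ x)^{1/2}`. -/
def volNorm {n m : ℕ} (x : Matrix (Fin n) (Fin m) ℝ) : ℝ :=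
  Real.sqrt (x.transpose * x).det

/-- The Fourier transform `y ↦ ∫ exp(i tr(yᵀ x)) f(x) dx`. -/
def fourierMat {n m : ℕ} (f : Matrix (Fin n) (Fin m) ℝ → ℂ) (y : Matrix (Fin n) (Fin m) ℝ) : ℂ :=
  ∫ x : Matrix (Fin n) (Fin m) ℝ,
    Complex.exp (Complex.I * (((y.transpose * x).trace : ℝ) : ℂ)) * f x

/-! ### The Stiefel manifold and its invariant probability measure -/

/-- The Stiefel manifold of orthonormal `q`-frames in `ℝⁿ`. -/
abbrev Stiefel (n q : ℕ) : Type :=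
  {ξ : Matrix (Fin n) (Fin q) ℝ // ξ.transpose * ξ = 1}

/-- The frame `[0; I_{n-k}]`. -/
def baseFrame (n k : ℕ) : Matrix (Fin n) (Fin (n - k)) ℝ :=
  Matrix.of fun i j => if (i : ℕ) = k + j then 1 else 0

theorem baseFrame_mem (n k : ℕ) : (baseFrame n k).transpose * baseFrame n k = 1 := by
  ext i j
  have hi : k + (i : ℕ) < n := by omega
  rw [Matrix.mul_apply, Finset.sum_eq_single (⟨k + i, hi⟩ : Fin n)]
  · by_cases h : i = j
    · subst h; simp [baseFrame]
    · have h' : (i : ℕ) ≠ j := fun e => h (Fin.ext e)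
      simp [baseFrame, h, h']
  · intro b _ hb
    have : (b : ℕ) ≠ k + i := fun e => hb (Fin.ext e)
    simp [baseFrame, this]
  · simp

/-- The real orthogonal group `O(n)` (the star operation of `ℝ` is trivial). -/
abbrev Orth (n : ℕ) : Type := Matrix.unitaryGroup (Fin n) ℝ

theorem orth_transpose_mul {n : ℕ} (g : Orth n) :
    (g : Matrix (Fin n) (Fin n) ℝ).transpose * (g : Matrix (Fin n) (Fin n) ℝ) = 1 := by
  have h := Matrix.mem_unitaryGroup_iff'.1 g.2
  rwa [Matrix.star_eq_conjTranspose, Matrix.conjTranspose_eq_transpose_of_trivial] at h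

instance orthCompactSpace (n : ℕ) : CompactSpace (Orth n) := by
  have hK : IsCompact (Set.pi Set.univ fun _ : Fin n => Set.pi Set.univ fun _ : Fin n =>
      Set.Icc (-1 : ℝ) 1) :=
    isCompact_univ_pi fun _ => isCompact_univ_pi fun _ => isCompact_Icc
  have hcl : IsClosed {g : Matrix (Fin n) (Fin n) ℝ | star g * g = 1} :=
    isClosed_eq (by fun_prop) continuous_const
  have hset : {g : Matrix (Fin n) (Fin n) ℝ | star g * g = 1} =
      (Matrix.unitaryGroup (Fin n) ℝ : Set (Matrix (Fin n) (Fin n) ℝ)) := by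
    ext g
    exact Matrix.mem_unitaryGroup_iff'.symm
  rw [hset] at hcl
  refine isCompact_iff_compactSpace.1 (IsCompact.of_isClosed_subset hK hcl ?_)
  intro g hg i _ j _
  have h := entry_norm_bound_of_unitary hg i j
  exact abs_le.1 (by simpa using h)

/-- The invariant measure of total mass one on `O(n)`. -/
def orthMeasure (n : ℕ) : Measure (Orth n) := Measure.haarMeasure ⊤

/-- The frame `g [0; I_{n-k}]`. -/
def rotateFrame (n k : ℕ) (g : Orth n) : Stiefel n (n - k) :=
  ⟨(g : Matrix (Fin n) (Fin n) ℝ) * baseFrame n k, by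
    rw [Matrix.transpose_mul, Matrix.mul_assoc,
      ← Matrix.mul_assoc (g : Matrix (Fin n) (Fin n) ℝ).transpose, orth_transpose_mul,
      Matrix.one_mul, baseFrame_mem]⟩

/-- The `O(n)`-invariant probability measure `d_* ξ` on the Stiefel manifold of orthonormal
`(n-k)`-frames in `ℝⁿ`. -/
def stiefelMeasure (n k : ℕ) : Measure (Stiefel n (n - k)) :=
  Measure.map (rotateFrame n k) (orthMeasure n)

/-! ### Radon transform and dual ridgelet transform -/

/-- The block matrix `[ω; t]`. -/
def stack {n k m : ℕ} (ω : Matrix (Fin k) (Fin m) ℝ) (t : Matrix (Fin (n - k)) (Fin m) ℝ) :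
    Matrix (Fin n) (Fin m) ℝ :=
  Matrix.of fun i j =>
    if h : (i : ℕ) < k then ω ⟨i, h⟩ j else t ⟨i - k, by omega⟩ j

/-- A rotation `g_ξ ∈ SO(n)` with `g_ξ [0; I_{n-k}] = ξ`. -/
def rotationOf {n k : ℕ} (ξ : Stiefel n (n - k)) : Matrix (Fin n) (Fin n) ℝ :=
  Classical.epsilon fun g =>
    g.transpose * g = 1 ∧ g.det = 1 ∧ g * baseFrame n k = (ξ : Matrix (Fin n) (Fin (n - k)) ℝ)

/-- The matrix `k`-plane Radon transform `f̂(ξ, t)`: the integral of `f` over the matrix `k`-plane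
`{x | ξᵀ x = t}`. -/
def radon {n k m : ℕ} (f : Matrix (Fin n) (Fin m) ℝ → ℂ) (ξ : Stiefel n (n - k))
    (t : Matrix (Fin (n - k)) (Fin m) ℝ) : ℂ :=
  ∫ ω : Matrix (Fin k) (Fin m) ℝ, f (rotationOf ξ * stack ω t)

/-- The scaled function `w_a(z) = |a|^{-q/2} w(z a^{-1/2})` on `q × m` matrices. -/
def scaled {q m : ℕ} (w : Matrix (Fin q) (Fin m) ℝ → ℂ) (a : Matrix (Fin m) (Fin m) ℝ)
    (z : Matrix (Fin q) (Fin m) ℝ) : ℂ :=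
  ((a.det ^ (-(q : ℝ) / 2) : ℝ) : ℂ) * w (z * (rootMat a)⁻¹)

/-- The dual continuous ridgelet transform
`(W_a^* φ)(x) = ∫ d_*ξ ∫ φ(ξ, t) w_a(ξᵀ x - t) dt`. -/
def dualRidgelet {n k m : ℕ} (w : Matrix (Fin (n - k)) (Fin m) ℝ → ℂ)
    (a : Matrix (Fin m) (Fin m) ℝ)
    (φ : Stiefel n (n - k) → Matrix (Fin (n - k)) (Fin m) ℝ → ℂ)
    (x : Matrix (Fin n) (Fin m) ℝ) : ℂ :=
  ∫ ξ : Stiefel n (n - k),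
    (∫ t : Matrix (Fin (n - k)) (Fin m) ℝ,
      φ ξ t * scaled w a ((ξ : Matrix (Fin n) (Fin (n - k)) ℝ).transpose * x - t))
    ∂(stiefelMeasure n k)

/-- The truncated integral `∫_{ε I}^{ρ I} W_a^* f̂ |a|^{-k/2} d_* a`. -/
def truncatedInversion {n m : ℕ} (k : ℕ) (w : Matrix (Fin (n - k)) (Fin m) ℝ → ℂ)
    (f : Matrix (Fin n) (Fin m) ℝ → ℂ) (ε ρ : ℝ) (x : Matrix (Fin n) (Fin m) ℝ) : ℂ :=
  ∫ a in coneInterval m ε ρ,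
    dualRidgelet w a (radon f) x * ((a.det ^ (-(k : ℝ) / 2) : ℝ) : ℂ) ∂(coneMeasure m)

/-- Admissible wavelet functions on `(n-k) × m` matrices. -/
structure IsAdmissible (n k m : ℕ) (w : Matrix (Fin (n - k)) (Fin m) ℝ → ℂ) : Prop where
  radial : ∃ w₀ : Matrix (Fin m) (Fin m) ℝ → ℂ, ∀ z, w z = w₀ (z.transpose * z)
  integrable : Integrable w
  symmetric : ∃ u₀ : Matrix (Fin m) (Fin m) ℝ → ℂ, IsSymmetricOnCone u₀ ∧
    ∀ y : Matrix (Fin (n - k)) (Fin m) ℝ, y.rank = m → fourierMat w y = u₀ (y.transpose * y)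
  finite : Integrable fun ζ : Matrix (Fin (n - k)) (Fin m) ℝ =>
    fourierMat w ζ / ((volNorm ζ ^ n : ℝ) : ℂ)

/-- `c_w = (2^{m(k+1)} π^{km} / σ_{n,m}) ∫ (F w)(ζ) / |ζ|_m^n dζ`. -/
def waveletConst (n k m : ℕ) (w : Matrix (Fin (n - k)) (Fin m) ℝ → ℂ) : ℂ :=
  ((2 ^ (m * (k + 1)) * Real.pi ^ (k * m) / stiefelVolume n m : ℝ) : ℂ) *
    ∫ ζ : Matrix (Fin (n - k)) (Fin m) ℝ, fourierMat w ζ / ((volNorm ζ ^ n : ℝ) : ℂ)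

end

end MatrixRadon

/-! On the Fourier side the truncated operator $I_{\varepsilon,\rho}$ is multiplication by a bounded
function that converges pointwise to the constant $c_w$; Plancherel and dominated convergence then
give the limit in $L^2$.

To find the multiplier, pair $I_{\varepsilon,\rho}f$ with a rapidly decreasing test function $\psi$.
Absolute convergence (`lintegral_decay_inversionKernel`) permits any order of integration. For fixed
$a$ and $\xi$ the integral over $x$ sees only the plane integrals of $\psi$, and the
projection-slice identity `fourierMat_radon`, $(\hat f(\xi,\cdot))^\sim(\eta)=\tilde f(\xi\eta)$,
turns the remaining convolution pairing into an integral over $\eta$ of $\tilde f(\xi\eta)\,\tilde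
w(\eta a^{1/2})\,\tilde\psi(-\xi\eta)$ (`IsTest.integral_radon_mul`). The pair $(\xi,\eta)$ enters
through $y=\xi\eta$ alone, and `map_frame_mul` says that $d_*\xi\,d\eta$ pushes forward to a
constant times $|y|_m^{-k}dy$. With $r=y'y$ and $\tilde w(\eta)=u(\eta'\eta)$ the multiplier is
therefore $\kappa(y)=C\,|r|^{-k/2}\int_{\varepsilon I<a<\rho I}|a|^{-k/2}u(a^{1/2}ra^{1/2})\,d_*a$.

The symmetry of $u$ replaces $a^{1/2}ra^{1/2}$ by $r^{1/2}ar^{1/2}$, which is a linear function of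
$a$. Invariance of $d_*a$ under $s=r^{1/2}ar^{1/2}$ gives $\kappa(y)=C\int|s|^{-k/2}u(s)\,d_*s$ over
a region which exhausts the cone (`multiplier_eq`). Convergence of the integral in $c_w$ is exactly
integrability of $|s|^{-k/2}u(s)$ for $d_*s$ (`profile_integral`), so $\kappa$ is bounded uniformly
in $\varepsilon,\rho$ and tends to $c_w$ (`waveletConst_eq`, `tendsto_multiplier`).

The measure theory rests on one fact, `IsConeInvariant.lintegral_mul_lintegral`: a $GL(m)$-invariant
measure on the cone is determined up to a factor, by a Fubini argument against Haar measure of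
$GL(m)$. The image of $|y|_m^{-N}dy$ under $y\mapsto y'y$ and the measure $d_*s$ are both invariant,
and a Gaussian fixes the factor as $\pi^{Nm/2}/\Gamma_m(N/2)$ (`lintegral_gram`). No Jacobian of
polar coordinates is needed; averaging over $O(n)$ gives the rest.

Finally, `inversion_l2` identifies the pointwise integral with the $L^2$ function defined by the
multiplier, since both have the same integrals against test functions. Measurable representatives of
$f$ and $w$ are used throughout, and restored at the end. -/

namespace MatrixRadon

/-! ### Lebesgue measure on spaces of matrices -/

/-- The space of real `n × m` matrices. -/
abbrev Mat (n m : ℕ) : Type := Matrix (Fin n) (Fin m) ℝ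

instance (n m : ℕ) : SigmaFinite (volume : Measure (Mat n m)) :=
  inferInstanceAs (SigmaFinite (volume : Measure (Fin n → Fin m → ℝ)))

instance (n m : ℕ) : (volume : Measure (Mat n m)).IsAddHaarMeasure :=
  (Measure.pi.isAddHaarMeasure _ : (volume : Measure (Fin n → Fin m → ℝ)).IsAddHaarMeasure)

instance (n m : ℕ) : PolishSpace (Mat n m) :=
  inferInstanceAs (PolishSpace (Fin n → Fin m → ℝ))

instance (n m : ℕ) : SecondCountableTopology (Mat n m) :=
  inferInstanceAs (SecondCountableTopology (Fin n → Fin m → ℝ))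

instance (n m : ℕ) : LocallyCompactSpace (Mat n m) :=
  inferInstanceAs (LocallyCompactSpace (Fin n → Fin m → ℝ))

theorem measurable_entry {n m : ℕ} (i : Fin n) (j : Fin m) :
    Measurable fun x : Mat n m => x i j :=
  (measurable_pi_apply j).comp (measurable_pi_apply (X := fun _ : Fin n => Fin m → ℝ) i)

theorem measurable_of_entries {α : Type*} [MeasurableSpace α] {n m : ℕ} {f : α → Mat n m}
    (h : ∀ i j, Measurable fun a => f a i j) : Measurable f :=
  measurable_pi_lambda _ fun i => measurable_pi_lambda _ fun j => h i j

theorem measurable_mul {α : Type*} [MeasurableSpace α] {n m p : ℕ} {f : α → Mat n m}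
    {g : α → Mat m p} (hf : Measurable f) (hg : Measurable g) :
    Measurable fun a => f a * g a := by
  refine measurable_of_entries fun i j => ?_
  simp only [Matrix.mul_apply]
  exact Finset.measurable_sum _ fun l _ =>
    ((measurable_entry i l).comp hf).mul ((measurable_entry l j).comp hg)

theorem measurable_det (n : ℕ) : Measurable fun x : Mat n n => x.det :=
  (continuous_id.matrix_det).measurable

theorem measurable_inv (n : ℕ) : Measurable fun x : Mat n n => x⁻¹ := by
  have : (fun x : Mat n n => x⁻¹) = fun x => Ring.inverse x.det • x.adjugate := by
    ext1 x; rw [Matrix.inv_def]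
  rw [this]
  refine measurable_of_entries fun i j => ?_
  simp only [Matrix.smul_apply, smul_eq_mul, Ring.inverse_eq_inv']
  exact (measurable_det n).inv.mul
    ((measurable_entry i j).comp (continuous_id.matrix_adjugate).measurable)

theorem measurable_transpose {n m : ℕ} : Measurable fun x : Mat n m => x.transpose :=
  (continuous_id.matrix_transpose).measurable

/-- Each of the $n$ rows is transformed separately by $p'$, so the map is a product of $n$ copies of
one map. The left-hand analogue follows by transposition. -/
theorem det_mulRightLinearMap_pi (n m : ℕ) (p : Mat m m) :
    LinearMap.det (mulRightLinearMap (Fin n) ℝ p : Mat n m →ₗ[ℝ] Mat n m) = p.det ^ n := by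
  have h := LinearMap.det_pi (R := ℝ) (ι := Fin n) (M := Fin m → ℝ)
    fun _ => Matrix.toLin' p.transpose
  rw [LinearMap.det_toLin', Matrix.det_transpose, Finset.prod_const, Finset.card_univ,
    Fintype.card_fin] at h
  rw [← h]
  congr 1
  ext x i j
  simp only [mulRightLinearMap_apply, Matrix.mul_apply, mul_comm (x _ _)]
  rfl

theorem det_mulLeftLinearMap_pi (n m : ℕ) (g : Mat n n) :
    LinearMap.det (mulLeftLinearMap (Fin m) ℝ g : Mat n m →ₗ[ℝ] Mat n m) = g.det ^ m := by
  rw [← LinearMap.det_conj _ (Matrix.transposeLinearEquiv (Fin n) (Fin m) ℝ ℝ),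
    ← Matrix.det_transpose, ← det_mulRightLinearMap_pi]
  congr 1
  ext x i j
  simp [Matrix.mul_apply, mul_comm]

theorem map_linearMap_volume {n m : ℕ} (f : Mat n m →ₗ[ℝ] Mat n m) (hf : LinearMap.det f ≠ 0) :
    Measure.map f volume = ENNReal.ofReal |(LinearMap.det f)⁻¹| • (volume : Measure (Mat n m)) :=
  Measure.map_linearMap_addHaar_eq_smul_addHaar (E := Fin n → Fin m → ℝ) volume hf

/-- Right multiplication by an invertible matrix. -/
noncomputable def mulRightEquiv (n : ℕ) {m : ℕ} (p : Mat m m) (hp : p.det ≠ 0) :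
    Mat n m ≃ᵐ Mat n m where
  toFun x := x * p
  invFun x := x * p⁻¹
  left_inv x := by
    dsimp only
    rw [Matrix.mul_assoc, Matrix.mul_nonsing_inv _ hp.isUnit, Matrix.mul_one]
  right_inv x := by
    dsimp only
    rw [Matrix.mul_assoc, Matrix.nonsing_inv_mul _ hp.isUnit, Matrix.mul_one]
  measurable_toFun := measurable_mul measurable_id measurable_const
  measurable_invFun := measurable_mul measurable_id measurable_const

/-- Left multiplication by an invertible matrix. -/
noncomputable def mulLeftEquiv {n : ℕ} (m : ℕ) (g : Mat n n) (hg : g.det ≠ 0) :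
    Mat n m ≃ᵐ Mat n m where
  toFun x := g * x
  invFun x := g⁻¹ * x
  left_inv x := by
    dsimp only
    rw [← Matrix.mul_assoc, Matrix.nonsing_inv_mul _ hg.isUnit, Matrix.one_mul]
  right_inv x := by
    dsimp only
    rw [← Matrix.mul_assoc, Matrix.mul_nonsing_inv _ hg.isUnit, Matrix.one_mul]
  measurable_toFun := measurable_mul measurable_const measurable_id
  measurable_invFun := measurable_mul measurable_const measurable_id

theorem map_mulRightEquiv (n : ℕ) {m : ℕ} (p : Mat m m) (hp : p.det ≠ 0) :
    Measure.map (mulRightEquiv n p hp) volume = ENNReal.ofReal (|p.det|⁻¹ ^ n) • volume := by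
  have h := map_linearMap_volume (mulRightLinearMap (Fin n) ℝ p : Mat n m →ₗ[ℝ] Mat n m)
    (by rw [det_mulRightLinearMap_pi]; exact pow_ne_zero _ hp)
  rw [det_mulRightLinearMap_pi, abs_inv, abs_pow, ← inv_pow] at h
  exact h

theorem map_mulLeftEquiv {n : ℕ} (m : ℕ) (g : Mat n n) (hg : g.det ≠ 0) :
    Measure.map (mulLeftEquiv m g hg) volume = ENNReal.ofReal (|g.det|⁻¹ ^ m) • volume := by
  have h := map_linearMap_volume (mulLeftLinearMap (Fin m) ℝ g : Mat n m →ₗ[ℝ] Mat n m)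
    (by rw [det_mulLeftLinearMap_pi]; exact pow_ne_zero _ hg)
  rw [det_mulLeftLinearMap_pi, abs_inv, abs_pow, ← inv_pow] at h
  exact h

theorem lintegral_mul_right {n m : ℕ} (p : Mat m m) (hp : p.det ≠ 0) (F : Mat n m → ENNReal) :
    ∫⁻ x : Mat n m, F (x * p) = ENNReal.ofReal (|p.det|⁻¹ ^ n) * ∫⁻ x, F x := by
  rw [← smul_eq_mul, ← lintegral_smul_measure, ← map_mulRightEquiv n p hp,
    lintegral_map_equiv]
  rfl

theorem lintegral_mul_left {n m : ℕ} (g : Mat n n) (hg : g.det ≠ 0) (F : Mat n m → ENNReal) :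
    ∫⁻ x : Mat n m, F (g * x) = ENNReal.ofReal (|g.det|⁻¹ ^ m) * ∫⁻ x, F x := by
  rw [← smul_eq_mul, ← lintegral_smul_measure, ← map_mulLeftEquiv m g hg,
    lintegral_map_equiv]
  rfl

theorem integral_mul_right {n m : ℕ} (p : Mat m m) (hp : p.det ≠ 0) (F : Mat n m → ℂ) :
    ∫ x : Mat n m, F (x * p) = (|p.det|⁻¹ ^ n : ℝ) • ∫ x, F x := by
  have h : (|p.det|⁻¹ ^ n : ℝ) = (ENNReal.ofReal (|p.det|⁻¹ ^ n)).toReal :=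
    (ENNReal.toReal_ofReal (by positivity)).symm
  rw [h, ← integral_smul_measure, ← map_mulRightEquiv n p hp, integral_map_equiv]
  rfl

theorem measurePreserving_orth {n : ℕ} (m : ℕ) (g : Mat n n) (hg : g.transpose * g = 1) :
    MeasurePreserving (fun x : Mat n m => g * x) := by
  have hd : |g.det| = 1 := by
    have := congrArg Matrix.det hg
    rw [Matrix.det_mul, Matrix.det_transpose, Matrix.det_one] at this
    rw [← pow_eq_one_iff_of_nonneg (abs_nonneg _) two_ne_zero, sq_abs, sq, this]
  have h0 : g.det ≠ 0 := fun h => by simp [h] at hd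
  refine ⟨measurable_mul measurable_const measurable_id, ?_⟩
  have := map_mulLeftEquiv m g h0
  rw [hd, inv_one, one_pow, ENNReal.ofReal_one, one_smul] at this
  exact this

/-- Left multiplication by an orthogonal matrix. -/
theorem measurableEmbedding_orth {n : ℕ} (m : ℕ) (g : Mat n n) (hg : g.transpose * g = 1) :
    MeasurableEmbedding (fun x : Mat n m => g * x) := by
  have h0 : g.det ≠ 0 := fun h => by
    have := congrArg Matrix.det hg
    simp [h] at this
  exact (mulLeftEquiv m g h0).measurableEmbedding

/-- Matrices of the form `[ω; t]`, as a measurable equivalence. -/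
noncomputable def stackEquiv (n k m : ℕ) (hkn : k ≤ n) :
    Mat k m × Mat (n - k) m ≃ᵐ Mat n m :=
  (MeasurableEquiv.sumPiEquivProdPi (fun _ : Fin k ⊕ Fin (n - k) => Fin m → ℝ)).symm.trans
    (MeasurableEquiv.piCongrLeft (fun _ : Fin n => Fin m → ℝ)
      (finSumFinEquiv.trans (finCongr (Nat.add_sub_of_le hkn))))

theorem stackEquiv_apply (n k m : ℕ) (hkn : k ≤ n) (p : Mat k m × Mat (n - k) m) :
    stackEquiv n k m hkn p = stack p.1 p.2 := by
  set e := finSumFinEquiv.trans (finCongr (Nat.add_sub_of_le hkn)) with he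
  ext i j
  obtain ⟨i, rfl⟩ := e.surjective i
  have : stackEquiv n k m hkn p (e i) =
    (MeasurableEquiv.sumPiEquivProdPi (fun _ : Fin k ⊕ Fin (n - k) => Fin m → ℝ)).symm p i :=
    Equiv.piCongrLeft_apply_apply (fun _ : Fin n => Fin m → ℝ) e _ i
  rw [this]
  rcases i with i | i
  · have h : ((e (Sum.inl i) : Fin n) : ℕ) = i := by simp [he]
    simp only [stack, Matrix.of_apply, h, i.2, dite_true]
    rfl
  · have h : ((e (Sum.inr i) : Fin n) : ℕ) = k + i := by simp [he]
    have h' : ¬ k + (i : ℕ) < k := by omega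
    simp only [stack, Matrix.of_apply, h, h', dite_false, add_tsub_cancel_left]
    rfl

theorem measurePreserving_stackEquiv (n k m : ℕ) (hkn : k ≤ n) :
    MeasurePreserving (stackEquiv n k m hkn) :=
  (volume_measurePreserving_piCongrLeft (fun _ : Fin n => Fin m → ℝ) _).comp
    (volume_measurePreserving_sumPiEquivProdPi_symm _)

/-- The determinant of a square matrix vanishes only on a null set. -/
theorem ae_det_ne_zero_of_shift {n m : ℕ} (e b : Mat n m) (hb : b.transpose * e = 1) :
    ∀ᵐ y : Mat n m, (b.transpose * y).det ≠ 0 := by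
  set Z : Set (Mat n m) := {y | (b.transpose * y).det = 0} with hZ
  have hZm : MeasurableSet Z := by
    have : Measurable fun y : Mat n m => (b.transpose * y).det :=
      (measurable_det m).comp (measurable_mul measurable_const measurable_id)
    exact this (measurableSet_singleton 0)
  have hshift : Measurable fun p : ℝ × Mat n m => p.2 + p.1 • e :=
    Continuous.measurable (by fun_prop)
  -- On a line in direction $e$ the determinant is $\det(b'y+cI)$, the characteristic polynomial of
  -- $-b'y$ at $c$, with finitely many roots. Tonelli and translation invariance then give
  -- $|Z|\cdot\infty=0$.
  have key : ∀ y : Mat n m, ∫⁻ c : ℝ, Z.indicator 1 (y + c • e) = 0 := by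
    intro y
    have hfin : {c : ℝ | y + c • e ∈ Z}.Finite := by
      have hsub : {c : ℝ | y + c • e ∈ Z} ⊆
          {c : ℝ | (-(b.transpose * y)).charpoly.IsRoot c} := by
        intro c hc
        simp only [hZ, Set.mem_ofPred_eq, Matrix.mul_add, Matrix.mul_smul, hb] at hc
        simp only [Set.mem_ofPred_eq, Polynomial.IsRoot, Matrix.eval_charpoly]
        rw [← hc]
        congr 1
        ext i j
        simp [Matrix.one_apply, Matrix.scalar_apply, Matrix.diagonal_apply, add_comm]
      exact (Polynomial.finite_setOfPred_isRoot (Matrix.charpoly_monic _).ne_zero).subset hsub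
    have h0 : ∀ᵐ c : ℝ, Z.indicator (1 : Mat n m → ENNReal) (y + c • e) = 0 := by
      filter_upwards [hfin.countable.ae_notMem volume] with c hc
      exact Set.indicator_of_notMem hc _
    rw [lintegral_congr_ae h0, lintegral_zero]
  have hswap : ∫⁻ y : Mat n m, ∫⁻ c : ℝ, Z.indicator 1 (y + c • e) =
      ∫⁻ c : ℝ, ∫⁻ y : Mat n m, Z.indicator 1 (y + c • e) := by
    refine lintegral_lintegral_swap (Measurable.aemeasurable ?_)
    exact (measurable_one.indicator hZm).comp (hshift.comp measurable_swap)
  simp only [key, lintegral_zero] at hswap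
  have hconst : ∀ c : ℝ, ∫⁻ y : Mat n m, Z.indicator 1 (y + c • e) = volume Z := by
    intro c
    rw [lintegral_add_right_eq_self (fun y => Z.indicator 1 y) (c • e), lintegral_indicator_one hZm]
  simp only [hconst, lintegral_const] at hswap
  have : volume Z = 0 := by
    by_contra h
    simp [h] at hswap
  exact measure_eq_zero_iff_ae_notMem.1 this

theorem ae_det_ne_zero (m : ℕ) : ∀ᵐ x : Mat m m, x.det ≠ 0 := by
  have := ae_det_ne_zero_of_shift (1 : Mat m m) 1 (by simp)
  simpa using this

/-- The first coordinate frame `[I_m; 0]`. -/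
noncomputable def topFrame (n m : ℕ) : Mat n m := Matrix.of fun i j => if (i : ℕ) = j then 1 else 0

theorem topFrame_mem {n m : ℕ} (h : m ≤ n) : (topFrame n m).transpose * topFrame n m = 1 := by
  ext i j
  have hi : (i : ℕ) < n := by omega
  rw [Matrix.mul_apply, Finset.sum_eq_single (⟨i, hi⟩ : Fin n)]
  · by_cases h : i = j
    · subst h; simp [topFrame]
    · have h' : (i : ℕ) ≠ j := fun e => h (Fin.ext e)
      simp [topFrame, h, h']
  · intro b _ hb
    have : (b : ℕ) ≠ i := fun e => hb (Fin.ext e)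
    simp [topFrame, this]
  · simp

theorem posDef_gram_iff {n m : ℕ} (y : Mat n m) :
    (y.transpose * y).PosDef ↔ Function.Injective y.mulVec := by
  rw [← Matrix.conjTranspose_eq_transpose_of_trivial]
  refine ⟨fun h u v huv => ?_, fun h => Matrix.PosDef.conjTranspose_mul_self y h⟩
  by_contra hne
  have := h.dotProduct_mulVec_pos (sub_ne_zero.2 hne)
  rw [← Matrix.mulVec_mulVec, Matrix.mulVec_sub, huv] at this
  simp at this

/-- Almost every `n × m` matrix with `m ≤ n` has rank `m`. -/
theorem ae_posDef_gram {n m : ℕ} (h : m ≤ n) : ∀ᵐ y : Mat n m, (y.transpose * y).PosDef := by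
  filter_upwards [ae_det_ne_zero_of_shift (topFrame n m) (topFrame n m) (topFrame_mem h)] with y hy
  rw [posDef_gram_iff]
  have h1 : Function.Injective ((topFrame n m).transpose * y).mulVec :=
    Matrix.mulVec_injective_iff_isUnit.2 ((Matrix.isUnit_iff_isUnit_det _).2 hy.isUnit)
  intro u v huv
  apply h1
  simp only [← Matrix.mulVec_mulVec, huv]

theorem rank_eq_of_posDef_gram {n m : ℕ} {y : Mat n m} (h : (y.transpose * y).PosDef) :
    y.rank = m := by
  rw [← Matrix.rank_transpose_mul_self, Matrix.rank_of_isUnit _ h.isUnit, Fintype.card_fin]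

/-! ### Positive definite matrices and square roots -/

section Sqrt

open scoped MatrixOrder

theorem rootMat_posSemidef {m : ℕ} (a : Mat m m) : (rootMat a).PosSemidef :=
  Matrix.nonneg_iff_posSemidef.1 (CFC.sqrt_nonneg a)

theorem rootMat_mul_self {m : ℕ} {a : Mat m m} (ha : a.PosSemidef) :
    rootMat a * rootMat a = a :=
  CFC.sqrt_mul_sqrt_self a ha.nonneg

theorem rootMat_unique {m : ℕ} {a b : Mat m m} (h : b * b = a) (hb : b.PosSemidef) :
    rootMat a = b :=
  CFC.sqrt_unique h hb.nonneg

theorem rootMat_of_not_posSemidef {m : ℕ} {a : Mat m m} (ha : ¬ a.PosSemidef) :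
    rootMat a = 0 := by
  unfold rootMat CFC.sqrt
  exact cfcₙ_apply_of_not_predicate _ fun h => ha (Matrix.nonneg_iff_posSemidef.1 h)

end Sqrt

theorem transpose_rootMat {m : ℕ} (a : Mat m m) : (rootMat a).transpose = rootMat a := by
  have := (rootMat_posSemidef a).1
  rwa [Matrix.IsHermitian, Matrix.conjTranspose_eq_transpose_of_trivial] at this

theorem det_rootMat_sq {m : ℕ} {a : Mat m m} (ha : a.PosSemidef) :
    (rootMat a).det ^ 2 = a.det := by
  rw [sq, ← Matrix.det_mul, rootMat_mul_self ha]

theorem det_rootMat_pos {m : ℕ} {a : Mat m m} (ha : a.PosDef) : 0 < (rootMat a).det := by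
  have h := det_rootMat_sq ha.posSemidef
  refine lt_of_le_of_ne (rootMat_posSemidef a).det_nonneg fun h0 => ?_
  rw [← h0] at h
  have := ha.det_pos
  simp at h
  linarith

theorem det_rootMat_ne_zero {m : ℕ} {a : Mat m m} (ha : a.PosDef) : (rootMat a).det ≠ 0 :=
  (det_rootMat_pos ha).ne'

theorem det_rootMat {m : ℕ} {a : Mat m m} (ha : a.PosDef) :
    (rootMat a).det = a.det ^ (1 / 2 : ℝ) := by
  rw [← det_rootMat_sq ha.posSemidef, ← Real.sqrt_eq_rpow, Real.sqrt_sq (det_rootMat_pos ha).le]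

theorem posDef_conj {m : ℕ} {a : Mat m m} (ha : a.PosDef) {g : Mat m m} (hg : g.det ≠ 0) :
    (g * a * g.transpose).PosDef := by
  have hu : Function.Injective g.vecMul :=
    Matrix.vecMul_injective_iff_isUnit.2 ((Matrix.isUnit_iff_isUnit_det _).2 hg.isUnit)
  simpa [Matrix.conjTranspose_eq_transpose_of_trivial] using
    ha.mul_mul_conjTranspose_same (B := g) hu

theorem posDef_conj_iff {m : ℕ} {a : Mat m m} {g : Mat m m} (hg : g.det ≠ 0) :
    (g * a * g.transpose).PosDef ↔ a.PosDef := by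
  refine ⟨fun h => ?_, fun h => posDef_conj h hg⟩
  have h' := posDef_conj h (g := g⁻¹) (by
    rw [Matrix.det_nonsing_inv, Ring.inverse_eq_inv']; exact inv_ne_zero hg)
  rwa [Matrix.transpose_nonsing_inv, Matrix.mul_assoc, Matrix.mul_assoc, Matrix.mul_assoc,
    Matrix.mul_nonsing_inv _ (by rw [Matrix.det_transpose]; exact hg.isUnit), Matrix.mul_one,
    Matrix.nonsing_inv_mul_cancel_left _ _ hg.isUnit] at h'

theorem isClosed_posSemidef (m : ℕ) : IsClosed {a : Mat m m | a.PosSemidef} := by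
  have : {a : Mat m m | a.PosSemidef} =
      {a | a.conjTranspose = a} ∩ ⋂ x : Fin m → ℝ, {a | 0 ≤ star x ⬝ᵥ a.mulVec x} := by
    ext a
    simp only [Set.mem_ofPred_eq, Set.mem_inter_iff, Set.mem_iInter]
    exact ⟨fun h => ⟨h.1, fun x => h.dotProduct_mulVec_nonneg x⟩,
      fun h => Matrix.PosSemidef.of_dotProduct_mulVec_nonneg h.1 h.2⟩
  rw [this]
  refine (isClosed_eq (by fun_prop) continuous_id).inter (isClosed_iInter fun x => ?_)
  exact isClosed_le continuous_const (by fun_prop)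

theorem posDef_iff_posSemidef_det {m : ℕ} {a : Mat m m} :
    a.PosDef ↔ a.PosSemidef ∧ a.det ≠ 0 :=
  ⟨fun h => ⟨h.posSemidef, h.det_pos.ne'⟩, fun h =>
    h.1.posDef_iff_isUnit.2 ((Matrix.isUnit_iff_isUnit_det _).2 h.2.isUnit)⟩

theorem measurableSet_posDef (m : ℕ) : MeasurableSet {a : Mat m m | a.PosDef} := by
  have : {a : Mat m m | a.PosDef} = {a | a.PosSemidef} ∩ {a | a.det = 0}ᶜ := by
    ext a; exact posDef_iff_posSemidef_det
  rw [this]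
  exact (isClosed_posSemidef m).measurableSet.inter
    ((measurable_det m) (measurableSet_singleton 0)).compl

/-- On semidefinite matrices the root inverts the continuous injective squaring map, and injective
continuous images of Borel sets are Borel (Lusin–Souslin). Elsewhere the root has the default value
0. -/
theorem measurable_rootMat (m : ℕ) : Measurable (rootMat : Mat m m → Mat m m) := by
  classical
  intro B hB
  set P := {a : Mat m m | a.PosSemidef} with hP
  have hPm : MeasurableSet P := (isClosed_posSemidef m).measurableSet
  have hinj : Set.InjOn (fun a : Mat m m => a * a) (B ∩ P) := by
    intro a ha b hb hab
    rw [← rootMat_unique rfl ha.2, ← rootMat_unique rfl hb.2]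
    exact congrArg rootMat hab
  have himg : MeasurableSet ((fun a : Mat m m => a * a) '' (B ∩ P)) :=
    (hB.inter hPm).image_of_continuousOn_injOn (by fun_prop) hinj
  have : rootMat ⁻¹' B = ((fun a : Mat m m => a * a) '' (B ∩ P)) ∪
      (if (0 : Mat m m) ∈ B then Pᶜ else ∅) := by
    ext a
    by_cases ha : a ∈ P
    · have : a ∉ (if (0 : Mat m m) ∈ B then Pᶜ else ∅) := by
        split_ifs <;> simp [ha]
      rw [Set.mem_union, or_iff_left this, Set.mem_preimage]
      refine ⟨fun h => ⟨rootMat a, ⟨h, rootMat_posSemidef a⟩, rootMat_mul_self ha⟩, ?_⟩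
      rintro ⟨b, hb, rfl⟩
      rw [rootMat_unique rfl hb.2]
      exact hb.1
    · have h1 : a ∉ (fun a : Mat m m => a * a) '' (B ∩ P) := by
        rintro ⟨b, hb, rfl⟩
        apply ha
        have : (b * b).PosSemidef := by
          have h := Matrix.posSemidef_conjTranspose_mul_self b
          rwa [hb.2.1] at h
        exact this
      rw [Set.mem_union, or_iff_right h1, Set.mem_preimage, rootMat_of_not_posSemidef ha]
      split_ifs with h <;> simp [h, ha]
  rw [this]
  refine himg.union ?_
  split_ifs
  exacts [hPm.compl, MeasurableSet.empty]

theorem measurableSet_coneInterval (m : ℕ) (ε ρ : ℝ) : MeasurableSet (coneInterval m ε ρ) := by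
  refine MeasurableSet.inter ?_ ?_
  · exact (show Measurable fun a : Mat m m => a - ε • (1 : Mat m m) from
      Continuous.measurable (by fun_prop)) (measurableSet_posDef m)
  · exact (show Measurable fun a : Mat m m => ρ • (1 : Mat m m) - a from
      Continuous.measurable (by fun_prop)) (measurableSet_posDef m)

theorem posDef_smul_one {m : ℕ} {ε : ℝ} (hε : 0 < ε) : (ε • (1 : Mat m m)).PosDef :=
  Matrix.PosDef.one.smul hε

theorem posDef_of_mem_coneInterval {m : ℕ} {ε ρ : ℝ} (hε : 0 < ε) {a : Mat m m}
    (ha : a ∈ coneInterval m ε ρ) : a.PosDef := by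
  have := ha.1.add (posDef_smul_one hε)
  simpa using this

/-- A positive definite matrix dominates a positive multiple of the identity. -/
theorem PosDef.exists_sub_smul {m : ℕ} {a : Mat m m} (ha : a.PosDef) :
    ∃ δ : ℝ, 0 < δ ∧ ∀ ε < δ, (a - ε • (1 : Mat m m)).PosDef := by
  have hcpt : IsCompact (Metric.sphere (0 : EuclideanSpace ℝ (Fin m)) 1) := isCompact_sphere _ _
  set Q : EuclideanSpace ℝ (Fin m) → ℝ := fun x => x.ofLp ⬝ᵥ a.mulVec x.ofLp with hQ
  have hQc : Continuous Q := by
    simp only [hQ, dotProduct, Matrix.mulVec]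
    fun_prop
  -- The quadratic form is positive on the compact unit sphere, so it has a positive lower bound
  -- $\delta$ there; homogeneity carries the bound to all vectors.
  have hpos : ∀ x ∈ Metric.sphere (0 : EuclideanSpace ℝ (Fin m)) 1, 0 < Q x := by
    intro x hx
    have hx0 : x.ofLp ≠ 0 := by
      intro h
      have : x = 0 := by ext i; exact congrFun h i
      simp [this] at hx
    simpa using ha.dotProduct_mulVec_pos hx0
  obtain ⟨δ, hδ, hδQ⟩ := hcpt.exists_forall_le' hQc.continuousOn hpos
  refine ⟨δ, hδ, fun ε hε => Matrix.PosDef.of_dotProduct_mulVec_pos ?_ fun x hx => ?_⟩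
  · refine ha.1.sub ?_
    simp [Matrix.IsHermitian]
  · set y : EuclideanSpace ℝ (Fin m) := WithLp.toLp 2 x with hy
    have hy0 : y ≠ 0 := by
      intro h; apply hx; ext i; exact congrArg (fun z : EuclideanSpace ℝ (Fin m) => z i) h
    have hn : 0 < ‖y‖ := norm_pos_iff.2 hy0
    have h1 := hδQ (‖y‖⁻¹ • y) (by simp [norm_smul, hn.ne'])
    have h2 : Q (‖y‖⁻¹ • y) = (‖y‖ ^ 2)⁻¹ * (x ⬝ᵥ a.mulVec x) := by
      simp only [hQ, hy, WithLp.ofLp_smul, Matrix.mulVec_smul, dotProduct_smul,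
        smul_dotProduct, smul_eq_mul]
      ring
    have h3 : x ⬝ᵥ x = ‖y‖ ^ 2 := by
      rw [EuclideanSpace.real_norm_sq_eq]
      simp [dotProduct, hy, sq]
    rw [h2] at h1
    have h4 : δ * ‖y‖ ^ 2 ≤ x ⬝ᵥ a.mulVec x := by
      have := mul_le_mul_of_nonneg_right h1 (sq_nonneg ‖y‖)
      rwa [mul_right_comm, inv_mul_cancel₀ (by positivity), one_mul] at this
    have h5 : ε * ‖y‖ ^ 2 < δ * ‖y‖ ^ 2 := mul_lt_mul_of_pos_right hε (by positivity)
    simp only [star_trivial, Matrix.sub_mulVec, Matrix.smul_mulVec, Matrix.one_mulVec,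
      dotProduct_sub, dotProduct_smul, smul_eq_mul, h3]
    linarith

/-- A positive definite matrix is dominated by a multiple of the identity. -/
theorem PosDef.exists_smul_sub {m : ℕ} {a : Mat m m} (ha : a.PosDef) :
    ∃ R : ℝ, ∀ ρ > R, (ρ • (1 : Mat m m) - a).PosDef := by
  obtain ⟨δ, hδ, h⟩ := PosDef.exists_sub_smul ha.inv
  have hu : IsUnit a.det := ha.det_pos.ne'.isUnit
  refine ⟨δ⁻¹, fun ρ hρ => ?_⟩
  have hρ0 : 0 < ρ := (inv_pos.2 hδ).trans hρ
  have h1 := h ρ⁻¹ (inv_lt_of_inv_lt₀ hδ hρ)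
  set r := rootMat a
  have hr : r * r = a := rootMat_mul_self ha.posSemidef
  have hrt : r.transpose = r := transpose_rootMat a
  have hr0 : r.det ≠ 0 := det_rootMat_ne_zero ha
  -- The lower bound $a^{-1}>\rho^{-1}I$, conjugated by $a^{1/2}$ and multiplied by $\rho$, is the
  -- desired upper bound $\rho I>a$.
  have h2 := (posDef_conj h1 hr0).smul hρ0
  have h3 : r * a⁻¹ * r = 1 := by
    rw [← hr, Matrix.mul_inv_rev, ← Matrix.mul_assoc, Matrix.mul_nonsing_inv _ hr0.isUnit,
      Matrix.one_mul, Matrix.nonsing_inv_mul _ hr0.isUnit]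
  rw [hrt, Matrix.mul_sub, Matrix.sub_mul, h3, Matrix.mul_smul, Matrix.mul_one, Matrix.smul_mul,
    hr, smul_sub, smul_smul, mul_inv_cancel₀ hρ0.ne', one_smul] at h2
  exact h2

/-! ### Orthonormal frames -/

theorem exists_orth_extension {n p : ℕ} (hp : p ≤ n) (ξ : Mat n p) (hξ : ξ.transpose * ξ = 1) :
    ∃ g : Mat n n, g.transpose * g = 1 ∧ g * topFrame n p = ξ := by
  classical
  set c : Fin p → Fin n := Fin.castLE hp with hc
  have hcinj : Function.Injective c := Fin.castLE_injective hp
  set u : Fin p → EuclideanSpace ℝ (Fin n) := fun j => WithLp.toLp 2 fun i => ξ i j with hu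
  have huo : Orthonormal ℝ u := by
    rw [orthonormal_iff_ite]
    intro i j
    have := congrFun (congrFun hξ i) j
    rw [Matrix.mul_apply, Matrix.one_apply] at this
    rw [← this]
    simp [hu, PiLp.inner_apply, mul_comm]
  -- Only the values on the range of `c` are prescribed; the zeros elsewhere are discarded when the
  -- family is completed to an orthonormal basis.
  set v : Fin n → EuclideanSpace ℝ (Fin n) := Function.extend c u 0 with hv
  have hvo : Orthonormal ℝ ((Set.range c).domRestrict v) := by
    have h1 : ∀ x : Set.range c, ∃ j, c j = x := fun x => x.2
    choose s hs using h1
    have h2 : (Set.range c).domRestrict v = u ∘ s := by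
      ext1 x
      simp only [Set.domRestrict_apply, Function.comp, hv]
      rw [← hs x, hcinj.extend_apply]
    rw [h2]
    refine huo.comp s fun x y hxy => ?_
    apply Subtype.ext
    rw [← hs x, ← hs y, hxy]
  obtain ⟨b, hb⟩ := hvo.exists_orthonormalBasis_extension_of_card_eq (by simp)
  refine ⟨Matrix.of fun i l => b l i, ?_, ?_⟩
  · ext i j
    have := orthonormal_iff_ite.1 b.orthonormal i j
    rw [Matrix.mul_apply, Matrix.one_apply, ← this]
    simp [PiLp.inner_apply, mul_comm]
  · ext i j
    rw [Matrix.mul_apply, Finset.sum_eq_single (c j)]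
    · have h1 : b (c j) = u j := by
        rw [hb (c j) ⟨j, rfl⟩, hv, hcinj.extend_apply]
      rw [Matrix.of_apply, h1]
      simp [topFrame, hu, hc]
    · intro l _ hl
      have : (l : ℕ) ≠ j := fun e => hl (Fin.ext e)
      simp [topFrame, this]
    · simp

theorem orth_mul_transpose {n : ℕ} {g : Mat n n} (hg : g.transpose * g = 1) :
    g * g.transpose = 1 :=
  mul_eq_one_comm.1 hg

/-- The orthogonal group acts transitively on orthonormal frames. -/
theorem exists_orth_mul_eq {n p : ℕ} (hp : p ≤ n) (η ξ : Mat n p) (hη : η.transpose * η = 1)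
    (hξ : ξ.transpose * ξ = 1) : ∃ g : Mat n n, g.transpose * g = 1 ∧ g * η = ξ := by
  obtain ⟨g₁, h₁, rfl⟩ := exists_orth_extension hp η hη
  obtain ⟨g₂, h₂, rfl⟩ := exists_orth_extension hp ξ hξ
  refine ⟨g₂ * g₁.transpose, ?_, ?_⟩
  · rw [Matrix.transpose_mul, Matrix.transpose_transpose, Matrix.mul_assoc,
      ← Matrix.mul_assoc g₂.transpose, h₂, Matrix.one_mul, orth_mul_transpose h₁]
  · rw [Matrix.mul_assoc, ← Matrix.mul_assoc g₁.transpose, h₁, Matrix.one_mul]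

/-- An orthogonal matrix as an element of the orthogonal group. -/
def toOrth {n : ℕ} (g : Mat n n) (hg : g.transpose * g = 1) : Orth n :=
  ⟨g, Matrix.mem_unitaryGroup_iff'.2 (by
    rwa [Matrix.star_eq_conjTranspose, Matrix.conjTranspose_eq_transpose_of_trivial])⟩

theorem rotateFrame_surjective (n k : ℕ) : Function.Surjective (rotateFrame n k) := by
  intro ξ
  obtain ⟨g, hg, h⟩ := exists_orth_mul_eq (Nat.sub_le n k) (baseFrame n k) ξ.1
    (baseFrame_mem n k) ξ.2
  exact ⟨toOrth g hg, Subtype.ext h⟩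

theorem rotationOf_spec {n k : ℕ} (hk : 1 ≤ k) (hkn : k ≤ n) (ξ : Stiefel n (n - k)) :
    (rotationOf ξ).transpose * rotationOf ξ = 1 ∧ (rotationOf ξ).det = 1 ∧
      rotationOf ξ * baseFrame n k = ξ := by
  refine Classical.epsilon_spec (p := fun g : Mat n n => g.transpose * g = 1 ∧ g.det = 1 ∧
    g * baseFrame n k = ξ) ?_
  obtain ⟨g, hg, h⟩ := exists_orth_mul_eq (Nat.sub_le n k) (baseFrame n k) ξ.1
    (baseFrame_mem n k) ξ.2
  have hd : g.det = 1 ∨ g.det = -1 := by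
    have := congrArg Matrix.det hg
    rw [Matrix.det_mul, Matrix.det_transpose, Matrix.det_one] at this
    exact mul_self_eq_one_iff.1 this
  rcases hd with hd | hd
  · exact ⟨g, hg, hd, h⟩
  -- The sign of the determinant is corrected by reflecting the first coordinate. Since $k\ge1$,
  -- this reflection fixes the base frame, which lives in the last $n-k$ coordinates.
  · set z : Fin n := ⟨0, by omega⟩
    set D : Mat n n := Matrix.diagonal fun i => if i = z then -1 else 1 with hD
    have hDb : D * baseFrame n k = baseFrame n k := by
      ext i j
      rw [hD, Matrix.diagonal_mul]
      by_cases hi : i = z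
      · have : ¬ (i : ℕ) = k + j := by rw [hi]; simp only [z]; omega
        simp [baseFrame, this]
      · simp [hi]
    refine ⟨g * D, ?_, ?_, ?_⟩
    · rw [Matrix.transpose_mul, Matrix.mul_assoc, ← Matrix.mul_assoc g.transpose, hg,
        Matrix.one_mul, hD, Matrix.diagonal_transpose, Matrix.diagonal_mul_diagonal,
        ← Matrix.diagonal_one]
      congr 1
      ext i
      split_ifs <;> simp
    · rw [Matrix.det_mul, hd, hD, Matrix.det_diagonal, Finset.prod_ite_eq' ]
      simp
    · rw [Matrix.mul_assoc, hDb, h]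

/-! ### The invariant measures on the orthogonal group and the Stiefel manifold -/

instance (n : ℕ) : PolishSpace (Orth n) := by
  have hcl : IsClosed {g : Matrix (Fin n) (Fin n) ℝ | star g * g = 1} :=
    isClosed_eq (by fun_prop) continuous_const
  have hset : {g : Matrix (Fin n) (Fin n) ℝ | star g * g = 1} =
      (Matrix.unitaryGroup (Fin n) ℝ : Set (Matrix (Fin n) (Fin n) ℝ)) := by
    ext g
    exact Matrix.mem_unitaryGroup_iff'.symm
  rw [hset] at hcl
  exact hcl.polishSpace

instance (n q : ℕ) : PolishSpace (Stiefel n q) :=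
  IsClosed.polishSpace (isClosed_eq (f := fun ξ : Mat n q => ξ.transpose * ξ) (by fun_prop)
    continuous_const)

instance (n : ℕ) : (orthMeasure n).IsHaarMeasure := by unfold orthMeasure; infer_instance

instance (n : ℕ) : IsProbabilityMeasure (orthMeasure n) :=
  ⟨Measure.haarMeasure_self (G := Orth n) (K₀ := ⊤)⟩

/-- Compact groups are unimodular: a right translate of Haar measure is again left invariant, hence
a multiple of it, and both have mass one. -/
instance (n : ℕ) : (orthMeasure n).IsMulRightInvariant := by
  refine ⟨fun g => ?_⟩
  have hp : IsProbabilityMeasure (Measure.map (· * g) (orthMeasure n)) :=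
    Measure.isProbabilityMeasure_map (measurable_mul_const g).aemeasurable
  have h := Measure.isMulInvariant_eq_smul_of_compactSpace
    (Measure.map (· * g) (orthMeasure n)) (orthMeasure n)
  have h1 := congrArg (fun μ : Measure (Orth n) => μ Set.univ) h
  simp only [measure_univ, Measure.smul_apply] at h1
  rw [h]
  have h2 : Measure.haarScalarFactor (Measure.map (· * g) (orthMeasure n)) (orthMeasure n) = 1 := by
    have h3 : (1 : ENNReal) =
      (Measure.haarScalarFactor (Measure.map (· * g) (orthMeasure n)) (orthMeasure n) : NNReal) := by
      simpa [ENNReal.smul_def] using h1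
    exact_mod_cast h3.symm
  rw [h2, one_smul]

theorem measurable_rotateFrame (n k : ℕ) : Measurable (rotateFrame n k) :=
  (measurable_mul measurable_subtype_coe measurable_const).subtype_mk

instance (n k : ℕ) : IsProbabilityMeasure (stiefelMeasure n k) :=
  Measure.isProbabilityMeasure_map (measurable_rotateFrame n k).aemeasurable

/-! ### Matrices as a Euclidean space -/

/-- The Euclidean space of `n × m` matrices. -/
abbrev EMat (n m : ℕ) : Type := EuclideanSpace ℝ (Fin n × Fin m)

/-- The identification of matrices with vectors of their entries. -/
noncomputable def toE (n m : ℕ) : Mat n m ≃L[ℝ] EMat n m :=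
  LinearEquiv.toContinuousLinearEquiv
    { toFun := fun x => WithLp.toLp 2 fun p => x p.1 p.2
      invFun := fun v => Matrix.of fun i j => v (i, j)
      map_add' := fun _ _ => rfl
      map_smul' := fun _ _ => rfl
      left_inv := fun _ => rfl
      right_inv := fun _ => rfl }

theorem toE_apply {n m : ℕ} (x : Mat n m) (i : Fin n) (j : Fin m) : toE n m x (i, j) = x i j := rfl

theorem inner_toE {n m : ℕ} (x y : Mat n m) :
    inner ℝ (toE n m x) (toE n m y) = (x.transpose * y).trace := by
  rw [PiLp.inner_apply, Fintype.sum_prod_type, Finset.sum_comm]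
  simp [Matrix.trace, Matrix.mul_apply, toE_apply, mul_comm]

theorem norm_toE_sq {n m : ℕ} (x : Mat n m) : ‖toE n m x‖ ^ 2 = (x.transpose * x).trace := by
  rw [← inner_toE, real_inner_self_eq_norm_sq]

theorem measurePreserving_toE (n m : ℕ) : MeasurePreserving (toE n m) := by
  refine ⟨(toE n m).continuous.measurable, ?_⟩
  set u : (Fin n → Fin m → ℝ) → (Fin n × Fin m → ℝ) := fun x p => x p.1 p.2 with hu
  have hum : Measurable u := by
    refine measurable_pi_lambda _ fun p => ?_
    exact (measurable_pi_apply p.2).comp (measurable_pi_apply p.1)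
  have h1 : Measure.map u volume = volume := by
    refine (Measure.pi_eq fun s hs => ?_).symm
    rw [Measure.map_apply hum (MeasurableSet.univ_pi hs)]
    have : u ⁻¹' Set.univ.pi s = Set.univ.pi fun i => Set.univ.pi fun j => s (i, j) := by
      ext x; simp [hu]
    rw [this, volume_pi_pi, Fintype.prod_prod_type]
    simp only [volume_pi_pi]
  have h2 := Measure.map_map (μ := (volume : Measure (Fin n → Fin m → ℝ)))
    (PiLp.volume_preserving_toLp (Fin n × Fin m)).measurable hum
  rw [h1, (PiLp.volume_preserving_toLp (Fin n × Fin m)).map_eq] at h2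
  exact h2.symm

theorem measurableEmbedding_toE (n m : ℕ) : MeasurableEmbedding (toE n m) :=
  (toE n m).toHomeomorph.measurableEmbedding

theorem integrable_gaussian (n m : ℕ) {b : ℝ} (hb : 0 < b) :
    Integrable fun x : Mat n m => Real.exp (-b * (x.transpose * x).trace) := by
  have h : Integrable fun v : EMat n m => Real.exp (-b * ‖v‖ ^ 2) := by
    have := (GaussianFourier.integrable_cexp_neg_mul_sq_norm_add (V := EMat n m)
      (b := (b : ℂ)) (by simpa using hb) 0 0).norm
    refine this.congr (ae_of_all _ fun v => ?_)
    simp only [Complex.norm_exp]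
    congr 1
    simp [← Complex.ofReal_pow, ← Complex.ofReal_neg, ← Complex.ofReal_mul]
  have h2 := ((measurePreserving_toE n m).integrable_comp_emb (measurableEmbedding_toE n m)).2 h
  refine h2.congr (ae_of_all _ fun x => ?_)
  simp only [Function.comp, norm_toE_sq]

theorem integral_gaussian_mat (n m : ℕ) :
    ∫ x : Mat n m, Real.exp (-(x.transpose * x).trace) = Real.pi ^ ((n : ℝ) * m / 2) := by
  have h := GaussianFourier.integral_rexp_neg_mul_sq_norm (V := EMat n m) one_pos
  rw [← (measurePreserving_toE n m).integral_comp (measurableEmbedding_toE n m)] at h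
  simpa [norm_toE_sq] using h

theorem lintegral_gaussian_mat (n m : ℕ) :
    ∫⁻ x : Mat n m, ENNReal.ofReal (Real.exp (-(x.transpose * x).trace)) =
      ENNReal.ofReal (Real.pi ^ ((n : ℝ) * m / 2)) := by
  rw [← integral_gaussian_mat, ofReal_integral_eq_lintegral_ofReal]
  · simpa using integrable_gaussian n m one_pos
  · exact ae_of_all _ fun _ => (Real.exp_pos _).le

/-! ### The measure on symmetric matrices -/

/-- The coordinates of a symmetric matrix. -/
abbrev SymCoord (m : ℕ) : Type := {p : Fin m × Fin m // p.1 ≤ p.2} → ℝ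

/-- The entries on and above the diagonal. -/
def upperPart {m : ℕ} (x : Mat m m) : SymCoord m := fun p => x p.1.1 p.1.2

theorem upperPart_symOfUpper {m : ℕ} (c : SymCoord m) : upperPart (symOfUpper m c) = c := by
  ext ⟨⟨i, j⟩, h⟩
  have h : i ≤ j := h
  simp [upperPart, symOfUpper, min_eq_left h, max_eq_right h]

theorem symOfUpper_transpose {m : ℕ} (c : SymCoord m) :
    (symOfUpper m c).transpose = symOfUpper m c := by
  ext i j
  simp [symOfUpper, min_comm, max_comm]

theorem symOfUpper_upperPart {m : ℕ} {x : Mat m m} (h : x.transpose = x) :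
    symOfUpper m (upperPart x) = x := by
  ext i j
  rcases le_total i j with hij | hij
  · simp [upperPart, symOfUpper, min_eq_left hij, max_eq_right hij]
  · have := congrFun (congrFun h i) j
    rw [Matrix.transpose_apply] at this
    simp [upperPart, symOfUpper, min_eq_right hij, max_eq_left hij, this]

theorem continuous_symOfUpper (m : ℕ) : Continuous (symOfUpper m) :=
  continuous_pi fun _ => continuous_pi fun _ => continuous_apply _

theorem continuous_upperPart (m : ℕ) : Continuous (upperPart : Mat m m → SymCoord m) :=
  continuous_pi fun p => continuous_id.matrix_elem p.1.1 p.1.2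

instance (m : ℕ) : SFinite (symVolume m) := by unfold symVolume; infer_instance

/-- The action `s ↦ g s gᵀ` in the coordinates of symmetric matrices. -/
noncomputable def conjCoord {m : ℕ} (g : Mat m m) : SymCoord m →ₗ[ℝ] SymCoord m where
  toFun c := upperPart (g * symOfUpper m c * g.transpose)
  map_add' c d := by
    have : symOfUpper m (c + d) = symOfUpper m c + symOfUpper m d := rfl
    rw [this, Matrix.mul_add, Matrix.add_mul]; rfl
  map_smul' r c := by
    have : symOfUpper m (r • c) = r • symOfUpper m c := rfl
    rw [this, Matrix.mul_smul, Matrix.smul_mul]; rfl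

theorem conjCoord_apply {m : ℕ} (g : Mat m m) (c : SymCoord m) :
    conjCoord g c = upperPart (g * symOfUpper m c * g.transpose) := rfl

theorem symOfUpper_conjCoord {m : ℕ} (g : Mat m m) (c : SymCoord m) :
    symOfUpper m (conjCoord g c) = g * symOfUpper m c * g.transpose := by
  rw [conjCoord_apply]
  refine symOfUpper_upperPart ?_
  simp [Matrix.transpose_mul, symOfUpper_transpose, Matrix.mul_assoc]

theorem conjCoord_mul {m : ℕ} (g h : Mat m m) :
    conjCoord (g * h) = conjCoord g ∘ₗ conjCoord h := by
  refine LinearMap.ext fun c => ?_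
  rw [LinearMap.comp_apply, conjCoord_apply, conjCoord_apply g, symOfUpper_conjCoord]
  simp [Matrix.transpose_mul, Matrix.mul_assoc]

theorem det_conjCoord_mul {m : ℕ} (g h : Mat m m) :
    LinearMap.det (conjCoord (g * h)) =
      LinearMap.det (conjCoord g) * LinearMap.det (conjCoord h) := by
  rw [conjCoord_mul, LinearMap.det_comp]

theorem det_conjCoord_one (m : ℕ) : LinearMap.det (conjCoord (1 : Mat m m)) = 1 := by
  have : conjCoord (1 : Mat m m) = LinearMap.id := by
    refine LinearMap.ext fun c => ?_
    rw [conjCoord_apply]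
    simp [upperPart_symOfUpper]
  rw [this, LinearMap.det_id]

/-- The coordinate $(i,j)$ is multiplied by $d_id_j$. With indices starting at 0, $i$ is the first
index of $m-i$ pairs $i\le j$ and the second index of $i+1$ pairs, so each $d_i$ occurs $m+1$ times.
-/
theorem det_conjCoord_diagonal {m : ℕ} (d : Fin m → ℝ) :
    LinearMap.det (conjCoord (Matrix.diagonal d)) = (∏ i, d i) ^ (m + 1) := by
  have h1 : conjCoord (Matrix.diagonal d) =
      Matrix.toLin' (Matrix.diagonal fun p : {p : Fin m × Fin m // p.1 ≤ p.2} =>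
        d p.1.1 * d p.1.2) := by
    refine LinearMap.ext fun c => ?_
    ext p
    change (Matrix.diagonal d * symOfUpper m c * (Matrix.diagonal d).transpose) p.1.1 p.1.2 = _
    have := congrFun (upperPart_symOfUpper c) p
    rw [Matrix.diagonal_transpose, Matrix.mul_diagonal, Matrix.diagonal_mul, Matrix.toLin'_apply,
      Matrix.mulVec_diagonal, ← this, upperPart]
    ring
  rw [h1, LinearMap.det_toLin', Matrix.det_diagonal, Finset.prod_mul_distrib]
  have h2 : ∏ p : {p : Fin m × Fin m // p.1 ≤ p.2}, d p.1.1 = ∏ i : Fin m, d i ^ (m - (i : ℕ)) := by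
    rw [← Finset.prod_subtype (Finset.univ.filter fun p : Fin m × Fin m => p.1 ≤ p.2)
      (by simp) fun p => d p.1, Finset.prod_filter, Fintype.prod_prod_type]
    refine Finset.prod_congr rfl fun i _ => ?_
    rw [← Finset.prod_filter]
    dsimp only
    rw [Finset.prod_const, Finset.filter_le_eq_Ici, Fin.card_Ici]
  have h3 : ∏ p : {p : Fin m × Fin m // p.1 ≤ p.2}, d p.1.2 = ∏ i : Fin m, d i ^ ((i : ℕ) + 1) := by
    rw [← Finset.prod_subtype (Finset.univ.filter fun p : Fin m × Fin m => p.1 ≤ p.2)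
      (by simp) fun p => d p.2, Finset.prod_filter, Fintype.prod_prod_type_right]
    refine Finset.prod_congr rfl fun i _ => ?_
    rw [← Finset.prod_filter]
    dsimp only
    rw [Finset.prod_const, Finset.filter_ge_eq_Iic, Fin.card_Iic]
  rw [h2, h3, ← Finset.prod_mul_distrib, ← Finset.prod_pow]
  refine Finset.prod_congr rfl fun i _ => ?_
  rw [← pow_add]
  congr 1
  omega

/-- Both sides are multiplicative in $g$, so diagonal matrices and transvections suffice. -/
theorem abs_det_conjCoord {m : ℕ} (g : Mat m m) (hg : g.det ≠ 0) :
    |LinearMap.det (conjCoord g)| = |g.det| ^ (m + 1) := by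
  refine Matrix.diagonal_transvection_induction_of_det_ne_zero
    (fun g : Mat m m => |LinearMap.det (conjCoord g)| = |g.det| ^ (m + 1)) g hg ?_ ?_ ?_
  · intro d _
    rw [det_conjCoord_diagonal, Matrix.det_diagonal, abs_pow]
  · rintro ⟨i, j, hij, c⟩
    simp only [Matrix.TransvectionStruct.toMatrix_mk]
    set t := Matrix.transvection i j c with ht
    set d : Fin m → ℝ := fun l => if l = i then 2 else 1 with hd
    -- Doubling the $i$-th coordinate conjugates $t$ to $t^2$. Hence the determinant of the action
    -- of $t$ equals its own square, and being nonzero it is 1.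
    have hcomm : Matrix.diagonal d * t = t * t * Matrix.diagonal d := by
      rw [ht, Matrix.transvection_mul_transvection_same i j hij]
      have h1 : Matrix.diagonal d * Matrix.single i j c = Matrix.single i j (2 * c) := by
        ext a b
        rw [Matrix.diagonal_mul, Matrix.single_apply, Matrix.single_apply]
        by_cases h : i = a ∧ j = b
        · simp [h, hd]
        · simp [h]
      have h2 : Matrix.single i j (c + c) * Matrix.diagonal d = Matrix.single i j (2 * c) := by
        ext a b
        rw [Matrix.mul_diagonal, Matrix.single_apply, Matrix.single_apply]
        by_cases h : i = a ∧ j = b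
        · obtain ⟨rfl, rfl⟩ := h
          simp [hd, hij.symm, two_mul]
        · simp [h]
      rw [Matrix.transvection, Matrix.transvection, Matrix.mul_add, Matrix.add_mul, h1, h2,
        Matrix.mul_one, Matrix.one_mul]
    have h1 := congrArg (fun g => LinearMap.det (conjCoord g)) hcomm
    simp only [det_conjCoord_mul] at h1
    have hD : LinearMap.det (conjCoord (Matrix.diagonal d)) ≠ 0 := by
      rw [det_conjCoord_diagonal]
      refine pow_ne_zero _ (Finset.prod_ne_zero_iff.2 fun l _ => ?_)
      simp only [hd]
      split_ifs <;> norm_num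
    have ht0 : LinearMap.det (conjCoord t) ≠ 0 := by
      have h2 := det_conjCoord_mul t (Matrix.transvection i j (-c))
      rw [ht, Matrix.transvection_mul_transvection_same i j hij, add_neg_cancel,
        Matrix.transvection_zero, det_conjCoord_one] at h2
      intro h0
      rw [ht] at h0
      rw [h0, zero_mul] at h2
      exact one_ne_zero h2
    have h3 : LinearMap.det (conjCoord t) = 1 := by
      apply mul_left_cancel₀ (mul_ne_zero hD ht0)
      rw [mul_one]
      linear_combination -h1
    rw [h3, ht, Matrix.det_transvection_of_ne i j hij]
    simp
  · intro A B _ _ hA hB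
    rw [det_conjCoord_mul, abs_mul, hA, hB, Matrix.det_mul, abs_mul, mul_pow]

theorem measurable_conj {m : ℕ} (g : Mat m m) : Measurable fun s : Mat m m => g * s * g.transpose :=
  measurable_mul (measurable_mul measurable_const measurable_id) measurable_const

theorem map_conj_symVolume {m : ℕ} (g : Mat m m) (hg : g.det ≠ 0) :
    Measure.map (fun s => g * s * g.transpose) (symVolume m) =
      ENNReal.ofReal ((|g.det| ^ (m + 1))⁻¹) • symVolume m := by
  have hL : LinearMap.det (conjCoord g) ≠ 0 := by
    rw [← abs_ne_zero, abs_det_conjCoord g hg]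
    exact pow_ne_zero _ (abs_ne_zero.2 hg)
  have h1 := Measure.map_linearMap_addHaar_eq_smul_addHaar
    (volume : Measure (SymCoord m)) hL
  rw [abs_inv, abs_det_conjCoord g hg] at h1
  have h2 : (fun s => g * s * g.transpose) ∘ symOfUpper m = symOfUpper m ∘ conjCoord g := by
    ext1 c; exact (symOfUpper_conjCoord g c).symm
  rw [symVolume, Measure.map_map (measurable_conj g) (continuous_symOfUpper m).measurable, h2,
    ← Measure.map_map (continuous_symOfUpper m).measurable
      (LinearMap.continuous_of_finiteDimensional _).measurable, h1, Measure.map_smul]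

theorem lintegral_conj_symVolume {m : ℕ} (g : Mat m m) (hg : g.det ≠ 0) {F : Mat m m → ENNReal}
    (hF : Measurable F) :
    ∫⁻ s, F (g * s * g.transpose) ∂symVolume m =
      ENNReal.ofReal ((|g.det| ^ (m + 1))⁻¹) * ∫⁻ s, F s ∂symVolume m := by
  rw [← lintegral_map hF (measurable_conj g), map_conj_symVolume g hg, lintegral_smul_measure,
    smul_eq_mul]

/-! ### Invariant measures on the cone -/

theorem measurable_ofReal_det_rpow {m : ℕ} (α : ℝ) :
    Measurable fun s : Mat m m => ENNReal.ofReal (s.det ^ α) :=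
  ((measurable_det m).pow_const α).ennreal_ofReal

instance (m : ℕ) : SFinite (coneMeasure m) := by unfold coneMeasure; infer_instance

theorem lintegral_coneMeasure {m : ℕ} {F : Mat m m → ENNReal} (hF : Measurable F) :
    ∫⁻ s, F s ∂coneMeasure m = ∫⁻ s, {s : Mat m m | s.PosDef}.indicator
      (fun s => ENNReal.ofReal (s.det ^ (-((m : ℝ) + 1) / 2)) * F s) s ∂symVolume m := by
  rw [coneMeasure, lintegral_withDensity_eq_lintegral_mul _ (measurable_ofReal_det_rpow _) hF,
    lintegral_indicator (measurableSet_posDef m)]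
  rfl

theorem ae_posDef_coneMeasure (m : ℕ) : ∀ᵐ s ∂coneMeasure m, s.PosDef :=
  (withDensity_absolutelyContinuous _ _).ae_le (ae_restrict_mem (measurableSet_posDef m))

/-- A measure on the cone of positive definite matrices which is invariant under the general
linear group. -/
structure IsConeInvariant {m : ℕ} (ν : Measure (Mat m m)) : Prop where
  posDef : ∀ᵐ s ∂ν, s.PosDef
  conj : ∀ g : Mat m m, g.det ≠ 0 → ∀ F : Mat m m → ENNReal, Measurable F →
    ∫⁻ s, F (g * s * g.transpose) ∂ν = ∫⁻ s, F s ∂ν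

theorem det_conj {m : ℕ} (g s : Mat m m) :
    (g * s * g.transpose).det = |g.det| ^ 2 * s.det := by
  rw [Matrix.det_mul, Matrix.det_mul, Matrix.det_transpose, sq_abs]; ring

/-- The Jacobian of $s\mapsto gsg'$ is $|\det g|^{m+1}$, and $|gsg'|^{-(m+1)/2}$ produces exactly
the inverse factor. -/
theorem isConeInvariant_coneMeasure (m : ℕ) : IsConeInvariant (coneMeasure m) := by
  refine ⟨ae_posDef_coneMeasure m, fun g hg F hF => ?_⟩
  have hFg : Measurable fun s => F (g * s * g.transpose) := hF.comp (measurable_conj g)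
  rw [lintegral_coneMeasure hFg, lintegral_coneMeasure hF]
  set G : Mat m m → ENNReal := {s : Mat m m | s.PosDef}.indicator
      (fun s => ENNReal.ofReal (s.det ^ (-((m : ℝ) + 1) / 2)) * F s) with hG
  have hGm : Measurable G :=
    ((measurable_ofReal_det_rpow _).mul hF).indicator (measurableSet_posDef m)
  have hg0 : 0 < |g.det| := abs_pos.2 hg
  have h1 : ∀ s, {s : Mat m m | s.PosDef}.indicator (fun s =>
      ENNReal.ofReal (s.det ^ (-((m : ℝ) + 1) / 2)) * F (g * s * g.transpose)) s =
      ENNReal.ofReal (|g.det| ^ (m + 1)) * G (g * s * g.transpose) := by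
    intro s
    by_cases hs : s.PosDef
    · have hs' := posDef_conj hs hg
      rw [hG, Set.indicator_of_mem (show s ∈ {s : Mat m m | s.PosDef} from hs),
        Set.indicator_of_mem (show _ ∈ {s : Mat m m | s.PosDef} from hs'), ← mul_assoc,
        ← ENNReal.ofReal_mul (by positivity), det_conj, Real.mul_rpow (by positivity)
        hs.det_pos.le, ← Real.rpow_natCast _ 2, ← Real.rpow_mul hg0.le, ← mul_assoc,
        ← Real.rpow_natCast _ (m + 1), ← Real.rpow_add hg0]
      congr 3
      push_cast
      rw [show (m : ℝ) + 1 + 2 * (-(m + 1) / 2) = 0 by ring, Real.rpow_zero, one_mul]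
    · have hs' : ¬ (g * s * g.transpose).PosDef := fun h => hs ((posDef_conj_iff hg).1 h)
      rw [hG, Set.indicator_of_notMem (show s ∉ {s : Mat m m | s.PosDef} from hs),
        Set.indicator_of_notMem (show _ ∉ {s : Mat m m | s.PosDef} from hs'), mul_zero]
  have hGg : Measurable fun s => G (g * s * g.transpose) := hGm.comp (measurable_conj g)
  rw [lintegral_congr h1, lintegral_const_mul _ hGg,
    lintegral_conj_symVolume g hg hGm, ← mul_assoc, ← ENNReal.ofReal_mul (by positivity),
    mul_inv_cancel₀ (by positivity), ENNReal.ofReal_one, one_mul]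

/-! ### Haar measure of $GL(m,\mathbb R)$ and uniqueness of invariant measures on the cone -/

/-- The Haar measure `|det x|^{-m} dx` of the general linear group. -/
noncomputable def glMeasure (m : ℕ) : Measure (Mat m m) :=
  volume.withDensity fun x => ENNReal.ofReal (|x.det|⁻¹ ^ m)

instance (m : ℕ) : SFinite (glMeasure m) := by unfold glMeasure; infer_instance

theorem measurable_glDensity (m : ℕ) :
    Measurable fun x : Mat m m => ENNReal.ofReal (|x.det|⁻¹ ^ m) :=
  (((continuous_abs.measurable.comp (measurable_det m)).inv).pow_const m).ennreal_ofReal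

theorem lintegral_glMeasure {m : ℕ} {F : Mat m m → ENNReal} (hF : Measurable F) :
    ∫⁻ x, F x ∂glMeasure m = ∫⁻ x : Mat m m, ENNReal.ofReal (|x.det|⁻¹ ^ m) * F x := by
  rw [glMeasure, lintegral_withDensity_eq_lintegral_mul _ (measurable_glDensity m) hF]
  rfl

theorem ae_det_ne_zero_glMeasure (m : ℕ) : ∀ᵐ x ∂glMeasure m, x.det ≠ 0 :=
  (withDensity_absolutelyContinuous _ _).ae_le (ae_det_ne_zero m)

theorem lintegral_glMeasure_mul_right {m : ℕ} (p : Mat m m) (hp : p.det ≠ 0)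
    {F : Mat m m → ENNReal} (hF : Measurable F) :
    ∫⁻ x, F (x * p) ∂glMeasure m = ∫⁻ x, F x ∂glMeasure m := by
  have hFp : Measurable fun x => F (x * p) :=
    hF.comp (measurable_mul measurable_id measurable_const)
  rw [lintegral_glMeasure hFp, lintegral_glMeasure hF]
  have h := lintegral_mul_right p hp (fun x : Mat m m => ENNReal.ofReal (|x.det|⁻¹ ^ m) * F x)
  have hp0 : 0 < |p.det|⁻¹ ^ m := by have := abs_pos.2 hp; positivity
  have h2 : ∀ x : Mat m m, ENNReal.ofReal (|(x * p).det|⁻¹ ^ m) * F (x * p) =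
      ENNReal.ofReal (|p.det|⁻¹ ^ m) * (ENNReal.ofReal (|x.det|⁻¹ ^ m) * F (x * p)) := by
    intro x
    rw [Matrix.det_mul, abs_mul, mul_inv, mul_pow, mul_comm (|x.det|⁻¹ ^ m),
      ENNReal.ofReal_mul hp0.le, mul_assoc]
  simp only [h2] at h
  rw [lintegral_const_mul _ ((measurable_glDensity m).fun_mul hFp)] at h
  exact (ENNReal.mul_right_inj (by simpa using hp0) ENNReal.ofReal_ne_top).1 h

theorem lintegral_glMeasure_mul_left {m : ℕ} (p : Mat m m) (hp : p.det ≠ 0)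
    {F : Mat m m → ENNReal} (hF : Measurable F) :
    ∫⁻ x, F (p * x) ∂glMeasure m = ∫⁻ x, F x ∂glMeasure m := by
  have hFp : Measurable fun x => F (p * x) :=
    hF.comp (measurable_mul measurable_const measurable_id)
  rw [lintegral_glMeasure hFp, lintegral_glMeasure hF]
  have h := lintegral_mul_left p hp (fun x : Mat m m => ENNReal.ofReal (|x.det|⁻¹ ^ m) * F x)
  have hp0 : 0 < |p.det|⁻¹ ^ m := by have := abs_pos.2 hp; positivity
  have h2 : ∀ x : Mat m m, ENNReal.ofReal (|(p * x).det|⁻¹ ^ m) * F (p * x) =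
      ENNReal.ofReal (|p.det|⁻¹ ^ m) * (ENNReal.ofReal (|x.det|⁻¹ ^ m) * F (p * x)) := by
    intro x
    rw [Matrix.det_mul, abs_mul, mul_inv, mul_pow, ENNReal.ofReal_mul hp0.le, mul_assoc]
  simp only [h2] at h
  rw [lintegral_const_mul _ ((measurable_glDensity m).fun_mul hFp)] at h
  exact (ENNReal.mul_right_inj (by simpa using hp0) ENNReal.ofReal_ne_top).1 h

theorem inv_mul_conj_mul {m : ℕ} {x : Mat m m} (hx : x.det ≠ 0) (s : Mat m m) :
    x⁻¹ * (x * s * x.transpose) * x⁻¹.transpose = s := by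
  rw [Matrix.transpose_nonsing_inv, Matrix.mul_assoc, Matrix.mul_assoc, Matrix.mul_assoc,
    Matrix.mul_nonsing_inv _ (by rw [Matrix.det_transpose]; exact hx.isUnit), Matrix.mul_one,
    Matrix.nonsing_inv_mul_cancel_left _ _ hx.isUnit]

theorem mul_rootMat_mul_transpose {m : ℕ} {s : Mat m m} (hs : s.PosSemidef) (x : Mat m m) :
    (x * rootMat s) * (x * rootMat s).transpose = x * s * x.transpose := by
  rw [Matrix.transpose_mul, transpose_rootMat, Matrix.mul_assoc, ← Matrix.mul_assoc (rootMat s),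
    rootMat_mul_self hs, Matrix.mul_assoc]

theorem det_inv_ne_zero {m : ℕ} {x : Mat m m} (hx : x.det ≠ 0) : x⁻¹.det ≠ 0 := by
  rw [Matrix.det_nonsing_inv, Ring.inverse_eq_inv']; exact inv_ne_zero hx

/-- Writing $xsx'=(xs^{1/2})(xs^{1/2})'$, the root is absorbed by right invariance; left invariance
plays the same role for $x^{-1}sx^{-1\prime}$. -/
theorem lintegral_glMeasure_conj {m : ℕ} {s : Mat m m} (hs : s.PosDef) {φ : Mat m m → ENNReal}
    (hφ : Measurable φ) :
    ∫⁻ x, φ (x * s * x.transpose) ∂glMeasure m = ∫⁻ x, φ (x * x.transpose) ∂glMeasure m := by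
  have hr := lintegral_glMeasure_mul_right (rootMat s) (det_rootMat_ne_zero hs)
    (F := fun x => φ (x * x.transpose)) (hφ.comp (measurable_mul measurable_id measurable_transpose))
  rw [← hr]
  exact lintegral_congr fun x => congrArg φ (mul_rootMat_mul_transpose hs.posSemidef x).symm

theorem lintegral_glMeasure_inv_conj {m : ℕ} {s : Mat m m} (hs : s.PosDef)
    {H : Mat m m → ENNReal} (hH : Measurable H) :
    ∫⁻ x, H (x⁻¹ * s * x⁻¹.transpose) ∂glMeasure m =
      ∫⁻ x, H (x⁻¹ * x⁻¹.transpose) ∂glMeasure m := by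
  have hd := det_rootMat_ne_zero hs
  have hm : Measurable fun x : Mat m m => x⁻¹ * x⁻¹.transpose :=
    measurable_mul (measurable_inv m) (measurable_transpose.comp (measurable_inv m))
  have hr := lintegral_glMeasure_mul_left (rootMat s)⁻¹ (det_inv_ne_zero hd)
    (F := fun x => H (x⁻¹ * x⁻¹.transpose)) (hH.comp hm)
  rw [← hr]
  refine lintegral_congr fun x => congrArg H ?_
  rw [Matrix.mul_inv_rev, Matrix.nonsing_inv_nonsing_inv _ hd.isUnit,
    mul_rootMat_mul_transpose hs.posSemidef]

/-- Comparison of an invariant measure on the cone with the Haar measure of the general linear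
group. -/
theorem IsConeInvariant.lintegral_mul_lintegral {m : ℕ} {ν : Measure (Mat m m)} [SFinite ν]
    (hν : IsConeInvariant ν) {H φ : Mat m m → ENNReal} (hH : Measurable H) (hφ : Measurable φ) :
    (∫⁻ s, H s ∂ν) * ∫⁻ x, φ (x * x.transpose) ∂glMeasure m =
      (∫⁻ s, φ s ∂ν) * ∫⁻ x, H (x⁻¹ * x⁻¹.transpose) ∂glMeasure m := by
  have m1 : Measurable fun q : Mat m m × Mat m m => q.2 * q.1 * q.2.transpose :=
    measurable_mul (measurable_mul measurable_snd measurable_fst)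
      (measurable_transpose.comp measurable_snd)
  have m2 : Measurable fun q : Mat m m × Mat m m => q.2⁻¹ * q.1 * q.2⁻¹.transpose :=
    measurable_mul (measurable_mul ((measurable_inv m).comp measurable_snd) measurable_fst)
      (measurable_transpose.comp ((measurable_inv m).comp measurable_snd))
  have mφ : Measurable fun q : Mat m m × Mat m m => H q.1 * φ (q.2 * q.1 * q.2.transpose) :=
    (hH.comp measurable_fst).fun_mul (hφ.comp m1)
  have mH : Measurable fun q : Mat m m × Mat m m => φ q.1 * H (q.2⁻¹ * q.1 * q.2⁻¹.transpose) :=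
    (hφ.comp measurable_fst).fun_mul (hH.comp m2)
  -- By invariance of Haar measure the inner integral of $\varphi(xsx')$ does not depend on $s$, so
  -- the product is a double integral; likewise for the other side. After exchanging the integrals,
  -- the invariance of `ν` under $s\mapsto xsx'$ matches the two for each fixed $x$.
  have e1 : (∫⁻ s, H s ∂ν) * ∫⁻ x, φ (x * x.transpose) ∂glMeasure m =
      ∫⁻ s, ∫⁻ x, H s * φ (x * s * x.transpose) ∂glMeasure m ∂ν := by
    rw [← lintegral_mul_const _ hH]
    refine lintegral_congr_ae ?_
    filter_upwards [hν.posDef] with s hs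
    have mφs : Measurable fun x : Mat m m => φ (x * s * x.transpose) :=
      hφ.comp (measurable_mul (measurable_mul measurable_id measurable_const) measurable_transpose)
    rw [lintegral_const_mul _ mφs, lintegral_glMeasure_conj hs hφ]
  have e2 : (∫⁻ s, φ s ∂ν) * ∫⁻ x, H (x⁻¹ * x⁻¹.transpose) ∂glMeasure m =
      ∫⁻ s, ∫⁻ x, φ s * H (x⁻¹ * s * x⁻¹.transpose) ∂glMeasure m ∂ν := by
    rw [← lintegral_mul_const _ hφ]
    refine lintegral_congr_ae ?_
    filter_upwards [hν.posDef] with s hs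
    have mHs : Measurable fun x : Mat m m => H (x⁻¹ * s * x⁻¹.transpose) :=
      hH.comp (measurable_mul (measurable_mul (measurable_inv m) measurable_const)
        (measurable_transpose.comp (measurable_inv m)))
    rw [lintegral_const_mul _ mHs, lintegral_glMeasure_inv_conj hs hH]
  rw [e1, e2]
  refine (lintegral_lintegral_swap mφ.aemeasurable).trans
    (Eq.trans ?_ (lintegral_lintegral_swap mH.aemeasurable).symm)
  refine lintegral_congr_ae ?_
  filter_upwards [ae_det_ne_zero_glMeasure m] with x hx
  have mF : Measurable fun s : Mat m m => φ s * H (x⁻¹ * s * x⁻¹.transpose) :=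
    hφ.fun_mul (hH.comp (measurable_mul (measurable_mul measurable_const measurable_id)
      measurable_const))
  rw [← hν.conj x hx (fun s => φ s * H (x⁻¹ * s * x⁻¹.transpose)) mF]
  refine lintegral_congr fun s => ?_
  rw [inv_mul_conj_mul hx, mul_comm]

/-- The weight `e^{-tr s} |s|^α`. -/
noncomputable def coneGaussian (m : ℕ) (α : ℝ) (s : Mat m m) : ENNReal :=
  ENNReal.ofReal (Real.exp (-s.trace) * s.det ^ α)

theorem measurable_coneGaussian (m : ℕ) (α : ℝ) : Measurable (coneGaussian m α) := by
  refine Measurable.ennreal_ofReal (Measurable.mul ?_ ((measurable_det m).pow_const α))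
  exact Continuous.measurable (Real.continuous_exp.comp (continuous_id.matrix_trace.neg))

theorem det_le_exp_trace {m : ℕ} {s : Mat m m} (hs : s.PosSemidef) :
    s.det ≤ Real.exp s.trace := by
  rw [hs.1.det_eq_prod_eigenvalues, hs.1.trace_eq_sum_eigenvalues]
  simp only [RCLike.ofReal_real_eq_id, id]
  rw [Real.exp_sum]
  refine Finset.prod_le_prod (fun i _ => hs.eigenvalues_nonneg i) fun i _ => ?_
  linarith [Real.add_one_le_exp (hs.1.eigenvalues i)]

theorem posSemidef_mul_transpose {n m : ℕ} (x : Mat n m) : (x * x.transpose).PosSemidef := by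
  simpa [Matrix.conjTranspose_eq_transpose_of_trivial] using
    Matrix.posSemidef_self_mul_conjTranspose x

theorem det_mul_transpose {m : ℕ} (x : Mat m m) : (x * x.transpose).det = |x.det| ^ 2 := by
  rw [Matrix.det_mul, Matrix.det_transpose, sq_abs, sq]

/-- The Haar density $|\det x|^{-m}$ against $|xx'|^{N/2}$ leaves the nonnegative power $|\det
x|^{N-m}$, which a Gaussian dominates. Finiteness and nonvanishing are what allow cancelling this
integral later. -/
theorem lintegral_coneGaussian_glMeasure {N m : ℕ} (h : m ≤ N) :
    ∫⁻ x, coneGaussian m ((N : ℝ) / 2) (x * x.transpose) ∂glMeasure m ≠ ⊤ ∧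
    ∫⁻ x, coneGaussian m ((N : ℝ) / 2) (x * x.transpose) ∂glMeasure m ≠ 0 := by
  have mx : Measurable fun x : Mat m m => x * x.transpose :=
    measurable_mul measurable_id measurable_transpose
  have mg : Measurable fun x : Mat m m => coneGaussian m ((N : ℝ) / 2) (x * x.transpose) :=
    (measurable_coneGaussian m _).comp mx
  rw [lintegral_glMeasure mg]
  have hform : ∀ x : Mat m m, x.det ≠ 0 →
      ENNReal.ofReal (|x.det|⁻¹ ^ m) * coneGaussian m ((N : ℝ) / 2) (x * x.transpose) =
      ENNReal.ofReal (Real.exp (-(x.transpose * x).trace) * |x.det| ^ (N - m)) := by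
    intro x hx
    have hx0 : 0 < |x.det| := abs_pos.2 hx
    rw [coneGaussian, ← ENNReal.ofReal_mul (by positivity), det_mul_transpose, Matrix.trace_mul_comm,
      ← Real.rpow_natCast _ 2, ← Real.rpow_mul hx0.le]
    congr 1
    rw [show ((2 : ℕ) : ℝ) * ((N : ℝ) / 2) = (N : ℕ) by push_cast; ring, Real.rpow_natCast,
      inv_pow, pow_sub₀ _ hx0.ne' h]
    ring
  constructor
  · set d : ℕ := N - m with hd
    -- Applying $\det\le e^{\operatorname{tr}}$ to $cs$ bounds $|s|^{d/2}$ by a multiple of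
    -- $e^{(cd/2)\operatorname{tr}s}$; since $cd\le1$, half of the Gaussian decay is left over.
    set c : ℝ := ((d : ℝ) + 1)⁻¹ with hc
    have hc0 : 0 < c := by positivity
    set C : ℝ := ((c ^ m)⁻¹) ^ ((d : ℝ) / 2) with hC
    have hbound : ∀ x : Mat m m, Real.exp (-(x.transpose * x).trace) * |x.det| ^ d ≤
        C * Real.exp (-(1 / 2) * (x.transpose * x).trace) := by
      intro x
      set s := x * x.transpose with hs
      have hsP : s.PosSemidef := posSemidef_mul_transpose x
      have ht : (x.transpose * x).trace = s.trace := Matrix.trace_mul_comm _ _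
      have ht0 : 0 ≤ s.trace := hsP.trace_nonneg
      have h1 : c ^ m * s.det ≤ Real.exp (c * s.trace) := by
        have := det_le_exp_trace (hsP.smul hc0.le)
        simpa [Matrix.det_smul, Matrix.trace_smul] using this
      have h2 : s.det ≤ (c ^ m)⁻¹ * Real.exp (c * s.trace) := by
        rw [inv_mul_eq_div, le_div_iff₀ (by positivity), mul_comm]; exact h1
      have h3 : |x.det| ^ d = s.det ^ ((d : ℝ) / 2) := by
        rw [det_mul_transpose, ← Real.rpow_natCast _ 2, ← Real.rpow_mul (abs_nonneg _),
          show ((2 : ℕ) : ℝ) * ((d : ℝ) / 2) = (d : ℕ) by push_cast; ring, Real.rpow_natCast]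
      have h4 : s.det ^ ((d : ℝ) / 2) ≤ C * Real.exp (1 / 2 * s.trace) := by
        calc s.det ^ ((d : ℝ) / 2)
            ≤ ((c ^ m)⁻¹ * Real.exp (c * s.trace)) ^ ((d : ℝ) / 2) :=
              Real.rpow_le_rpow hsP.det_nonneg h2 (by positivity)
          _ = C * Real.exp (c * s.trace * (d / 2)) := by
              rw [Real.mul_rpow (by positivity) (Real.exp_pos _).le, ← Real.exp_mul]
          _ ≤ C * Real.exp (1 / 2 * s.trace) := by
              refine mul_le_mul_of_nonneg_left (Real.exp_le_exp.2 ?_) (by positivity)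
              have h5 : c * d ≤ 1 := by
                rw [hc, inv_mul_le_iff₀ (by positivity)]; linarith
              nlinarith
      rw [h3, ht]
      calc Real.exp (-s.trace) * s.det ^ ((d : ℝ) / 2)
          ≤ Real.exp (-s.trace) * (C * Real.exp (1 / 2 * s.trace)) :=
            mul_le_mul_of_nonneg_left h4 (Real.exp_pos _).le
        _ = C * Real.exp (-(1 / 2) * s.trace) := by
            rw [mul_left_comm, ← Real.exp_add]; congr 2; ring
    have hInt : ∫⁻ x : Mat m m, ENNReal.ofReal
        (C * Real.exp (-(1 / 2) * (x.transpose * x).trace)) ≠ ⊤ :=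
      (((integrable_gaussian m m (b := 1 / 2) (by norm_num)).const_mul C).lintegral_lt_top).ne
    refine ne_top_of_le_ne_top hInt (lintegral_mono_ae ?_)
    filter_upwards [ae_det_ne_zero m] with x hx
    rw [hform x hx]
    exact ENNReal.ofReal_le_ofReal (hbound x)
  · rw [Ne, lintegral_eq_zero_iff ((measurable_glDensity m).fun_mul mg)]
    intro h0
    have : ∀ᵐ x : Mat m m, False := by
      filter_upwards [h0, ae_det_ne_zero m] with x h1 hx
      simp only [Pi.zero_apply] at h1
      rw [hform x hx, ENNReal.ofReal_eq_zero] at h1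
      have := abs_pos.2 hx
      have h2 : 0 < Real.exp (-(x.transpose * x).trace) * |x.det| ^ (N - m) := by positivity
      linarith
    rw [eventually_false_iff_eq_bot, ae_eq_bot] at this
    exact NeZero.ne (volume : Measure (Mat m m)) this

/-! ### Finiteness and positivity of the cone measure -/

/-- The set of `a` with `ε I ≤ a ≤ ρ I`. -/
def coneBox (m : ℕ) (ε ρ : ℝ) : Set (Mat m m) :=
  {a | (a - ε • (1 : Mat m m)).PosSemidef ∧ (ρ • (1 : Mat m m) - a).PosSemidef}

theorem coneInterval_subset_coneBox (m : ℕ) (ε ρ : ℝ) : coneInterval m ε ρ ⊆ coneBox m ε ρ :=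
  fun _ ha => ⟨ha.1.posSemidef, ha.2.posSemidef⟩

theorem posDef_of_mem_coneBox {m : ℕ} {ε ρ : ℝ} (hε : 0 < ε) {a : Mat m m}
    (ha : a ∈ coneBox m ε ρ) : a.PosDef := by
  have := (posDef_smul_one hε).add_posSemidef ha.1
  simpa using this

theorem isCompact_coneBox (m : ℕ) {ε : ℝ} (hε : 0 < ε) (ρ : ℝ) : IsCompact (coneBox m ε ρ) := by
  have hcl : IsClosed (coneBox m ε ρ) := by
    refine IsClosed.inter ?_ ?_
    · exact (isClosed_posSemidef m).preimage (f := fun a : Mat m m => a - ε • (1 : Mat m m))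
        (by fun_prop)
    · exact (isClosed_posSemidef m).preimage (f := fun a : Mat m m => ρ • (1 : Mat m m) - a)
        (by fun_prop)
  -- Every entry of $a^{1/2}$ has square at most $\operatorname{tr}a\le\rho m$, hence absolute value
  -- at most $\rho m+1$. So the box lies in the image of a compact cube under squaring.
  set c : ℝ := ρ * m + 1 with hc
  have hK : IsCompact (Set.pi Set.univ fun _ : Fin m => Set.pi Set.univ fun _ : Fin m =>
      Set.Icc (-c) c : Set (Fin m → Fin m → ℝ)) :=
    isCompact_univ_pi fun _ => isCompact_univ_pi fun _ => isCompact_Icc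
  have himg := IsCompact.image (X := Mat m m) (f := fun r : Mat m m => r * r) hK (by fun_prop)
  refine himg.of_isClosed_subset hcl fun a ha => ?_
  have hP := (posDef_of_mem_coneBox hε ha).posSemidef
  refine ⟨rootMat a, fun i _ j _ => ?_, rootMat_mul_self hP⟩
  have h1 : a.trace ≤ ρ * m := by
    have := ha.2.trace_nonneg
    rw [Matrix.trace_sub, Matrix.trace_smul, Matrix.trace_one, Fintype.card_fin, smul_eq_mul] at this
    linarith
  have h2 : rootMat a i j ^ 2 ≤ a.trace := by
    have h3 : a.trace = ∑ i, ∑ j, rootMat a i j ^ 2 := by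
      conv_lhs => rw [← rootMat_mul_self hP]
      simp only [Matrix.trace, Matrix.diag, Matrix.mul_apply]
      refine Finset.sum_congr rfl fun i _ => Finset.sum_congr rfl fun j _ => ?_
      rw [sq, ← Matrix.transpose_apply (rootMat a) i j, transpose_rootMat]
    rw [h3]
    exact (Finset.single_le_sum (f := fun j => rootMat a i j ^ 2) (fun _ _ => sq_nonneg _)
      (Finset.mem_univ j)).trans (Finset.single_le_sum (f := fun i => ∑ j, rootMat a i j ^ 2)
      (fun _ _ => Finset.sum_nonneg fun _ _ => sq_nonneg _) (Finset.mem_univ i))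
  have h0 : 0 ≤ ρ * m := (sq_nonneg _).trans (h2.trans h1)
  exact abs_le.1 (abs_le_of_sq_le_sq (by nlinarith) (by linarith))

theorem symVolume_lt_top_of_isCompact {m : ℕ} {K : Set (Mat m m)} (hK : IsCompact K) :
    symVolume m K < ⊤ := by
  rw [symVolume, Measure.map_apply (continuous_symOfUpper m).measurable hK.measurableSet]
  refine lt_of_le_of_lt (measure_mono ?_)
    (hK.image (continuous_upperPart m)).measure_lt_top
  exact fun c hc => ⟨symOfUpper m c, hc, upperPart_symOfUpper c⟩

theorem coneMeasure_lt_top_of_isCompact {m : ℕ} {K : Set (Mat m m)} (hK : IsCompact K)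
    (hP : ∀ s ∈ K, s.PosDef) : coneMeasure m K < ⊤ := by
  have hc : ContinuousOn (fun s : Mat m m => s.det ^ (-((m : ℝ) + 1) / 2)) K := by
    refine ContinuousOn.rpow_const (continuous_id.matrix_det).continuousOn fun s hs => Or.inl ?_
    exact (hP s hs).det_pos.ne'
  obtain ⟨C, hC⟩ := hK.exists_bound_of_continuousOn hc
  rw [← lintegral_indicator_one hK.measurableSet,
    lintegral_coneMeasure (measurable_one.indicator hK.measurableSet)]
  refine lt_of_le_of_lt (lintegral_mono (g := fun s => ENNReal.ofReal C * K.indicator 1 s) ?_) ?_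
  · intro s
    by_cases hs : s ∈ K
    · refine (Set.indicator_le_self _ _ _).trans (mul_le_mul' (ENNReal.ofReal_le_ofReal ?_) le_rfl)
      exact (le_abs_self _).trans (hC s hs)
    · refine (Set.indicator_le_self _ _ _).trans ?_
      simp [Set.indicator_of_notMem hs]
  · rw [lintegral_const_mul _ (measurable_one.indicator hK.measurableSet),
      lintegral_indicator_one hK.measurableSet]
    exact ENNReal.mul_lt_top ENNReal.ofReal_lt_top (symVolume_lt_top_of_isCompact hK)

theorem coneMeasure_coneInterval_lt_top (m : ℕ) {ε : ℝ} (hε : 0 < ε) (ρ : ℝ) :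
    coneMeasure m (coneInterval m ε ρ) < ⊤ :=
  (measure_mono (coneInterval_subset_coneBox m ε ρ)).trans_lt
    (coneMeasure_lt_top_of_isCompact (isCompact_coneBox m hε ρ)
      fun _ hs => posDef_of_mem_coneBox hε hs)

/-- For large $r$, $s+rI=\bigl(rI-(s^2+I)\bigr)+\tfrac12(s+I)^2+\tfrac12(s^2+I)$ is a positive
definite matrix plus semidefinite ones. -/
theorem exists_add_smul_posDef {m : ℕ} {s : Mat m m} (hs : s.transpose = s) :
    ∃ r : ℕ, (s + (r : ℝ) • (1 : Mat m m)).PosDef := by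
  have hsq : ∀ t : Mat m m, t.transpose = t → (t * t).PosSemidef := fun t ht => by
    have := posSemidef_mul_transpose t
    rwa [ht] at this
  have h1 : (s * s + 1).PosDef := Matrix.PosDef.one.posSemidef_add (hsq s hs)
  obtain ⟨R, hR⟩ := PosDef.exists_smul_sub h1
  obtain ⟨r, hr⟩ := exists_nat_gt R
  have h2 := hR r hr
  have h3 : ((1 / 2 : ℝ) • ((s + 1) * (s + 1))).PosSemidef :=
    (hsq (s + 1) (by simp [hs])).smul (by norm_num)
  have h4 : ((1 / 2 : ℝ) • (s * s + 1)).PosSemidef := h1.posSemidef.smul (by norm_num)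
  have h5 := (h2.add_posSemidef h3).add_posSemidef h4
  refine ⟨r, ?_⟩
  convert h5 using 1
  simp only [Matrix.add_mul, Matrix.mul_add, Matrix.one_mul, Matrix.mul_one]
  module

/-- Countably many translates of the cone by multiples of the identity cover all symmetric matrices,
so a null cone would make the whole space null. -/
theorem symVolume_posDef_ne_zero (m : ℕ) : symVolume m {s | s.PosDef} ≠ 0 := by
  rw [symVolume, Measure.map_apply (continuous_symOfUpper m).measurable (measurableSet_posDef m)]
  set A := symOfUpper m ⁻¹' {s | s.PosDef} with hA
  intro h0
  have hcov : (Set.univ : Set (SymCoord m)) ⊆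
      ⋃ r : ℕ, (fun c => c + upperPart ((r : ℝ) • (1 : Mat m m))) ⁻¹' A := by
    intro c _
    obtain ⟨r, hr⟩ := exists_add_smul_posDef (symOfUpper_transpose c)
    refine Set.mem_iUnion.2 ⟨r, ?_⟩
    have h1 : symOfUpper m (c + upperPart ((r : ℝ) • (1 : Mat m m))) =
        symOfUpper m c + symOfUpper m (upperPart ((r : ℝ) • (1 : Mat m m))) := rfl
    rw [Set.mem_preimage, hA, Set.mem_preimage, h1, symOfUpper_upperPart (by simp)]
    exact hr
  have : (volume : Measure (SymCoord m)) Set.univ = 0 := by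
    refine measure_mono_null hcov (measure_iUnion_null fun r => ?_)
    rw [measure_preimage_add_right]
    exact h0
  exact NeZero.ne (volume : Measure (SymCoord m)) (Measure.measure_univ_eq_zero.1 this)

theorem coneMeasure_ne_zero (m : ℕ) : coneMeasure m ≠ 0 := by
  intro h0
  have h1 := lintegral_coneMeasure (m := m) (F := fun _ => 1) measurable_one
  rw [h0, lintegral_zero_measure, eq_comm, lintegral_indicator (measurableSet_posDef m),
    lintegral_eq_zero_iff ((measurable_ofReal_det_rpow _).mul_const 1)] at h1
  have h2 : ∀ᵐ s ∂(symVolume m).restrict {s | s.PosDef}, False := by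
    filter_upwards [h1, ae_restrict_mem (measurableSet_posDef m)] with s hs hP
    simp only [mul_one, Pi.zero_apply, ENNReal.ofReal_eq_zero] at hs
    exact absurd hs (not_le.2 (Real.rpow_pos_of_pos (Matrix.PosDef.det_pos hP) _))
  rw [eventually_false_iff_eq_bot, ae_eq_bot, Measure.restrict_eq_zero] at h2
  exact symVolume_posDef_ne_zero m h2

theorem lintegral_coneGaussian_ne_zero {N m : ℕ} (h : m ≤ N) :
    ∫⁻ s, coneGaussian m ((N : ℝ) / 2) s ∂coneMeasure m ≠ 0 := by
  intro h0
  have h1 := (isConeInvariant_coneMeasure m).lintegral_mul_lintegral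
    (H := fun _ => 1) measurable_one (measurable_coneGaussian m ((N : ℝ) / 2))
  rw [h0, zero_mul, lintegral_one, mul_eq_zero, or_iff_left (lintegral_coneGaussian_glMeasure h).2]
    at h1
  exact coneMeasure_ne_zero m (Measure.measure_univ_eq_zero.1 h1)

theorem exists_mem_coneInterval {m : ℕ} {s : Mat m m} (hs : s.PosDef) :
    ∃ r : ℕ, s ∈ coneInterval m ((r : ℝ) + 1)⁻¹ (r + 1) := by
  obtain ⟨δ, hδ, h1⟩ := PosDef.exists_sub_smul hs
  obtain ⟨R, h2⟩ := PosDef.exists_smul_sub hs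
  obtain ⟨r, hr⟩ := exists_nat_gt (max δ⁻¹ R)
  have h3 := (le_max_left _ _).trans_lt hr
  have h4 := (le_max_right _ _).trans_lt hr
  exact ⟨r, h1 _ (inv_lt_of_inv_lt₀ hδ (by linarith)), h2 _ (by linarith)⟩

/-- Suppose the integral is infinite and compare with the indicator of a bounded cone interval. The
left side of the comparison is finite, so $x^{-1}x^{-1\prime}$ must avoid the interval for almost
every $x$. Countably many intervals exhaust the cone, which is absurd. -/
theorem lintegral_coneGaussian_ne_top {N m : ℕ} (h : m ≤ N) :
    ∫⁻ s, coneGaussian m ((N : ℝ) / 2) s ∂coneMeasure m ≠ ⊤ := by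
  intro htop
  have key : ∀ r : ℕ, ∀ᵐ x ∂glMeasure m,
      x⁻¹ * x⁻¹.transpose ∉ coneInterval m ((r : ℝ) + 1)⁻¹ (r + 1) := by
    intro r
    have hm := measurableSet_coneInterval m ((r : ℝ) + 1)⁻¹ (r + 1)
    have hx : Measurable fun x : Mat m m => x⁻¹ * x⁻¹.transpose :=
      measurable_mul (measurable_inv m) (measurable_transpose.comp (measurable_inv m))
    have h1 := (isConeInvariant_coneMeasure m).lintegral_mul_lintegral
      (H := (coneInterval m ((r : ℝ) + 1)⁻¹ (r + 1)).indicator 1) (measurable_one.indicator hm)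
      (measurable_coneGaussian m ((N : ℝ) / 2))
    rw [htop, lintegral_indicator_one hm] at h1
    have h2 : ∫⁻ x, (coneInterval m ((r : ℝ) + 1)⁻¹ (r + 1)).indicator 1
        (x⁻¹ * x⁻¹.transpose) ∂glMeasure m = 0 := by
      by_contra hne
      rw [ENNReal.top_mul hne] at h1
      exact (ENNReal.mul_lt_top (coneMeasure_coneInterval_lt_top m (by positivity) _)
        (lintegral_coneGaussian_glMeasure h).1.lt_top).ne h1
    have h3 : Measurable fun x : Mat m m => (coneInterval m ((r : ℝ) + 1)⁻¹ (r + 1)).indicator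
        (1 : Mat m m → ENNReal) (x⁻¹ * x⁻¹.transpose) := (measurable_one.indicator hm).comp hx
    rw [lintegral_eq_zero_iff h3] at h2
    filter_upwards [h2] with x hx' hmem
    simp [hmem] at hx'
  have hF : ∀ᵐ x ∂glMeasure m, False := by
    filter_upwards [ae_all_iff.2 key, ae_det_ne_zero_glMeasure m] with x hx hd
    have hP : (x⁻¹ * x⁻¹.transpose).PosDef := by
      simpa using posDef_conj Matrix.PosDef.one (det_inv_ne_zero hd)
    obtain ⟨r, hr⟩ := exists_mem_coneInterval hP
    exact hx r hr
  rw [eventually_false_iff_eq_bot, ae_eq_bot] at hF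
  apply (lintegral_coneGaussian_glMeasure h).2
  rw [hF, lintegral_zero_measure]

/-- `siegelGamma` is a Bochner integral, with default value 0 in case of divergence; finiteness of
the lower integral is what makes the two agree and, with nonvanishing, gives positivity. -/
theorem lintegral_coneGaussian_eq {N m : ℕ} (h : m ≤ N) :
    0 < siegelGamma m ((N : ℝ) / 2) ∧ ∫⁻ s, coneGaussian m ((N : ℝ) / 2) s ∂coneMeasure m =
      ENNReal.ofReal (siegelGamma m ((N : ℝ) / 2)) := by
  have hP := measurableSet_posDef m
  have h1 : ∫⁻ s, coneGaussian m ((N : ℝ) / 2) s ∂coneMeasure m =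
      ∫⁻ s in {s : Mat m m | s.PosDef}, ENNReal.ofReal
        (Real.exp (-s.trace) * s.det ^ ((N : ℝ) / 2 - ((m : ℝ) + 1) / 2)) ∂symVolume m := by
    rw [lintegral_coneMeasure (measurable_coneGaussian m _), lintegral_indicator hP]
    refine setLIntegral_congr_fun hP fun s hs => ?_
    have hd : 0 < s.det := Matrix.PosDef.det_pos hs
    rw [coneGaussian, ← ENNReal.ofReal_mul (by positivity), mul_left_comm, ← Real.rpow_add hd]
    congr 3
    ring
  have hm : Measurable fun s : Mat m m =>
      Real.exp (-s.trace) * s.det ^ ((N : ℝ) / 2 - ((m : ℝ) + 1) / 2) := by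
    refine Measurable.mul ?_ ((measurable_det m).pow_const _)
    exact Continuous.measurable (Real.continuous_exp.comp (continuous_id.matrix_trace.neg))
  have h0 : 0 ≤ᵐ[(symVolume m).restrict {s : Mat m m | s.PosDef}] fun s =>
      Real.exp (-s.trace) * s.det ^ ((N : ℝ) / 2 - ((m : ℝ) + 1) / 2) := by
    filter_upwards [ae_restrict_mem hP] with s hs
    have hd : 0 < s.det := Matrix.PosDef.det_pos hs
    exact (mul_pos (Real.exp_pos _) (Real.rpow_pos_of_pos hd _)).le
  have hInt : Integrable (fun s : Mat m m =>
      Real.exp (-s.trace) * s.det ^ ((N : ℝ) / 2 - ((m : ℝ) + 1) / 2))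
      ((symVolume m).restrict {s : Mat m m | s.PosDef}) := by
    refine ⟨hm.aestronglyMeasurable, ?_⟩
    rw [hasFiniteIntegral_iff_ofReal h0, ← h1]
    exact (lintegral_coneGaussian_ne_top h).lt_top
  have h2 : ∫⁻ s, coneGaussian m ((N : ℝ) / 2) s ∂coneMeasure m =
      ENNReal.ofReal (siegelGamma m ((N : ℝ) / 2)) := by
    rw [h1, siegelGamma, ofReal_integral_eq_lintegral_ofReal hInt h0]
  refine ⟨?_, h2⟩
  by_contra hneg
  rw [ENNReal.ofReal_of_nonpos (not_lt.1 hneg)] at h2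
  exact lintegral_coneGaussian_ne_zero h h2

/-! ### Polar coordinates: the distribution of `yᵀ y` -/

theorem measurable_gram (N m : ℕ) : Measurable fun y : Mat N m => y.transpose * y :=
  measurable_mul measurable_transpose measurable_id

/-- The image of `|y|_m^{-N} dy` under `y ↦ yᵀ y`. -/
noncomputable def gramMeasure (N m : ℕ) : Measure (Mat m m) :=
  Measure.map (fun y : Mat N m => y.transpose * y)
    (volume.withDensity fun y : Mat N m =>
      ENNReal.ofReal ((y.transpose * y).det ^ (-(N : ℝ) / 2)))

instance (N m : ℕ) : SFinite (gramMeasure N m) := by unfold gramMeasure; infer_instance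

theorem lintegral_gramMeasure {N m : ℕ} {F : Mat m m → ENNReal} (hF : Measurable F) :
    ∫⁻ s, F s ∂gramMeasure N m = ∫⁻ y : Mat N m,
      ENNReal.ofReal ((y.transpose * y).det ^ (-(N : ℝ) / 2)) * F (y.transpose * y) := by
  have h1 : Measurable fun y : Mat N m =>
      ENNReal.ofReal ((y.transpose * y).det ^ (-(N : ℝ) / 2)) :=
    (measurable_ofReal_det_rpow _).comp (measurable_gram N m)
  have h2 : Measurable fun y : Mat N m => F (y.transpose * y) := hF.comp (measurable_gram N m)
  rw [gramMeasure, lintegral_map hF (measurable_gram N m),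
    lintegral_withDensity_eq_lintegral_mul _ h1 h2]
  rfl

/-- The substitution $y\mapsto yg'$ sends $y'y$ to $g(y'y)g'$, and its Jacobian $|\det g|^N$ cancels
the change of the density $|y'y|^{-N/2}$. -/
theorem isConeInvariant_gramMeasure {N m : ℕ} (h : m ≤ N) :
    IsConeInvariant (gramMeasure N m) := by
  refine ⟨?_, fun g hg F hF => ?_⟩
  · rw [gramMeasure, ae_map_iff (measurable_gram N m).aemeasurable (measurableSet_posDef m)]
    exact (withDensity_absolutelyContinuous _ _).ae_le (ae_posDef_gram h)
  · have hFg : Measurable fun s => F (g * s * g.transpose) := hF.comp (measurable_conj g)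
    rw [lintegral_gramMeasure hFg, lintegral_gramMeasure hF]
    have hg0 : 0 < |g.det| := abs_pos.2 hg
    have h1 := lintegral_mul_right (n := N) g.transpose (by rwa [Matrix.det_transpose])
      (fun y : Mat N m => ENNReal.ofReal ((y.transpose * y).det ^ (-(N : ℝ) / 2)) *
        F (y.transpose * y))
    have h2 : ∀ᵐ y : Mat N m,
        ENNReal.ofReal (((y * g.transpose).transpose * (y * g.transpose)).det ^ (-(N : ℝ) / 2)) *
          F ((y * g.transpose).transpose * (y * g.transpose)) =
        ENNReal.ofReal (|g.det|⁻¹ ^ N) *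
          (ENNReal.ofReal ((y.transpose * y).det ^ (-(N : ℝ) / 2)) *
            F (g * (y.transpose * y) * g.transpose)) := by
      filter_upwards [ae_posDef_gram h] with y hy
      have h3 : (y * g.transpose).transpose * (y * g.transpose) =
          g * (y.transpose * y) * g.transpose := by
        simp [Matrix.transpose_mul, Matrix.mul_assoc]
      rw [h3, det_conj, Real.mul_rpow (by positivity) hy.det_pos.le,
        ENNReal.ofReal_mul (by positivity), mul_assoc, ← Real.rpow_natCast _ 2,
        ← Real.rpow_mul hg0.le,
        show ((2 : ℕ) : ℝ) * (-(N : ℝ) / 2) = -((N : ℕ) : ℝ) by push_cast; ring,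
        Real.rpow_neg hg0.le, Real.rpow_natCast, inv_pow]
    have hmm : Measurable fun y : Mat N m =>
        ENNReal.ofReal ((y.transpose * y).det ^ (-(N : ℝ) / 2)) *
            F (g * (y.transpose * y) * g.transpose) :=
      ((measurable_ofReal_det_rpow _).comp (measurable_gram N m)).fun_mul
        (hFg.comp (measurable_gram N m))
    rw [lintegral_congr_ae h2, lintegral_const_mul _ hmm, Matrix.det_transpose] at h1
    refine (ENNReal.mul_right_inj ?_ ENNReal.ofReal_ne_top).1 h1
    have : 0 < |g.det|⁻¹ ^ N := by positivity
    simpa using this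

/-- The constant `π^{Nm/2} / Γ_m(N/2)`. -/
noncomputable def gramConst (N m : ℕ) : ℝ :=
  Real.pi ^ ((N : ℝ) * m / 2) / siegelGamma m ((N : ℝ) / 2)

theorem gramConst_pos {N m : ℕ} (h : m ≤ N) : 0 < gramConst N m :=
  div_pos (Real.rpow_pos_of_pos Real.pi_pos _) (lintegral_coneGaussian_eq h).1

/-- Integration of functions of `yᵀ y`. -/
theorem lintegral_gram {N m : ℕ} (h : m ≤ N) {H : Mat m m → ENNReal} (hH : Measurable H) :
    ∫⁻ y : Mat N m, H (y.transpose * y) = ENNReal.ofReal (gramConst N m) *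
      ∫⁻ s, ENNReal.ofReal (s.det ^ ((N : ℝ) / 2)) * H s ∂coneMeasure m := by
  have hgm : ∀ G : Mat m m → ENNReal, Measurable G →
      ∫⁻ s, ENNReal.ofReal (s.det ^ ((N : ℝ) / 2)) * G s ∂gramMeasure N m =
        ∫⁻ y : Mat N m, G (y.transpose * y) := by
    intro G hG
    rw [lintegral_gramMeasure ((measurable_ofReal_det_rpow _).fun_mul hG)]
    refine lintegral_congr_ae ?_
    filter_upwards [ae_posDef_gram h] with y hy
    rw [← mul_assoc, ← ENNReal.ofReal_mul (Real.rpow_nonneg hy.det_pos.le _),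
      ← Real.rpow_add hy.det_pos, neg_div, neg_add_cancel, Real.rpow_zero, ENNReal.ofReal_one,
      one_mul]
  have hφ : ∫⁻ s, coneGaussian m ((N : ℝ) / 2) s ∂gramMeasure N m =
      ENNReal.ofReal (Real.pi ^ ((N : ℝ) * m / 2)) := by
    rw [← lintegral_gaussian_mat, ← hgm (fun s => ENNReal.ofReal (Real.exp (-s.trace)))]
    · refine lintegral_congr fun s => ?_
      rw [coneGaussian, ENNReal.ofReal_mul (Real.exp_pos _).le, mul_comm]
    · exact (Continuous.measurable
        (Real.continuous_exp.comp (continuous_id.matrix_trace.neg))).ennreal_ofReal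
  have hHm : Measurable fun s : Mat m m => ENNReal.ofReal (s.det ^ ((N : ℝ) / 2)) * H s :=
    (measurable_ofReal_det_rpow _).fun_mul hH
  -- The same comparison is made for both measures with the same pair of functions. Eliminating the
  -- common integral over $GL(m)$ leaves the ratio of the two Gaussian integrals, $\pi^{Nm/2}$ and
  -- $\Gamma_m(N/2)$.
  have e1 := (isConeInvariant_gramMeasure h).lintegral_mul_lintegral hHm
    (measurable_coneGaussian m ((N : ℝ) / 2))
  have e2 := (isConeInvariant_coneMeasure m).lintegral_mul_lintegral hHm
    (measurable_coneGaussian m ((N : ℝ) / 2))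
  obtain ⟨hΓ, hΓe⟩ := lintegral_coneGaussian_eq (N := N) h
  rw [hgm H hH, hφ] at e1
  rw [hΓe] at e2
  obtain ⟨hc1, hc2⟩ := lintegral_coneGaussian_glMeasure (N := N) h
  set A := ∫⁻ y : Mat N m, H (y.transpose * y)
  set B := ∫⁻ s, ENNReal.ofReal (s.det ^ ((N : ℝ) / 2)) * H s ∂coneMeasure m
  set c := ∫⁻ x, coneGaussian m ((N : ℝ) / 2) (x * x.transpose) ∂glMeasure m
  have hΓ0 : ENNReal.ofReal (siegelGamma m ((N : ℝ) / 2)) ≠ 0 := by simpa using hΓ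
  have e3 : A * ENNReal.ofReal (siegelGamma m ((N : ℝ) / 2)) =
      ENNReal.ofReal (Real.pi ^ ((N : ℝ) * m / 2)) * B := by
    refine (ENNReal.mul_left_inj hc2 hc1).1 ?_
    rw [mul_right_comm, e1, mul_assoc _ B c, e2]
    ring
  rw [gramConst, ENNReal.ofReal_div_of_pos hΓ, ENNReal.div_eq_inv_mul, mul_assoc, ← e3,
    mul_comm A, ← mul_assoc, ENNReal.inv_mul_cancel hΓ0 ENNReal.ofReal_ne_top, one_mul]

theorem map_gram_volume {N m : ℕ} (h : m ≤ N) :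
    Measure.map (fun y : Mat N m => y.transpose * y) volume =
      ENNReal.ofReal (gramConst N m) • (coneMeasure m).withDensity
        fun s => ENNReal.ofReal (s.det ^ ((N : ℝ) / 2)) := by
  refine Measure.ext_of_lintegral _ fun F hF => ?_
  rw [lintegral_map hF (measurable_gram N m), lintegral_gram h hF, lintegral_smul_measure,
    lintegral_withDensity_eq_lintegral_mul _ (measurable_ofReal_det_rpow _) hF]
  rfl

/-! ### Averages over the orthogonal group -/

/-- The average of a function over the orthogonal group. -/
noncomputable def orthAverage {n m : ℕ} (G : Mat n m → ENNReal) (y : Mat n m) : ENNReal :=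
  ∫⁻ g : Orth n, G ((g : Mat n n) * y) ∂orthMeasure n

theorem measurable_orth_mul (n m : ℕ) :
    Measurable fun p : Orth n × Mat n m => (p.1 : Mat n n) * p.2 :=
  measurable_mul (measurable_subtype_coe.comp measurable_fst) measurable_snd

theorem measurable_orthAverage {n m : ℕ} {G : Mat n m → ENNReal} (hG : Measurable G) :
    Measurable (orthAverage G) :=
  Measurable.lintegral_prod_left' (f := fun p : Orth n × Mat n m => G ((p.1 : Mat n n) * p.2))
    (hG.comp (measurable_orth_mul n m))

theorem orthAverage_mul {n m : ℕ} (G : Mat n m → ENNReal) {g : Mat n n}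
    (hg : g.transpose * g = 1) (y : Mat n m) : orthAverage G (g * y) = orthAverage G y := by
  have := lintegral_mul_right_eq_self (μ := orthMeasure n)
    (fun γ : Orth n => G ((γ : Mat n n) * y)) (toOrth g hg)
  rw [orthAverage, orthAverage, ← this]
  refine lintegral_congr fun γ => ?_
  rw [← Matrix.mul_assoc]
  rfl

/-- Polar decomposition $y=\xi(y'y)^{1/2}$ with an orthonormal frame $\xi$: as $O(n)$ acts
transitively on frames, the average depends on $y'y$ only. -/
theorem orthAverage_eq {n m : ℕ} (h : m ≤ n) (G : Mat n m → ENNReal) {y : Mat n m}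
    (hy : (y.transpose * y).PosDef) :
    orthAverage G y = orthAverage G (topFrame n m * rootMat (y.transpose * y)) := by
  set s := y.transpose * y with hs
  set r := rootMat s with hr
  have hd : IsUnit r.det := (det_rootMat_ne_zero hy).isUnit
  have hξ : (y * r⁻¹).transpose * (y * r⁻¹) = 1 := by
    rw [Matrix.transpose_mul, Matrix.mul_assoc, ← Matrix.mul_assoc y.transpose, ← hs,
      ← rootMat_mul_self hy.posSemidef, ← hr, Matrix.mul_assoc, Matrix.mul_nonsing_inv _ hd,
      Matrix.mul_one, Matrix.transpose_nonsing_inv, hr, transpose_rootMat,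
      Matrix.nonsing_inv_mul _ hd]
  obtain ⟨g, hg, hgy⟩ := exists_orth_mul_eq h (topFrame n m) (y * r⁻¹) (topFrame_mem h) hξ
  rw [← orthAverage_mul G hg (topFrame n m * r), ← Matrix.mul_assoc, hgy, Matrix.mul_assoc,
    Matrix.nonsing_inv_mul _ hd, Matrix.mul_one]

theorem gram_orth_mul {n m : ℕ} {g : Mat n n} (hg : g.transpose * g = 1) (y : Mat n m) :
    (g * y).transpose * (g * y) = y.transpose * y := by
  rw [Matrix.transpose_mul, Matrix.mul_assoc, ← Matrix.mul_assoc g.transpose, hg, Matrix.one_mul]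

theorem gram_frame_mul {n q m : ℕ} {ξ : Mat n q} (hξ : ξ.transpose * ξ = 1) (η : Mat q m) :
    (ξ * η).transpose * (ξ * η) = η.transpose * η := by
  rw [Matrix.transpose_mul, Matrix.mul_assoc, ← Matrix.mul_assoc ξ.transpose, hξ, Matrix.one_mul]

theorem measurable_frame_mul (n q m : ℕ) :
    Measurable fun p : Stiefel n q × Mat q m => (p.1 : Mat n q) * p.2 :=
  measurable_mul (measurable_subtype_coe.comp measurable_fst) measurable_snd

/-- Integration over all frames and all coordinates with respect to them. -/
theorem lintegral_frame_mul {n k m : ℕ} (hkn : k + m ≤ n) {G : Mat n m → ENNReal}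
    (hG : Measurable G) :
    ∫⁻ ξ, (∫⁻ η : Mat (n - k) m, G ((ξ : Mat n (n - k)) * η)) ∂stiefelMeasure n k =
      ENNReal.ofReal (gramConst (n - k) m / gramConst n m) *
        ∫⁻ y : Mat n m, ENNReal.ofReal ((y.transpose * y).det ^ (-(k : ℝ) / 2)) * G y := by
  have hmn : m ≤ n := by omega
  have hmq : m ≤ n - k := by omega
  set H : Mat m m → ENNReal := fun s => orthAverage G (topFrame n m * rootMat s) with hH
  have hHm : Measurable H :=
    (measurable_orthAverage hG).comp (measurable_mul measurable_const (measurable_rootMat m))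
  have hGf : Measurable fun p : Stiefel n (n - k) × Mat (n - k) m => G ((p.1 : Mat n (n - k)) * p.2) :=
    hG.comp (measurable_frame_mul n (n - k) m)
  -- Both sides reduce to integrals over the cone of the $O(n)$-average `H`: on the left because
  -- $(\xi\eta)'(\xi\eta)=\eta'\eta$, on the right by invariance of $dy$. The weights agree, since
  -- $|s|^{-k/2}|s|^{n/2}=|s|^{(n-k)/2}$.
  have e1 : ∫⁻ ξ, (∫⁻ η : Mat (n - k) m, G ((ξ : Mat n (n - k)) * η)) ∂stiefelMeasure n k =
      ∫⁻ η : Mat (n - k) m, H (η.transpose * η) := by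
    rw [stiefelMeasure, lintegral_map hGf.lintegral_prod_right' (measurable_rotateFrame n k)]
    have hm2 : Measurable fun p : Orth n × Mat (n - k) m =>
        G ((rotateFrame n k p.1 : Mat n (n - k)) * p.2) :=
      hGf.comp (((measurable_rotateFrame n k).comp measurable_fst).prodMk measurable_snd)
    rw [lintegral_lintegral_swap hm2.aemeasurable]
    refine lintegral_congr_ae ?_
    filter_upwards [ae_posDef_gram hmq] with η hη
    have h1 : (baseFrame n k * η).transpose * (baseFrame n k * η) = η.transpose * η :=
      gram_frame_mul (baseFrame_mem n k) η
    rw [hH]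
    dsimp only
    rw [← h1, ← orthAverage_eq hmn G (by rwa [h1])]
    refine lintegral_congr fun g => ?_
    rw [← Matrix.mul_assoc]
    rfl
  have hw : Measurable fun y : Mat n m =>
      ENNReal.ofReal ((y.transpose * y).det ^ (-(k : ℝ) / 2)) :=
    (measurable_ofReal_det_rpow _).comp (measurable_gram n m)
  have e2 : ∫⁻ y : Mat n m, ENNReal.ofReal ((y.transpose * y).det ^ (-(k : ℝ) / 2)) * G y =
      ∫⁻ y : Mat n m, ENNReal.ofReal ((y.transpose * y).det ^ (-(k : ℝ) / 2)) *
        H (y.transpose * y) := by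
    have h1 : ∀ g : Orth n,
        ∫⁻ y : Mat n m, ENNReal.ofReal ((y.transpose * y).det ^ (-(k : ℝ) / 2)) *
          G ((g : Mat n n) * y) =
        ∫⁻ y : Mat n m, ENNReal.ofReal ((y.transpose * y).det ^ (-(k : ℝ) / 2)) * G y := by
      intro g
      rw [← (measurePreserving_orth m (g : Mat n n) (orth_transpose_mul g)).lintegral_comp
        (hw.fun_mul hG)]
      refine lintegral_congr fun y => ?_
      rw [gram_orth_mul (orth_transpose_mul g)]
    have h2 : ∫⁻ y : Mat n m, ENNReal.ofReal ((y.transpose * y).det ^ (-(k : ℝ) / 2)) * G y =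
        ∫⁻ g : Orth n, (∫⁻ y : Mat n m, ENNReal.ofReal ((y.transpose * y).det ^ (-(k : ℝ) / 2)) *
          G ((g : Mat n n) * y)) ∂orthMeasure n := by
      simp only [h1, lintegral_const, measure_univ, mul_one]
    have hm3 : Measurable fun p : Orth n × Mat n m =>
        ENNReal.ofReal ((p.2.transpose * p.2).det ^ (-(k : ℝ) / 2)) * G ((p.1 : Mat n n) * p.2) :=
      (hw.comp measurable_snd).fun_mul (hG.comp (measurable_orth_mul n m))
    rw [h2, lintegral_lintegral_swap hm3.aemeasurable]
    refine lintegral_congr_ae ?_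
    filter_upwards [ae_posDef_gram hmn] with y hy
    have hGy : Measurable fun g : Orth n => G ((g : Mat n n) * y) :=
      hG.comp (measurable_mul measurable_subtype_coe measurable_const)
    rw [lintegral_const_mul _ hGy, hH]
    dsimp only
    rw [← orthAverage_eq hmn G hy]
    rfl
  have e3 : ∫⁻ y : Mat n m, ENNReal.ofReal ((y.transpose * y).det ^ (-(k : ℝ) / 2)) *
        H (y.transpose * y) = ENNReal.ofReal (gramConst n m) *
      ∫⁻ s, ENNReal.ofReal (s.det ^ (((n - k : ℕ) : ℝ) / 2)) * H s ∂coneMeasure m := by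
    rw [lintegral_gram hmn (H := fun s => ENNReal.ofReal (s.det ^ (-(k : ℝ) / 2)) * H s)
      ((measurable_ofReal_det_rpow _).fun_mul hHm)]
    congr 1
    refine lintegral_congr_ae ?_
    filter_upwards [ae_posDef_coneMeasure m] with s hs
    rw [← mul_assoc, ← ENNReal.ofReal_mul (Real.rpow_nonneg hs.det_pos.le _),
      ← Real.rpow_add hs.det_pos, Nat.cast_sub (by omega)]
    congr 3
    ring
  have hcn := gramConst_pos hmn
  have hcn0 : ENNReal.ofReal (gramConst n m) ≠ 0 := by simpa using hcn
  rw [e1, e2, e3, lintegral_gram hmq hHm, ENNReal.ofReal_div_of_pos hcn, ← mul_assoc,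
    ENNReal.div_mul_cancel hcn0 ENNReal.ofReal_ne_top]

theorem map_frame_mul {n k m : ℕ} (hkn : k + m ≤ n) :
    Measure.map (fun p : Stiefel n (n - k) × Mat (n - k) m => (p.1 : Mat n (n - k)) * p.2)
      ((stiefelMeasure n k).prod volume) =
    ENNReal.ofReal (gramConst (n - k) m / gramConst n m) • (volume : Measure (Mat n m)).withDensity
      fun y => ENNReal.ofReal ((y.transpose * y).det ^ (-(k : ℝ) / 2)) := by
  have hw : Measurable fun y : Mat n m =>
      ENNReal.ofReal ((y.transpose * y).det ^ (-(k : ℝ) / 2)) :=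
    (measurable_ofReal_det_rpow _).comp (measurable_gram n m)
  refine Measure.ext_of_lintegral _ fun F hF => ?_
  have hFf : Measurable fun p : Stiefel n (n - k) × Mat (n - k) m =>
      F ((p.1 : Mat n (n - k)) * p.2) := hF.comp (measurable_frame_mul n (n - k) m)
  rw [lintegral_map hF (measurable_frame_mul n (n - k) m), lintegral_prod _ hFf.aemeasurable,
    lintegral_frame_mul hkn hF, lintegral_smul_measure,
    lintegral_withDensity_eq_lintegral_mul _ hw hF]
  rfl

/-! ### Plane integrals -/

theorem stack_eq {n k m : ℕ} (hkn : k ≤ n) (ω : Mat k m) (t : Mat (n - k) m) :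
    stack ω t = topFrame n k * ω + baseFrame n k * t := by
  ext i j
  rw [Matrix.add_apply, Matrix.mul_apply, Matrix.mul_apply]
  by_cases h : (i : ℕ) < k
  · rw [Finset.sum_eq_single (⟨i, h⟩ : Fin k), Finset.sum_eq_zero]
    · simp [stack, topFrame, h]
    · intro l _
      have : ¬ (i : ℕ) = k + l := by omega
      simp [baseFrame, this]
    · intro l _ hl
      have : ¬ (i : ℕ) = l := fun e => hl (Fin.ext e.symm)
      simp [topFrame, this]
    · simp
  · rw [Finset.sum_eq_zero, zero_add, Finset.sum_eq_single (⟨i - k, by omega⟩ : Fin (n - k))]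
    · have : (i : ℕ) = k + (i - k) := by omega
      simp [stack, baseFrame, h, ← this]
    · intro l _ hl
      have : ¬ (i : ℕ) = k + l := fun e => hl (Fin.ext (by simp; omega))
      simp [baseFrame, this]
    · simp
    · intro l _
      have : ¬ (i : ℕ) = l := by omega
      simp [topFrame, this]

theorem baseFrame_transpose_mul_topFrame (n k : ℕ) :
    (baseFrame n k).transpose * topFrame n k = 0 := by
  ext i j
  rw [Matrix.mul_apply, Matrix.zero_apply, Finset.sum_eq_zero]
  intro l _
  by_cases h : (l : ℕ) = k + i
  · have : ¬ (l : ℕ) = j := by omega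
    simp [topFrame, this]
  · simp [baseFrame, h]

theorem topFrame_mul_transpose_add {n k : ℕ} (hkn : k ≤ n) :
    topFrame n k * (topFrame n k).transpose + baseFrame n k * (baseFrame n k).transpose = 1 := by
  rw [← stack_eq hkn]
  ext i j
  by_cases h : (i : ℕ) < k
  · simp [stack, topFrame, h, Matrix.one_apply, Fin.ext_iff, eq_comm]
  · have : (j : ℕ) = k + (i - k) ↔ (i : ℕ) = j := by omega
    simp [stack, baseFrame, h, Matrix.one_apply, Fin.ext_iff, this]

/-- Since $g^{-1}g'$ fixes the last $n-k$ coordinate vectors, it acts as an orthogonal matrix on the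
first $k$. This $U$ preserves $d\omega$, so the plane integrals do not depend on the chosen rotation
$g_\xi$. -/
theorem exists_orth_stack {n k : ℕ} (hkn : k ≤ n) {g g' : Mat n n} (hg : g.transpose * g = 1)
    (hg' : g'.transpose * g' = 1) (h : g * baseFrame n k = g' * baseFrame n k) :
    ∃ U : Mat k k, U.transpose * U = 1 ∧ ∀ (m : ℕ) (ω : Mat k m) (t : Mat (n - k) m),
      g' * stack ω t = g * stack (U * ω) t := by
  set b := baseFrame n k with hb
  set c := topFrame n k with hc
  set p := g.transpose * g' with hp
  have hgp : g * p = g' := by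
    rw [hp, ← Matrix.mul_assoc, orth_mul_transpose hg, Matrix.one_mul]
  have hpb : p * b = b := by
    rw [hp, Matrix.mul_assoc, ← h, ← Matrix.mul_assoc, hg, Matrix.one_mul]
  have hpp : p.transpose * p = 1 := by
    rw [hp, Matrix.transpose_mul, Matrix.transpose_transpose, Matrix.mul_assoc,
      ← Matrix.mul_assoc g, orth_mul_transpose hg, Matrix.one_mul, hg']
  have hbp : b.transpose * p = b.transpose := by
    have : p.transpose * b = b := by
      conv_lhs => rw [← hpb]
      rw [← Matrix.mul_assoc, hpp, Matrix.one_mul]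
    rw [← Matrix.transpose_transpose p, ← Matrix.transpose_mul, this]
  have hcb : c * c.transpose = 1 - b * b.transpose := by
    rw [← topFrame_mul_transpose_add hkn]; simp [hb, hc]
  have hbc : b.transpose * c = 0 := baseFrame_transpose_mul_topFrame n k
  have hkey : p * c = c * (c.transpose * p * c) := by
    rw [← Matrix.mul_assoc, ← Matrix.mul_assoc, hcb, Matrix.sub_mul, Matrix.sub_mul, Matrix.one_mul,
      Matrix.mul_assoc b, hbp, Matrix.mul_assoc b, hbc, Matrix.mul_zero, sub_zero]
  refine ⟨c.transpose * p * c, ?_, fun m ω t => ?_⟩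
  · have h1 : (p * c).transpose * (p * c) = 1 := by
      rw [Matrix.transpose_mul, Matrix.mul_assoc, ← Matrix.mul_assoc p.transpose, hpp,
        Matrix.one_mul, hc, topFrame_mem hkn]
    have hcc : c.transpose * c = 1 := topFrame_mem hkn
    rw [hkey, Matrix.transpose_mul c, Matrix.mul_assoc, ← Matrix.mul_assoc c.transpose c, hcc,
      Matrix.one_mul] at h1
    exact h1
  · rw [stack_eq hkn, stack_eq hkn, ← hgp, Matrix.mul_assoc, ← hb, ← hc, Matrix.mul_add,
      ← Matrix.mul_assoc p, ← Matrix.mul_assoc p, hpb, hkey, Matrix.mul_assoc c]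

theorem measurable_stack (n k m : ℕ) (hkn : k ≤ n) :
    Measurable fun p : Mat k m × Mat (n - k) m => stack p.1 p.2 := by
  have : (fun p : Mat k m × Mat (n - k) m => stack p.1 p.2) = stackEquiv n k m hkn := by
    ext1 p; exact (stackEquiv_apply n k m hkn p).symm
  rw [this]
  exact (stackEquiv n k m hkn).measurable

theorem measurePreserving_orth_stack {n k : ℕ} (m : ℕ) (hkn : k ≤ n) {g : Mat n n}
    (hg : g.transpose * g = 1) :
    MeasurePreserving (fun p : Mat k m × Mat (n - k) m => g * stack p.1 p.2) := by
  have := (measurePreserving_orth m g hg).comp (measurePreserving_stackEquiv n k m hkn)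
  convert this using 1
  ext1 p
  simp [stackEquiv_apply]

theorem measurableEmbedding_orth_stack {n k : ℕ} (m : ℕ) (hkn : k ≤ n) {g : Mat n n}
    (hg : g.transpose * g = 1) :
    MeasurableEmbedding (fun p : Mat k m × Mat (n - k) m => g * stack p.1 p.2) := by
  have := (measurableEmbedding_orth m g hg).comp (stackEquiv n k m hkn).measurableEmbedding
  convert this using 1
  ext1 p
  simp [stackEquiv_apply]

theorem frame_transpose_mul_stack {n k m : ℕ} (hkn : k ≤ n) {g : Mat n n}
    (hg : g.transpose * g = 1) {ξ : Mat n (n - k)} (h : g * baseFrame n k = ξ) (ω : Mat k m)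
    (t : Mat (n - k) m) : ξ.transpose * (g * stack ω t) = t := by
  rw [← h, Matrix.transpose_mul, Matrix.mul_assoc, ← Matrix.mul_assoc g.transpose, hg,
    Matrix.one_mul, stack_eq hkn, Matrix.mul_add, ← Matrix.mul_assoc, ← Matrix.mul_assoc,
    baseFrame_transpose_mul_topFrame, baseFrame_mem, Matrix.zero_mul, Matrix.one_mul, zero_add]

theorem norm_toE_orth_stack {n k m : ℕ} (hkn : k ≤ n) {g : Mat n n}
    (hg : g.transpose * g = 1) (ω : Mat k m) (t : Mat (n - k) m) :
    ‖toE n m (g * stack ω t)‖ ^ 2 = ‖toE k m ω‖ ^ 2 + ‖toE (n - k) m t‖ ^ 2 := by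
  have hbc := baseFrame_transpose_mul_topFrame n k
  have hcb : (topFrame n k).transpose * baseFrame n k = 0 := by
    rw [← Matrix.transpose_transpose (baseFrame n k), ← Matrix.transpose_mul, hbc,
      Matrix.transpose_zero]
  rw [norm_toE_sq, norm_toE_sq, norm_toE_sq, gram_orth_mul hg, stack_eq hkn, Matrix.transpose_add,
    Matrix.mul_add, Matrix.add_mul, Matrix.add_mul, gram_frame_mul (topFrame_mem hkn),
    gram_frame_mul (baseFrame_mem n k), Matrix.transpose_mul, Matrix.transpose_mul,
    Matrix.mul_assoc t.transpose, ← Matrix.mul_assoc (baseFrame n k).transpose, hbc,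
    Matrix.mul_assoc ω.transpose, ← Matrix.mul_assoc (topFrame n k).transpose, hcb]
  simp [Matrix.trace_add]

/-- Integral of a nonnegative function over a matrix plane. -/
noncomputable def planeLIntegral {n k m : ℕ} (F : Mat n m → ENNReal) (ξ : Stiefel n (n - k))
    (t : Mat (n - k) m) : ENNReal :=
  ∫⁻ ω : Mat k m, F (rotationOf ξ * stack ω t)

theorem planeLIntegral_eq {n k m : ℕ} (hk : 1 ≤ k) (hkn : k ≤ n)
    (F : Mat n m → ENNReal) {ξ : Stiefel n (n - k)} {g : Mat n n}
    (hg : g.transpose * g = 1) (h : g * baseFrame n k = ξ) (t : Mat (n - k) m) :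
    planeLIntegral F ξ t = ∫⁻ ω : Mat k m, F (g * stack ω t) := by
  obtain ⟨h1, -, h3⟩ := rotationOf_spec hk hkn ξ
  obtain ⟨U, hU, hst⟩ := exists_orth_stack hkn hg h1 (h.trans h3.symm)
  rw [planeLIntegral]
  simp only [hst]
  exact (measurePreserving_orth m U hU).lintegral_comp_emb (measurableEmbedding_orth m U hU)
    fun ω => F (g * stack ω t)

theorem radon_eq {n k m : ℕ} (hk : 1 ≤ k) (hkn : k ≤ n)
    (f : Mat n m → ℂ) {ξ : Stiefel n (n - k)} {g : Mat n n}
    (hg : g.transpose * g = 1) (h : g * baseFrame n k = ξ) (t : Mat (n - k) m) :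
    radon f ξ t = ∫ ω : Mat k m, f (g * stack ω t) := by
  obtain ⟨h1, -, h3⟩ := rotationOf_spec hk hkn ξ
  obtain ⟨U, hU, hst⟩ := exists_orth_stack hkn hg h1 (h.trans h3.symm)
  rw [radon]
  simp only [hst]
  exact (measurePreserving_orth m U hU).integral_comp (measurableEmbedding_orth m U hU)
    fun ω => f (g * stack ω t)

/-- A rotation carrying the base frame to a given frame. -/
theorem exists_orth_baseFrame {n k : ℕ} (ξ : Stiefel n (n - k)) :
    ∃ g : Mat n n, g.transpose * g = 1 ∧ g * baseFrame n k = ξ :=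
  exists_orth_mul_eq (Nat.sub_le n k) (baseFrame n k) ξ.1 (baseFrame_mem n k) ξ.2

/-- The rotation $g_\xi$ is an arbitrary choice with no measurability in $\xi$. On $O(n)$ the group
element itself serves as rotation, and measurability descends along a measurable surjection of
standard Borel spaces. -/
theorem measurable_of_comp_rotateFrame {n k m : ℕ} {β : Type*} [MeasurableSpace β]
    {F : Stiefel n (n - k) × Mat (n - k) m → β}
    (h : Measurable fun p : Orth n × Mat (n - k) m => F (rotateFrame n k p.1, p.2)) :
    Measurable F := by
  have hm : Measurable fun p : Orth n × Mat (n - k) m => (rotateFrame n k p.1, p.2) :=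
    ((measurable_rotateFrame n k).comp measurable_fst).prodMk measurable_snd
  have hs : Function.Surjective
      fun p : Orth n × Mat (n - k) m => (rotateFrame n k p.1, p.2) := by
    rintro ⟨ξ, t⟩
    obtain ⟨g, rfl⟩ := rotateFrame_surjective n k ξ
    exact ⟨(g, t), rfl⟩
  exact (hm.measurable_comp_iff_of_surjective hs).1 h

theorem measurable_planeLIntegral {n k m : ℕ} (hk : 1 ≤ k) (hkn : k ≤ n) {F : Mat n m → ENNReal}
    (hF : Measurable F) :
    Measurable fun p : Stiefel n (n - k) × Mat (n - k) m => planeLIntegral F p.1 p.2 := by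
  refine measurable_of_comp_rotateFrame ?_
  have : (fun p : Orth n × Mat (n - k) m => planeLIntegral F (rotateFrame n k p.1) p.2) =
      fun p => ∫⁻ ω : Mat k m, F ((p.1 : Mat n n) * stack ω p.2) := by
    ext1 p
    exact planeLIntegral_eq hk hkn F (orth_transpose_mul p.1) rfl p.2
  dsimp only
  rw [this]
  refine Measurable.lintegral_prod_right' (f := fun q : (Orth n × Mat (n - k) m) × Mat k m =>
    F ((q.1.1 : Mat n n) * stack q.2 q.1.2)) (hF.comp ?_)
  exact measurable_mul (measurable_subtype_coe.comp (measurable_fst.comp measurable_fst))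
    ((measurable_stack n k m hkn).comp
      (measurable_snd.prodMk (measurable_snd.comp measurable_fst)))

theorem measurable_radon {n k m : ℕ} (hk : 1 ≤ k) (hkn : k ≤ n) {f : Mat n m → ℂ}
    (hf : Measurable f) :
    Measurable fun p : Stiefel n (n - k) × Mat (n - k) m => radon f p.1 p.2 := by
  refine measurable_of_comp_rotateFrame ?_
  have : (fun p : Orth n × Mat (n - k) m => radon f (rotateFrame n k p.1) p.2) =
      fun p => ∫ ω : Mat k m, f ((p.1 : Mat n n) * stack ω p.2) := by
    ext1 p
    exact radon_eq hk hkn f (orth_transpose_mul p.1) rfl p.2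
  dsimp only
  rw [this]
  refine (StronglyMeasurable.integral_prod_right' (f := fun q : (Orth n × Mat (n - k) m) × Mat k m =>
    f ((q.1.1 : Mat n n) * stack q.2 q.1.2)) (hf.comp ?_).stronglyMeasurable).measurable
  exact measurable_mul (measurable_subtype_coe.comp (measurable_fst.comp measurable_fst))
    ((measurable_stack n k m hkn).comp
      (measurable_snd.prodMk (measurable_snd.comp measurable_fst)))

theorem enorm_radon_le {n k m : ℕ} (f : Mat n m → ℂ) (ξ : Stiefel n (n - k))
    (t : Mat (n - k) m) : ‖radon f ξ t‖ₑ ≤ planeLIntegral (fun x => ‖f x‖ₑ) ξ t :=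
  enorm_integral_le_lintegral_enorm _

/-- Tonelli in the coordinates $x=g[\omega;t]$, in which $\xi'x=t$. -/
theorem lintegral_mul_planeLIntegral {n k m : ℕ} (hk : 1 ≤ k) (hkn : k ≤ n) {F : Mat n m → ENNReal}
    (hF : Measurable F) (ξ : Stiefel n (n - k)) {v : Mat (n - k) m → ENNReal} (hv : Measurable v) :
    ∫⁻ t, v t * planeLIntegral F ξ t =
      ∫⁻ x : Mat n m, v ((ξ : Mat n (n - k)).transpose * x) * F x := by
  obtain ⟨g, hg, h⟩ := exists_orth_baseFrame ξ
  have hm : Measurable fun x : Mat n m => v ((ξ : Mat n (n - k)).transpose * x) * F x :=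
    (hv.comp (measurable_mul measurable_const measurable_id)).fun_mul hF
  have hmp := measurePreserving_orth_stack m hkn hg
  rw [← hmp.lintegral_comp hm, Measure.volume_eq_prod]
  refine Eq.trans ?_ (lintegral_prod_symm' _ (hm.comp hmp.measurable)).symm
  refine lintegral_congr fun t => ?_
  simp only [Function.comp_apply]
  rw [planeLIntegral_eq hk hkn F hg h]
  simp only [frame_transpose_mul_stack hkn hg h]
  refine (lintegral_const_mul _ (hF.comp (hmp.measurable.comp measurable_prodMk_right))).symm

theorem lintegral_planeLIntegral {n k m : ℕ} (hk : 1 ≤ k) (hkn : k ≤ n) {F : Mat n m → ENNReal}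
    (hF : Measurable F) (ξ : Stiefel n (n - k)) :
    ∫⁻ t, planeLIntegral F ξ t = ∫⁻ x : Mat n m, F x := by
  simpa using lintegral_mul_planeLIntegral hk hkn hF ξ (v := fun _ => 1) measurable_one

theorem integrable_radon {n k m : ℕ} (hk : 1 ≤ k) (hkn : k ≤ n) {f : Mat n m → ℂ}
    (hf : Measurable f) (hfi : Integrable f) (ξ : Stiefel n (n - k)) :
    Integrable fun t : Mat (n - k) m => radon f ξ t := by
  refine ⟨((measurable_radon hk hkn hf).comp measurable_prodMk_left).aestronglyMeasurable, ?_⟩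
  refine (lintegral_mono fun t => enorm_radon_le f ξ t).trans_lt ?_
  rw [lintegral_planeLIntegral hk hkn hf.enorm ξ]
  exact hfi.2

/-- Integration over matrix planes. -/
theorem integral_mul_radon {n k m : ℕ} (hk : 1 ≤ k) (hkn : k ≤ n) {f : Mat n m → ℂ}
    (ξ : Stiefel n (n - k)) {v : Mat (n - k) m → ℂ}
    (h : Integrable fun x : Mat n m => v ((ξ : Mat n (n - k)).transpose * x) * f x) :
    ∫ t, v t * radon f ξ t = ∫ x : Mat n m, v ((ξ : Mat n (n - k)).transpose * x) * f x := by
  obtain ⟨g, hg, hgξ⟩ := exists_orth_baseFrame ξ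
  have hmp := measurePreserving_orth_stack m hkn hg
  have hme := measurableEmbedding_orth_stack m hkn hg
  rw [← hmp.integral_comp hme, Measure.volume_eq_prod]
  refine Eq.trans ?_ (integral_prod_symm _ ((hmp.integrable_comp_emb hme).2 h)).symm
  refine integral_congr_ae (ae_of_all _ fun t => ?_)
  simp only [Function.comp_apply]
  rw [radon_eq hk hkn f hg hgξ]
  simp only [frame_transpose_mul_stack hkn hg hgξ]
  rw [integral_const_mul]

/-! ### Absolute convergence -/

/-- The weight `(1 + ‖x‖)^{-r}`. -/
noncomputable def decay {n m : ℕ} (r : ℝ) (x : Mat n m) : ℝ := (1 + ‖toE n m x‖) ^ (-r)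

theorem decay_pos {n m : ℕ} (r : ℝ) (x : Mat n m) : 0 < decay r x :=
  Real.rpow_pos_of_pos (by positivity) _

theorem measurable_decay (n m : ℕ) (r : ℝ) : Measurable (decay r : Mat n m → ℝ) := by
  have h : Measurable fun x : Mat n m => 1 + ‖toE n m x‖ :=
    Continuous.measurable (continuous_const.add (toE n m).continuous.norm)
  exact h.pow_const _

theorem integrable_decay {n m : ℕ} {r : ℝ} (hr : (n : ℝ) * m < r) :
    Integrable (decay r : Mat n m → ℝ) := by
  have h := integrable_one_add_norm (E := EMat n m) (μ := volume) (r := r) (by simpa using hr)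
  exact ((measurePreserving_toE n m).integrable_comp_emb (measurableEmbedding_toE n m)).2 h

theorem lintegral_decay_lt_top {n m : ℕ} {r : ℝ} (hr : (n : ℝ) * m < r) :
    ∫⁻ x : Mat n m, ENNReal.ofReal (decay r x) < ⊤ :=
  (integrable_decay hr).lintegral_lt_top

theorem decay_orth_stack_le {n k m : ℕ} (hkn : k ≤ n) {r : ℝ} (hr : 0 ≤ r) {g : Mat n n}
    (hg : g.transpose * g = 1) (ω : Mat k m) (t : Mat (n - k) m) :
    decay r (g * stack ω t) ≤ decay r ω := by
  refine Real.rpow_le_rpow_of_nonpos (by positivity) ?_ (by linarith)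
  have h := norm_toE_orth_stack hkn hg ω t
  have : ‖toE k m ω‖ ≤ ‖toE n m (g * stack ω t)‖ :=
    abs_le_of_sq_le_sq' (by nlinarith [sq_nonneg ‖toE (n - k) m t‖]) (norm_nonneg _) |>.2
  linarith

theorem planeLIntegral_decay_le {n k m : ℕ} (hk : 1 ≤ k) (hkn : k ≤ n) {r : ℝ} (hr : 0 ≤ r)
    (ξ : Stiefel n (n - k)) (t : Mat (n - k) m) :
    planeLIntegral (fun x => ENNReal.ofReal (decay r x)) ξ t ≤
      ∫⁻ ω : Mat k m, ENNReal.ofReal (decay r ω) := by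
  obtain ⟨g, hg, h⟩ := exists_orth_baseFrame ξ
  rw [planeLIntegral_eq hk hkn _ hg h]
  exact lintegral_mono fun ω => ENNReal.ofReal_le_ofReal (decay_orth_stack_le hkn hr hg ω t)

theorem measurable_scaled_comp {α : Type*} [MeasurableSpace α] {q m : ℕ} {w : Mat q m → ℂ}
    (hw : Measurable w) {A : α → Mat m m} (hA : Measurable A) {Z : α → Mat q m}
    (hZ : Measurable Z) : Measurable fun p => scaled w (A p) (Z p) := by
  have h0 : Measurable fun p => (rootMat (A p))⁻¹ :=
    (measurable_inv m).comp ((measurable_rootMat m).comp hA)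
  have h1 : Measurable fun p => Z p * (rootMat (A p))⁻¹ := measurable_mul hZ h0
  have h2 : Measurable fun p => (((A p).det ^ (-(q : ℝ) / 2) : ℝ) : ℂ) :=
    Complex.measurable_ofReal.comp (((measurable_det m).comp hA).pow_const _)
  have h3 : Measurable fun p => w (Z p * (rootMat (A p))⁻¹) := hw.comp h1
  unfold scaled
  exact h2.fun_mul h3

theorem det_rpow_mul_root_pow {q m : ℕ} {a : Mat m m} (ha : a.PosDef) :
    a.det ^ (-(q : ℝ) / 2) * |(rootMat a)⁻¹.det|⁻¹ ^ q = 1 := by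
  have hd := det_rootMat_pos ha
  rw [Matrix.det_nonsing_inv, Ring.inverse_eq_inv', abs_inv, inv_inv, abs_of_pos hd,
    det_rootMat ha, ← Real.rpow_natCast _ q, ← Real.rpow_mul ha.det_pos.le,
    ← Real.rpow_add ha.det_pos,
    show -(q : ℝ) / 2 + 1 / 2 * q = 0 by ring, Real.rpow_zero]

/-- The factor $|a|^{-q/2}$ is the $L^1$ normalization of the dilation, so the norm is independent
of $a$ and of the translation. -/
theorem lintegral_scaled {q m : ℕ} {w : Mat q m → ℂ} (hw : Measurable w) {a : Mat m m}
    (ha : a.PosDef) (t : Mat q m) :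
    ∫⁻ s : Mat q m, ‖scaled w a (s - t)‖ₑ = ∫⁻ z : Mat q m, ‖w z‖ₑ := by
  rw [lintegral_sub_right_eq_self (fun s : Mat q m => ‖scaled w a s‖ₑ) t]
  have hd := det_inv_ne_zero (det_rootMat_ne_zero ha)
  have hc : 0 ≤ a.det ^ (-(q : ℝ) / 2) := Real.rpow_nonneg ha.det_pos.le _
  have h1 : ∀ s : Mat q m, ‖scaled w a s‖ₑ =
      ENNReal.ofReal (a.det ^ (-(q : ℝ) / 2)) * ‖w (s * (rootMat a)⁻¹)‖ₑ := by
    intro s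
    rw [scaled, enorm_mul, ← ofReal_norm, Complex.norm_real, Real.norm_of_nonneg hc]
  simp only [h1]
  have hm : Measurable fun s : Mat q m => ‖w (s * (rootMat a)⁻¹)‖ₑ :=
    (hw.comp (measurable_mul measurable_id measurable_const)).enorm
  rw [lintegral_const_mul _ hm, lintegral_mul_right _ hd fun z : Mat q m => ‖w z‖ₑ, ← mul_assoc,
    ← ENNReal.ofReal_mul hc, det_rpow_mul_root_pow ha, ENNReal.ofReal_one, one_mul]

/-! ### The inversion kernel and its integrability over all parameters -/

/-- The integrand of the inversion formula. -/
noncomputable def inversionKernel {n k m : ℕ} (f : Mat n m → ℂ) (w : Mat (n - k) m → ℂ)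
    (x : Mat n m) (q : Mat m m × (Stiefel n (n - k) × Mat (n - k) m)) : ℂ :=
  radon f q.2.1 q.2.2 * scaled w q.1 ((q.2.1 : Mat n (n - k)).transpose * x - q.2.2) *
    ((q.1.det ^ (-(k : ℝ) / 2) : ℝ) : ℂ)

/-- The measure on the parameters `(a, ξ, t)`. -/
noncomputable def paramMeasure (n k m : ℕ) (ε ρ : ℝ) :
    Measure (Mat m m × (Stiefel n (n - k) × Mat (n - k) m)) :=
  ((coneMeasure m).restrict (coneInterval m ε ρ)).prod ((stiefelMeasure n k).prod volume)

instance (n k m : ℕ) (ε ρ : ℝ) : SFinite (paramMeasure n k m ε ρ) := by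
  unfold paramMeasure; infer_instance

theorem ae_paramMeasure_posDef (n k m : ℕ) {ε : ℝ} (hε : 0 < ε) (ρ : ℝ) :
    ∀ᵐ q ∂paramMeasure n k m ε ρ, q.1.PosDef := by
  have h : ∀ᵐ a ∂(coneMeasure m).restrict (coneInterval m ε ρ), a.PosDef :=
    (ae_restrict_mem (measurableSet_coneInterval m ε ρ)).mono
      fun a ha => posDef_of_mem_coneInterval hε ha
  exact Measure.quasiMeasurePreserving_fst.ae h

theorem measurable_sub_mat {α : Type*} [MeasurableSpace α] {q m : ℕ} {x t : α → Mat q m}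
    (hx : Measurable x) (ht : Measurable t) : Measurable fun p => x p - t p := by
  refine measurable_of_entries fun i j => ?_
  have h1 : Measurable fun p => x p i j := (measurable_entry i j).comp hx
  have h2 : Measurable fun p => t p i j := (measurable_entry i j).comp ht
  exact h1.fun_sub h2

theorem measurable_scaled_frame_sub {α : Type*} [MeasurableSpace α] {n q m : ℕ}
    {w : Mat q m → ℂ} (hw : Measurable w) {A : α → Mat m m} (hA : Measurable A) {ξ : α → Mat n q}
    (hξ : Measurable ξ) {x : α → Mat n m} (hx : Measurable x) {t : α → Mat q m}
    (ht : Measurable t) :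
    Measurable fun p => scaled w (A p) ((ξ p).transpose * x p - t p) := by
  have hT : Measurable fun p => (ξ p).transpose :=
    measurable_of_entries fun i j => (measurable_entry j i).comp hξ
  have h1 : Measurable fun p => (ξ p).transpose * x p := measurable_mul hT hx
  have h2 : Measurable fun p => (ξ p).transpose * x p - t p := measurable_sub_mat h1 ht
  exact measurable_scaled_comp hw hA h2

theorem measurable_scaled_sub {n k m : ℕ} {w : Mat (n - k) m → ℂ} (hw : Measurable w) :
    Measurable fun p : Mat n m × (Mat m m × (Stiefel n (n - k) × Mat (n - k) m)) =>
      scaled w p.2.1 ((p.2.2.1 : Mat n (n - k)).transpose * p.1 - p.2.2.2) :=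
  measurable_scaled_frame_sub hw measurable_snd.fst measurable_snd.snd.fst.subtype_val
    measurable_fst measurable_snd.snd.snd

theorem measurable_inversionKernel {n k m : ℕ} (hk : 1 ≤ k) (hkn : k ≤ n) {f : Mat n m → ℂ}
    (hf : Measurable f) {w : Mat (n - k) m → ℂ} (hw : Measurable w) :
    Measurable fun p : Mat n m × (Mat m m × (Stiefel n (n - k) × Mat (n - k) m)) =>
      inversionKernel f w p.1 p.2 := by
  have h1 : Measurable fun p : Mat n m × (Mat m m × (Stiefel n (n - k) × Mat (n - k) m)) =>
      radon f p.2.2.1 p.2.2.2 :=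
    (measurable_radon hk hkn hf).comp (measurable_snd.comp measurable_snd)
  have h3 : Measurable fun p : Mat n m × (Mat m m × (Stiefel n (n - k) × Mat (n - k) m)) =>
      ((p.2.1.det ^ (-(k : ℝ) / 2) : ℝ) : ℂ) :=
    Complex.measurable_ofReal.comp
      (((measurable_det m).comp (measurable_fst.comp measurable_snd)).pow_const _)
  exact (h1.mul (measurable_scaled_sub hw)).mul h3

theorem lintegral_det_rpow_coneInterval (m : ℕ) (α : ℝ) {ε : ℝ} (hε : 0 < ε) (ρ : ℝ) :
    ∫⁻ a in coneInterval m ε ρ, ENNReal.ofReal (a.det ^ α) ∂coneMeasure m < ⊤ := by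
  have hc : ContinuousOn (fun s : Mat m m => s.det ^ α) (coneBox m ε ρ) := by
    refine ContinuousOn.rpow_const (continuous_id.matrix_det).continuousOn fun s hs => Or.inl ?_
    exact (posDef_of_mem_coneBox hε hs).det_pos.ne'
  obtain ⟨C, hC⟩ := (isCompact_coneBox m hε ρ).exists_bound_of_continuousOn hc
  calc ∫⁻ a in coneInterval m ε ρ, ENNReal.ofReal (a.det ^ α) ∂coneMeasure m
      ≤ ∫⁻ a in coneInterval m ε ρ, ENNReal.ofReal C ∂coneMeasure m := by
        refine setLIntegral_mono measurable_const fun a ha => ENNReal.ofReal_le_ofReal ?_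
        exact (le_abs_self _).trans (hC a (coneInterval_subset_coneBox m ε ρ ha))
    _ < ⊤ := by
        rw [setLIntegral_const]
        exact ENNReal.mul_lt_top ENNReal.ofReal_lt_top (coneMeasure_coneInterval_lt_top m hε ρ)

/-- Integrating along the planes $\xi'x=s$ first, the weight contributes a constant independent of
the plane, and the $L^1$ norm of $w_a$ remains. The bound is uniform in $a$, $\xi$ and $t$. -/
theorem lintegral_scaled_mul_decay_le {n k m : ℕ} (hk : 1 ≤ k) (hkn : k ≤ n)
    {w : Mat (n - k) m → ℂ} (hw : Measurable w) {r : ℝ} (hr : 0 ≤ r) {a : Mat m m} (ha : a.PosDef)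
    (ξ : Stiefel n (n - k)) (t : Mat (n - k) m) :
    ∫⁻ x : Mat n m, ‖scaled w a ((ξ : Mat n (n - k)).transpose * x - t)‖ₑ *
        ENNReal.ofReal (decay r x) ≤
      (∫⁻ ω : Mat k m, ENNReal.ofReal (decay r ω)) * ∫⁻ z : Mat (n - k) m, ‖w z‖ₑ := by
  have hdm : Measurable fun x : Mat n m => ENNReal.ofReal (decay r x) :=
    (measurable_decay n m r).ennreal_ofReal
  have hsm : Measurable fun s : Mat (n - k) m => ‖scaled w a (s - t)‖ₑ :=
    (measurable_scaled_comp hw measurable_const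
      (measurable_sub_mat measurable_id measurable_const)).enorm
  rw [← lintegral_mul_planeLIntegral hk hkn hdm ξ hsm]
  calc ∫⁻ s : Mat (n - k) m, ‖scaled w a (s - t)‖ₑ *
        planeLIntegral (fun x => ENNReal.ofReal (decay r x)) ξ s
      ≤ ∫⁻ s : Mat (n - k) m, ‖scaled w a (s - t)‖ₑ *
          ∫⁻ ω : Mat k m, ENNReal.ofReal (decay r ω) :=
        lintegral_mono fun s => mul_le_mul' le_rfl (planeLIntegral_decay_le hk hkn hr ξ s)
    _ = _ := by rw [lintegral_mul_const _ hsm, lintegral_scaled hw ha, mul_comm]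

/-- With the $x$-integral performed first against a decaying weight, the bound factors into
$\|w\|_1$, $\|f\|_1$ and the integral of $|a|^{-k/2}$ over a bounded cone interval. This is the
source of almost everywhere convergence and of every later use of Fubini with test functions. -/
theorem lintegral_decay_inversionKernel {n k m : ℕ} (hk : 1 ≤ k) (hkn : k ≤ n) {f : Mat n m → ℂ}
    (hf : Measurable f) (hfi : Integrable f) {w : Mat (n - k) m → ℂ} (hw : Measurable w)
    (hwi : Integrable w) {r : ℝ} (hr : (n : ℝ) * m < r) {ε : ℝ} (hε : 0 < ε) (ρ : ℝ) :
    ∫⁻ x, ∫⁻ q, ENNReal.ofReal (decay r x) * ‖inversionKernel f w x q‖ₑ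
      ∂paramMeasure n k m ε ρ < ⊤ := by
  have hr0 : 0 ≤ r := le_trans (by positivity) hr.le
  have hkr : (k : ℝ) * m < r := by
    refine lt_of_le_of_lt ?_ hr
    gcongr
  set C : ENNReal := ∫⁻ ω : Mat k m, ENNReal.ofReal (decay r ω) with hC
  have hCt : C < ⊤ := lintegral_decay_lt_top hkr
  set W : ENNReal := ∫⁻ z : Mat (n - k) m, ‖w z‖ₑ with hW
  have hWt : W < ⊤ := hwi.2
  have hdm : Measurable fun x : Mat n m => ENNReal.ofReal (decay r x) :=
    (measurable_decay n m r).ennreal_ofReal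
  have hmeas : Measurable fun p : Mat n m × (Mat m m × (Stiefel n (n - k) × Mat (n - k) m)) =>
      ENNReal.ofReal (decay r p.1) * ‖inversionKernel f w p.1 p.2‖ₑ :=
    (hdm.comp measurable_fst).fun_mul (measurable_inversionKernel hk hkn hf hw).enorm
  have hrad : Measurable fun p : Stiefel n (n - k) × Mat (n - k) m => ‖radon f p.1 p.2‖ₑ :=
    (measurable_radon hk hkn hf).enorm
  rw [lintegral_lintegral_swap hmeas.aemeasurable]
  have hbound : ∀ᵐ q ∂paramMeasure n k m ε ρ,
      ∫⁻ x : Mat n m, ENNReal.ofReal (decay r x) * ‖inversionKernel f w x q‖ₑ ≤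
        (C * W) * (ENNReal.ofReal (q.1.det ^ (-(k : ℝ) / 2)) * ‖radon f q.2.1 q.2.2‖ₑ) := by
    filter_upwards [ae_paramMeasure_posDef n k m hε ρ] with q hq
    obtain ⟨a, ξ, t⟩ := q
    have ha : a.PosDef := hq
    have h1 : ∀ x : Mat n m, ENNReal.ofReal (decay r x) * ‖inversionKernel f w x (a, ξ, t)‖ₑ =
        (ENNReal.ofReal (a.det ^ (-(k : ℝ) / 2)) * ‖radon f ξ t‖ₑ) *
          (‖scaled w a ((ξ : Mat n (n - k)).transpose * x - t)‖ₑ *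
            ENNReal.ofReal (decay r x)) := by
      intro x
      rw [inversionKernel, enorm_mul, enorm_mul, ← ofReal_norm (((_ : ℝ) : ℂ)),
        Complex.norm_real, Real.norm_of_nonneg (Real.rpow_nonneg ha.det_pos.le _)]
      ring
    have hmx : Measurable fun x : Mat n m =>
        ‖scaled w a ((ξ : Mat n (n - k)).transpose * x - t)‖ₑ * ENNReal.ofReal (decay r x) :=
      (measurable_scaled_frame_sub hw measurable_const measurable_const measurable_id
        measurable_const).enorm.fun_mul hdm
    simp only [h1]
    rw [lintegral_const_mul _ hmx, mul_comm]
    exact mul_le_mul' (lintegral_scaled_mul_decay_le hk hkn hw hr0 ha ξ t) le_rfl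
  refine (lintegral_mono_ae hbound).trans_lt ?_
  have hdet : Measurable fun a : Mat m m => ENNReal.ofReal (a.det ^ (-(k : ℝ) / 2)) :=
    measurable_ofReal_det_rpow _
  have hmq : Measurable fun q : Mat m m × (Stiefel n (n - k) × Mat (n - k) m) =>
      ENNReal.ofReal (q.1.det ^ (-(k : ℝ) / 2)) * ‖radon f q.2.1 q.2.2‖ₑ :=
    (hdet.comp measurable_fst).fun_mul (hrad.comp measurable_snd)
  rw [lintegral_const_mul _ hmq, paramMeasure]
  refine ENNReal.mul_lt_top (ENNReal.mul_lt_top hCt hWt) ?_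
  rw [lintegral_prod_mul (f := fun a : Mat m m => ENNReal.ofReal (a.det ^ (-(k : ℝ) / 2)))
    (g := fun p : Stiefel n (n - k) × Mat (n - k) m => ‖radon f p.1 p.2‖ₑ)
    hdet.aemeasurable hrad.aemeasurable]
  refine ENNReal.mul_lt_top (lintegral_det_rpow_coneInterval m _ hε ρ) ?_
  rw [lintegral_prod _ hrad.aemeasurable]
  calc ∫⁻ ξ, (∫⁻ t : Mat (n - k) m, ‖radon f ξ t‖ₑ) ∂stiefelMeasure n k
      ≤ ∫⁻ _, (∫⁻ x : Mat n m, ‖f x‖ₑ) ∂stiefelMeasure n k := by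
        refine lintegral_mono fun ξ => ?_
        rw [← lintegral_planeLIntegral hk hkn hf.enorm ξ]
        exact lintegral_mono fun t => enorm_radon_le f ξ t
    _ < ⊤ := by
        rw [lintegral_const, measure_univ, mul_one]
        exact hfi.2

theorem integrable_mul_inversionKernel {n k m : ℕ} (hk : 1 ≤ k) (hkn : k ≤ n) {f : Mat n m → ℂ}
    (hf : Measurable f) (hfi : Integrable f) {w : Mat (n - k) m → ℂ} (hw : Measurable w)
    (hwi : Integrable w) {r : ℝ} (hr : (n : ℝ) * m < r) {ε : ℝ} (hε : 0 < ε) (ρ : ℝ)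
    {ψ : Mat n m → ℂ} (hψ : Measurable ψ) {B : ℝ} (hB : ∀ x, ‖ψ x‖ ≤ B * decay r x) :
    Integrable (fun p : Mat n m × (Mat m m × (Stiefel n (n - k) × Mat (n - k) m)) =>
      ψ p.1 * inversionKernel f w p.1 p.2) (volume.prod (paramMeasure n k m ε ρ)) := by
  have hKm := measurable_inversionKernel hk hkn hf hw
  have hdm : Measurable fun x : Mat n m => ENNReal.ofReal (decay r x) :=
    (measurable_decay n m r).ennreal_ofReal
  have hmeas : Measurable fun p : Mat n m × (Mat m m × (Stiefel n (n - k) × Mat (n - k) m)) =>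
      ENNReal.ofReal (decay r p.1) * ‖inversionKernel f w p.1 p.2‖ₑ :=
    (hdm.comp measurable_fst).fun_mul hKm.enorm
  refine ⟨((hψ.comp measurable_fst).mul hKm).aestronglyMeasurable, ?_⟩
  have h1 : ∀ p : Mat n m × (Mat m m × (Stiefel n (n - k) × Mat (n - k) m)),
      ‖ψ p.1 * inversionKernel f w p.1 p.2‖ₑ ≤
      ENNReal.ofReal B * (ENNReal.ofReal (decay r p.1) * ‖inversionKernel f w p.1 p.2‖ₑ) := by
    intro p
    rw [enorm_mul, ← mul_assoc]
    refine mul_le_mul' ?_ le_rfl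
    rw [← ENNReal.ofReal_mul' (decay_pos r _).le, ← ofReal_norm]
    exact ENNReal.ofReal_le_ofReal (hB _)
  refine (lintegral_mono h1).trans_lt ?_
  rw [lintegral_const_mul _ hmeas, lintegral_prod _ hmeas.aemeasurable]
  exact ENNReal.mul_lt_top ENNReal.ofReal_lt_top
    (lintegral_decay_inversionKernel hk hkn hf hfi hw hwi hr hε ρ)

theorem ae_integrable_inversionKernel {n k m : ℕ} (hk : 1 ≤ k) (hkn : k ≤ n) {f : Mat n m → ℂ}
    (hf : Measurable f) (hfi : Integrable f) {w : Mat (n - k) m → ℂ} (hw : Measurable w)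
    (hwi : Integrable w) {ε : ℝ} (hε : 0 < ε) (ρ : ℝ) :
    ∀ᵐ x : Mat n m, Integrable (inversionKernel f w x) (paramMeasure n k m ε ρ) := by
  set r : ℝ := (n : ℝ) * m + 1 with hrdef
  have hψ : Measurable fun x : Mat n m => ((decay r x : ℝ) : ℂ) :=
    Complex.measurable_ofReal.comp (measurable_decay n m r)
  have h := integrable_mul_inversionKernel hk hkn hf hfi hw hwi (r := r) (by simp [hrdef]) hε ρ
    (ψ := fun x => ((decay r x : ℝ) : ℂ)) hψ (B := 1) (fun x => by
      rw [one_mul, Complex.norm_real, Real.norm_of_nonneg (decay_pos r x).le])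
  filter_upwards [h.prod_right_ae] with x hx
  have h0 : ((decay r x : ℝ) : ℂ) ≠ 0 := by exact_mod_cast (decay_pos r x).ne'
  refine (hx.const_mul ((decay r x : ℝ) : ℂ)⁻¹).congr (ae_of_all _ fun q => ?_)
  dsimp only
  rw [← mul_assoc, inv_mul_cancel₀ h0, one_mul]

/-- The truncated inversion as one integral over all parameters. -/
theorem truncatedInversion_eq {n k m : ℕ} {f : Mat n m → ℂ} {w : Mat (n - k) m → ℂ} {ε ρ : ℝ}
    {x : Mat n m} (h : Integrable (inversionKernel f w x) (paramMeasure n k m ε ρ)) :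
    truncatedInversion k w f ε ρ x =
      ∫ q, inversionKernel f w x q ∂paramMeasure n k m ε ρ := by
  rw [truncatedInversion, paramMeasure, integral_prod _ h]
  refine integral_congr_ae ?_
  filter_upwards [h.prod_right_ae] with a ha
  rw [integral_prod _ ha, dualRidgelet, ← integral_mul_const]
  refine integral_congr_ae (ae_of_all _ fun ξ => ?_)
  dsimp only
  rw [← integral_mul_const]
  rfl

theorem ae_truncatedInversion_eq {n k m : ℕ} (hk : 1 ≤ k) (hkn : k ≤ n) {f : Mat n m → ℂ}
    (hf : Measurable f) (hfi : Integrable f) {w : Mat (n - k) m → ℂ} (hw : Measurable w)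
    (hwi : Integrable w) {ε : ℝ} (hε : 0 < ε) (ρ : ℝ) :
    ∀ᵐ x : Mat n m, truncatedInversion k w f ε ρ x =
      ∫ q, inversionKernel f w x q ∂paramMeasure n k m ε ρ :=
  (ae_integrable_inversionKernel hk hkn hf hfi hw hwi hε ρ).mono
    fun _ hx => truncatedInversion_eq hx

/-! ### Fourier multipliers on square integrable functions -/

section Multiplier

open scoped FourierTransform SchwartzMap ContDiff

variable {E : Type*} [NormedAddCommGroup E] [InnerProductSpace ℝ E] [FiniteDimensional ℝ E]
  [MeasurableSpace E] [BorelSpace E]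

theorem integral_fourier_mul_schwartz {f : E → ℂ} (hf : Integrable f) (g : 𝓢(E, ℂ)) :
    ∫ v, g v * 𝓕 f v = ∫ x, 𝓕 (g : E → ℂ) x * f x := by
  have h := VectorFourier.integral_fourierIntegral_smul_eq_flip (L := innerₗ E)
    (μ := (volume : Measure E)) (ν := (volume : Measure E))
    Real.continuous_fourierChar continuous_inner (g.integrable (μ := volume)) hf
  simp only [smul_eq_mul, flip_innerₗ] at h
  exact h.symm

/-- The $L^2$ transform and the Fourier integral satisfy the same multiplication formula against
smooth compactly supported functions, which separate locally integrable functions. -/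
theorem fourier_toLp_ae_eq {f : E → ℂ} (hf1 : Integrable f) (hf2 : MemLp f 2) :
    (𝓕 (hf2.toLp f) : Lp ℂ 2 (volume : Measure E)) =ᵐ[volume] 𝓕 f := by
  have hc : Continuous (𝓕 f) :=
    VectorFourier.fourierIntegral_continuous Real.continuous_fourierChar continuous_inner hf1
  refine ae_eq_of_integral_contDiff_smul_eq
    ((Lp.memLp (𝓕 (hf2.toLp f))).locallyIntegrable (by norm_num))
    hc.locallyIntegrable fun g hg hgc => ?_
  have hg1 : HasCompactSupport (Complex.ofRealCLM ∘ g) := hgc.comp_left rfl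
  have hg2 : ContDiff ℝ ∞ (Complex.ofRealCLM ∘ g) := by fun_prop
  set ψ : 𝓢(E, ℂ) := hg1.toSchwartzMap hg2 with hψ
  have h1 : ∫ x, ψ x • (𝓕 (hf2.toLp f) : Lp ℂ 2 (volume : Measure E)) x =
      ∫ x, (𝓕 ψ) x • (hf2.toLp f) x := by
    have := congrArg (fun T : 𝓢'(E, ℂ) => T ψ) (Lp.fourier_toTemperedDistribution_eq (hf2.toLp f))
    simpa [TemperedDistribution.fourier_apply, Lp.toTemperedDistribution_apply] using this.symm
  have h2 : ∫ x, (𝓕 ψ) x • (hf2.toLp f) x = ∫ x, 𝓕 (ψ : E → ℂ) x * f x := by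
    refine integral_congr_ae ?_
    filter_upwards [hf2.coeFn_toLp] with x hx
    rw [hx, smul_eq_mul, SchwartzMap.fourier_coe]
  rw [h2, ← integral_fourier_mul_schwartz hf1] at h1
  simpa [hψ] using h1

theorem memLp_fourier {f : E → ℂ} (hf1 : Integrable f) (hf2 : MemLp f 2) :
    MemLp (𝓕 f) 2 :=
  (memLp_congr_ae (fourier_toLp_ae_eq hf1 hf2)).1 (Lp.memLp _)

/-- Bounded functions act on square integrable functions as Fourier multipliers. -/
theorem exists_fourierMultiplier {f : E → ℂ} (hf1 : Integrable f) (hf2 : MemLp f 2) {κ : E → ℂ}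
    (hκ : AEStronglyMeasurable κ) {C : ℝ} (hC : ∀ᵐ v, ‖κ v‖ ≤ C) :
    ∃ h : E → ℂ, MemLp h 2 ∧
      (∀ ψ : 𝓢(E, ℂ), ∫ x, ψ x * h x = ∫ v, 𝓕⁻ (ψ : E → ℂ) v * (κ v * 𝓕 f v)) ∧
      ∀ c : ℂ, eLpNorm (fun x => h x - c * f x) 2 =
        eLpNorm (fun v => (κ v - c) * 𝓕 f v) 2 := by
  have hF := memLp_fourier hf1 hf2
  have hb : MemLp (fun v => κ v * 𝓕 f v) 2 :=
    hF.of_le_mul (hκ.mul hF.1) (hC.mono fun v hv => by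
      rw [norm_mul]; exact mul_le_mul_of_nonneg_right hv (norm_nonneg _))
  set b : Lp ℂ 2 (volume : Measure E) := hb.toLp _ with hbdef
  -- The function sought is the inverse transform of $\kappa\,\mathcal Ff$: duality gives the tested
  -- identity and Plancherel the norm identity.
  set h : Lp ℂ 2 (volume : Measure E) := 𝓕⁻ b with hh
  refine ⟨h, Lp.memLp h, fun ψ => ?_, fun c => ?_⟩
  · have := congrArg (fun T : 𝓢'(E, ℂ) => T ψ) (Lp.fourierInv_toTemperedDistribution_eq b)
    simp only [TemperedDistribution.fourierInv_apply, Lp.toTemperedDistribution_apply,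
      smul_eq_mul] at this
    rw [← hh] at this
    rw [← this]
    refine integral_congr_ae ?_
    filter_upwards [hb.coeFn_toLp] with x hx
    rw [hx, SchwartzMap.fourierInv_coe]
  · have h1 : 𝓕 (h - c • hf2.toLp f) = b - c • 𝓕 (hf2.toLp f) := by
      rw [hh, sub_eq_add_neg, FourierTransform.fourier_add, FourierTransform.fourier_neg,
        FourierTransform.fourier_smul, ← sub_eq_add_neg,
        FourierTransform.fourier_fourierInv_eq]
    have h2 := Lp.norm_fourier_eq (h - c • hf2.toLp f)
    rw [h1, Lp.norm_def, Lp.norm_def, ENNReal.toReal_eq_toReal_iff' (Lp.eLpNorm_ne_top _)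
      (Lp.eLpNorm_ne_top _)] at h2
    have h3 : eLpNorm (h - c • hf2.toLp f : Lp ℂ 2 (volume : Measure E)) 2 volume =
        eLpNorm (fun x => h x - c * f x) 2 := by
      refine eLpNorm_congr_ae ?_
      filter_upwards [Lp.coeFn_sub h (c • hf2.toLp f), Lp.coeFn_smul c (hf2.toLp f),
        hf2.coeFn_toLp] with x h1 h2 h3
      rw [h1, Pi.sub_apply, h2, Pi.smul_apply, h3, smul_eq_mul]
    have h4 : eLpNorm (b - c • 𝓕 (hf2.toLp f) : Lp ℂ 2 (volume : Measure E)) 2 volume =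
        eLpNorm (fun v => (κ v - c) * 𝓕 f v) 2 := by
      refine eLpNorm_congr_ae ?_
      filter_upwards [Lp.coeFn_sub b (c • 𝓕 (hf2.toLp f)), Lp.coeFn_smul c (𝓕 (hf2.toLp f)),
        hb.coeFn_toLp, fourier_toLp_ae_eq hf1 hf2] with x h1 h2 h3 h4
      rw [h1, Pi.sub_apply, h2, Pi.smul_apply, h3, h4, smul_eq_mul, sub_mul]
    rw [← h3, ← h4, h2]

end Multiplier

/-! ### The Fourier transform of matrix functions -/

section MatrixFourier

open scoped FourierTransform SchwartzMap

theorem integral_comp_toE {n m : ℕ} (F : EMat n m → ℂ) :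
    ∫ x : Mat n m, F (toE n m x) = ∫ v, F v :=
  (measurePreserving_toE n m).integral_comp (measurableEmbedding_toE n m) F

theorem integrable_comp_toE_symm {n m : ℕ} {f : Mat n m → ℂ} :
    Integrable (fun v => f ((toE n m).symm v)) ↔ Integrable f := by
  rw [← (measurePreserving_toE n m).integrable_comp_emb (measurableEmbedding_toE n m)]
  simp [Function.comp_def]

theorem trace_transpose_mul_comm {n m : ℕ} (x y : Mat n m) :
    (x.transpose * y).trace = (y.transpose * x).trace := by
  rw [← inner_toE, real_inner_comm, inner_toE]

/-- Change of convention: $e^{i\langle y,x\rangle}=e^{-2\pi i\langle x,v\rangle}$ for $v=-y/(2\pi)$.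
-/
theorem fourierMat_eq {n m : ℕ} (f : Mat n m → ℂ) (y : Mat n m) :
    fourierMat f y =
      𝓕 (fun v => f ((toE n m).symm v)) (-((2 * Real.pi)⁻¹ • toE n m y)) := by
  rw [Real.fourier_eq', ← integral_comp_toE, fourierMat]
  refine integral_congr_ae (ae_of_all _ fun x => ?_)
  simp only [ContinuousLinearEquiv.symm_apply_apply, smul_eq_mul]
  congr 2
  rw [inner_neg_right, real_inner_smul_right, inner_toE, trace_transpose_mul_comm x y]
  push_cast
  field_simp

theorem continuous_fourierMat {n m : ℕ} {f : Mat n m → ℂ} (hf : Integrable f) :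
    Continuous (fourierMat f) := by
  have hc : Continuous (𝓕 (fun v => f ((toE n m).symm v))) :=
    VectorFourier.fourierIntegral_continuous Real.continuous_fourierChar continuous_inner
      (integrable_comp_toE_symm.2 hf)
  have : fourierMat f = fun y =>
      𝓕 (fun v => f ((toE n m).symm v)) (-((2 * Real.pi)⁻¹ • toE n m y)) :=
    funext (fourierMat_eq f)
  rw [this]
  have h2 : Continuous fun y => -((2 * Real.pi)⁻¹ • toE n m y) :=
    ((toE n m).continuous.fun_const_smul _).fun_neg
  exact hc.comp h2

theorem norm_fourierMat_le {n m : ℕ} (f : Mat n m → ℂ) (y : Mat n m) :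
    ‖fourierMat f y‖ ≤ ∫ x : Mat n m, ‖f x‖ := by
  refine (norm_integral_le_integral_norm _).trans (le_of_eq ?_)
  refine integral_congr_ae (ae_of_all _ fun x => ?_)
  dsimp only
  rw [norm_mul, mul_comm Complex.I, Complex.norm_exp_ofReal_mul_I, one_mul]

theorem continuous_trace_mul (n m : ℕ) :
    Continuous fun p : Mat n m × Mat n m => (p.1.transpose * p.2).trace :=
  (continuous_fst.matrix_transpose.matrix_mul continuous_snd).matrix_trace

theorem integral_fourierMat_mul {n m : ℕ} {f g : Mat n m → ℂ} (hf : Integrable f)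
    (hg : Integrable g) :
    ∫ y, fourierMat f y * g y = ∫ x, f x * fourierMat g x := by
  have hInt : Integrable (fun p : Mat n m × Mat n m =>
      Complex.exp (Complex.I * (((p.1.transpose * p.2).trace : ℝ) : ℂ)) * (g p.1 * f p.2))
      (volume.prod volume) := by
    refine (hg.mul_prod hf).bdd_mul (c := 1) ?_ (ae_of_all _ fun p => ?_)
    · exact (Complex.continuous_exp.comp (continuous_const.mul
        (Complex.continuous_ofReal.comp (continuous_trace_mul n m)))).aestronglyMeasurable
    · rw [mul_comm Complex.I, Complex.norm_exp_ofReal_mul_I]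
  have h1 : ∀ y : Mat n m, fourierMat f y * g y = ∫ x : Mat n m,
      Complex.exp (Complex.I * (((y.transpose * x).trace : ℝ) : ℂ)) * (g y * f x) := by
    intro y
    rw [fourierMat, ← integral_mul_const]
    congr 1; ext x; ring
  have h2 : ∀ x : Mat n m, f x * fourierMat g x = ∫ y : Mat n m,
      Complex.exp (Complex.I * (((y.transpose * x).trace : ℝ) : ℂ)) * (g y * f x) := by
    intro x
    rw [fourierMat, ← integral_const_mul]
    congr 1; ext y
    rw [trace_transpose_mul_comm x y]
    ring
  simp only [h1, h2]
  exact integral_integral_swap hInt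

theorem integral_comp_smul_toE_symm {n m : ℕ} (F : Mat n m → ℂ) {R : ℝ} (hR : 0 < R) :
    ∫ v, F (R • (toE n m).symm v) = ((R ^ (n * m))⁻¹ : ℝ) • ∫ x, F x := by
  have h := Measure.integral_comp_smul (μ := (volume : Measure (EMat n m)))
    (fun v => F ((toE n m).symm v)) R
  simp only [map_smul, finrank_euclideanSpace, Fintype.card_prod, Fintype.card_fin] at h
  rw [h, ← integral_comp_toE, abs_of_pos (by positivity)]
  simp

/-- The Fourier inversion formula. -/
theorem fourierMat_inversion {n m : ℕ} {u : Mat n m → ℂ} (hc : Continuous u) (hu : Integrable u)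
    (hF : Integrable (fourierMat u)) (s : Mat n m) :
    u s = (((2 * Real.pi) ^ (n * m))⁻¹ : ℝ) * fourierMat (fun y => fourierMat u (-y)) s := by
  have hpi : (0 : ℝ) < 2 * Real.pi := by positivity
  set uE : EMat n m → ℂ := fun v => u ((toE n m).symm v) with huE
  have hFE : 𝓕 uE = fun v => fourierMat u (-((2 * Real.pi) • (toE n m).symm v)) := by
    ext v
    rw [fourierMat_eq]
    rw [map_neg, map_smul, ContinuousLinearEquiv.apply_symm_apply, smul_neg, neg_neg, smul_smul,
      inv_mul_cancel₀ hpi.ne', one_smul]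
  have hFi : Integrable (𝓕 uE) := by
    rw [hFE]
    have h1 : Integrable fun v => fourierMat u ((toE n m).symm v) :=
      integrable_comp_toE_symm.2 hF
    have h2 := (h1.comp_smul (R := -(2 * Real.pi)) (by linarith : -(2 * Real.pi) ≠ 0))
    refine h2.congr (ae_of_all _ fun v => ?_)
    simp
  have h := congrFun (Continuous.fourierInv_fourier_eq (hc.comp (toE n m).symm.continuous)
    (integrable_comp_toE_symm.2 hu) hFi) (toE n m s)
  rw [Real.fourierInv_eq'] at h
  simp only [Function.comp_apply, ContinuousLinearEquiv.symm_apply_apply] at h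
  rw [← h, fourierMat, ← Complex.real_smul, ← integral_comp_smul_toE_symm _ hpi]
  refine integral_congr_ae (ae_of_all _ fun v => ?_)
  change _ • 𝓕 uE v = _
  rw [hFE, smul_eq_mul]
  dsimp only
  congr 2
  rw [← ContinuousLinearEquiv.apply_symm_apply (toE n m) v, inner_toE,
    ContinuousLinearEquiv.symm_apply_apply,
    Matrix.mul_smul, Matrix.trace_smul, trace_transpose_mul_comm s,
    smul_eq_mul]
  push_cast
  ring

theorem fourierMat_scaled {q m : ℕ} (w : Mat q m → ℂ) {a : Mat m m} (ha : a.PosDef)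
    (η : Mat q m) : fourierMat (scaled w a) η = fourierMat w (η * rootMat a) := by
  have hd := det_rootMat_ne_zero ha
  have hu : IsUnit (rootMat a).det := isUnit_iff_ne_zero.2 hd
  have h := integral_mul_right (n := q) (rootMat a)⁻¹ (det_inv_ne_zero hd) fun z : Mat q m =>
    Complex.exp (Complex.I * ((((η * rootMat a).transpose * z).trace : ℝ) : ℂ)) * w z
  have h1 : ∀ x : Mat q m, ((η * rootMat a).transpose * (x * (rootMat a)⁻¹)).trace =
      (η.transpose * x).trace := by
    intro x
    rw [Matrix.transpose_mul, transpose_rootMat, Matrix.mul_assoc, Matrix.trace_mul_comm,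
      Matrix.mul_assoc, Matrix.mul_assoc, Matrix.nonsing_inv_mul _ hu, Matrix.mul_one]
  simp only [h1] at h
  have h2 : fourierMat (scaled w a) η = ((a.det ^ (-(q : ℝ) / 2) : ℝ) : ℂ) *
      ∫ x : Mat q m, Complex.exp (Complex.I * (((η.transpose * x).trace : ℝ) : ℂ)) *
        w (x * (rootMat a)⁻¹) := by
    rw [fourierMat, ← integral_const_mul]
    congr 1; ext x
    rw [scaled]; ring
  rw [h2, h, Complex.real_smul, ← mul_assoc, ← Complex.ofReal_mul, det_rpow_mul_root_pow ha,
    Complex.ofReal_one, one_mul, fourierMat]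

/-- The projection-slice theorem: a character of $t=\xi'x$ with frequency $\eta$ is the character of
$x$ with frequency $\xi\eta$, so Fubini along the planes gives the claim. -/
theorem fourierMat_radon {n k m : ℕ} (hk : 1 ≤ k) (hkn : k ≤ n) {f : Mat n m → ℂ}
    (hf : Integrable f) (ξ : Stiefel n (n - k)) (η : Mat (n - k) m) :
    fourierMat (radon f ξ) η = fourierMat f ((ξ : Mat n (n - k)) * η) := by
  have h1 : ∀ x : Mat n m, (η.transpose * ((ξ : Mat n (n - k)).transpose * x)).trace =
      (((ξ : Mat n (n - k)) * η).transpose * x).trace := by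
    intro x
    rw [Matrix.transpose_mul, Matrix.mul_assoc]
  rw [fourierMat, integral_mul_radon hk hkn (f := f) ξ
    (v := fun t => Complex.exp (Complex.I * (((η.transpose * t).trace : ℝ) : ℂ)))]
  · simp only [h1]; rfl
  · simp only [h1]
    refine hf.bdd_mul (c := 1) ?_ (ae_of_all _ fun p => ?_)
    · exact (Complex.continuous_exp.comp (continuous_const.mul (Complex.continuous_ofReal.comp
        ((continuous_trace_mul n m).comp (continuous_const.prodMk
          continuous_id))))).aestronglyMeasurable
    · rw [mul_comm Complex.I, Complex.norm_exp_ofReal_mul_I]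

theorem exists_schwartz_le_decay {n m : ℕ} (ψ : 𝓢(EMat n m, ℂ)) (r : ℕ) :
    ∃ B : ℝ, ∀ x : Mat n m, ‖ψ (toE n m x)‖ ≤ B * decay r x := by
  refine ⟨2 ^ r * (Finset.Iic (r, 0)).sup (fun p => SchwartzMap.seminorm ℝ p.1 p.2) ψ,
    fun x => ?_⟩
  have h := SchwartzMap.one_add_le_sup_seminorm_apply (𝕜 := ℝ) (m := (r, 0)) (k := r) (n := 0)
    le_rfl le_rfl ψ (toE n m x)
  rw [norm_iteratedFDeriv_zero] at h
  rw [decay, Real.rpow_neg (by positivity), Real.rpow_natCast, ← div_eq_mul_inv,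
    le_div_iff₀ (by positivity), mul_comm]
  exact h

theorem exists_fourierMat_schwartz_le_decay {n m : ℕ} (ψ : 𝓢(EMat n m, ℂ)) (r : ℕ) :
    ∃ B : ℝ, ∀ y : Mat n m, ‖fourierMat (fun x => ψ (toE n m x)) y‖ ≤ B * decay r y := by
  have hpi : (0 : ℝ) < 2 * Real.pi := by positivity
  let e : EMat n m ≃L[ℝ] EMat n m := ContinuousLinearEquiv.smulLeft (Units.mk0 (-(2 * Real.pi)⁻¹)
    (neg_ne_zero.2 (inv_ne_zero hpi.ne')))
  obtain ⟨B, hB⟩ := exists_schwartz_le_decay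
    (SchwartzMap.compCLMOfContinuousLinearEquiv ℝ e (𝓕 ψ)) r
  refine ⟨B, fun y => ?_⟩
  have h := hB y
  rw [SchwartzMap.compCLMOfContinuousLinearEquiv_apply, Function.comp_apply,
    SchwartzMap.fourier_coe] at h
  rw [fourierMat_eq]
  simp only [ContinuousLinearEquiv.apply_symm_apply]
  convert h using 3
  simp [e]

theorem decay_frame_mul {n q m : ℕ} (r : ℝ) {ξ : Mat n q} (hξ : ξ.transpose * ξ = 1)
    (η : Mat q m) : decay r (ξ * η) = decay r η := by
  have h : ‖toE n m (ξ * η)‖ ^ 2 = ‖toE q m η‖ ^ 2 := by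
    rw [norm_toE_sq, norm_toE_sq, gram_frame_mul hξ]
  rw [decay, decay, (sq_eq_sq₀ (norm_nonneg _) (norm_nonneg _)).1 h]

theorem integrable_of_le_decay {n m : ℕ} {r : ℝ} (hr : (n : ℝ) * m < r) {ψ : Mat n m → ℂ}
    (hψ : Continuous ψ) {B : ℝ} (hB : ∀ x, ‖ψ x‖ ≤ B * decay r x) : Integrable ψ :=
  ((integrable_decay hr).const_mul B).mono' hψ.aestronglyMeasurable (ae_of_all _ hB)

/-- Continuity is what makes Fourier inversion for the plane integrals valid at every point. The
domination holds because $\|g[\omega;t]\|\ge\|\omega\|$. -/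
theorem continuous_radon {n k m : ℕ} (hk : 1 ≤ k) (hkn : k ≤ n) {r : ℝ} (hr : (n : ℝ) * m < r)
    {ψ : Mat n m → ℂ} (hψ : Continuous ψ) {B : ℝ} (hB : ∀ x, ‖ψ x‖ ≤ B * decay r x)
    (ξ : Stiefel n (n - k)) : Continuous (radon ψ ξ) := by
  obtain ⟨g, hg, hgξ⟩ := exists_orth_baseFrame ξ
  have hkr : (k : ℝ) * m < r := by
    refine lt_of_le_of_lt ?_ hr
    gcongr
  have hr0 : 0 ≤ r := le_trans (by positivity) hr.le
  have hB0 : 0 ≤ B := by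
    by_contra! h
    have := (norm_nonneg _).trans (hB 0)
    nlinarith [decay_pos r (0 : Mat n m)]
  have hst : Continuous fun p : Mat k m × Mat (n - k) m => g * stack p.1 p.2 := by
    have : (fun p : Mat k m × Mat (n - k) m => g * stack p.1 p.2) = fun p =>
        g * (topFrame n k * p.1 + baseFrame n k * p.2) := by
      ext1 p; rw [stack_eq hkn]
    rw [this]
    exact continuous_const.matrix_mul ((continuous_const.matrix_mul continuous_fst).add
      (continuous_const.matrix_mul continuous_snd))
  have h1 : radon ψ ξ = fun t => ∫ ω : Mat k m, ψ (g * stack ω t) :=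
    funext fun t => radon_eq hk hkn ψ hg hgξ t
  rw [h1]
  refine continuous_of_dominated (bound := fun ω => B * decay r ω) (fun t => ?_) (fun t => ?_)
    ((integrable_decay hkr).const_mul B) (ae_of_all _ fun ω => ?_)
  · exact (hψ.comp (hst.comp (continuous_id.prodMk continuous_const))).aestronglyMeasurable
  · exact ae_of_all _ fun ω => (hB _).trans
      (mul_le_mul_of_nonneg_left (decay_orth_stack_le hkn hr0 hg ω t) hB0)
  · exact hψ.comp (hst.comp (continuous_const.prodMk continuous_id))

/-- Fourier inversion for the Radon transform of a rapidly decreasing function. -/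
theorem radon_inversion {n k m : ℕ} (hk : 1 ≤ k) (hkn : k ≤ n) {r : ℝ} (hr : (n : ℝ) * m < r)
    {ψ : Mat n m → ℂ} (hψ : Continuous ψ) {B B' : ℝ} (hB : ∀ x, ‖ψ x‖ ≤ B * decay r x)
    (hB' : ∀ y, ‖fourierMat ψ y‖ ≤ B' * decay r y) (ξ : Stiefel n (n - k))
    (s : Mat (n - k) m) :
    radon ψ ξ s = (((2 * Real.pi) ^ ((n - k) * m))⁻¹ : ℝ) *
      fourierMat (fun η => fourierMat ψ (-((ξ : Mat n (n - k)) * η))) s := by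
  have hi : Integrable ψ := integrable_of_le_decay hr hψ hB
  have hqr : ((n - k : ℕ) : ℝ) * m < r := by
    refine lt_of_le_of_lt ?_ hr
    gcongr
    exact Nat.sub_le n k
  have hRi : Integrable (radon ψ ξ) := integrable_radon hk hkn hψ.measurable hi ξ
  have hF : ∀ η, fourierMat (radon ψ ξ) η = fourierMat ψ ((ξ : Mat n (n - k)) * η) :=
    fourierMat_radon hk hkn hi ξ
  have hFi : Integrable (fourierMat (radon ψ ξ)) := by
    refine integrable_of_le_decay hqr (continuous_fourierMat hRi) (B := B') fun η => ?_
    rw [hF, ← decay_frame_mul r ξ.2 η]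
    exact hB' _
  rw [fourierMat_inversion (continuous_radon hk hkn hr hψ hB ξ) hRi hFi s]
  simp only [hF, Matrix.mul_neg]

end MatrixFourier

/-! ### The profile of an admissible wavelet on the cone -/

/-- The function `u` on the cone with `(F w)(y) = u(yᵀ y)`. -/
noncomputable def coneProfile {q m : ℕ} (w : Mat q m → ℂ) (s : Mat m m) : ℂ :=
  fourierMat w (topFrame q m * rootMat s)

theorem measurable_coneProfile {q m : ℕ} {w : Mat q m → ℂ} (hw : Integrable w) :
    Measurable (coneProfile w) := by
  have h : Measurable fun s : Mat m m => topFrame q m * rootMat s :=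
    measurable_mul measurable_const (measurable_rootMat m)
  exact (continuous_fourierMat hw).measurable.comp h

theorem norm_coneProfile_le {q m : ℕ} (w : Mat q m → ℂ) (s : Mat m m) :
    ‖coneProfile w s‖ ≤ ∫ x, ‖w x‖ :=
  norm_fourierMat_le w _

theorem gram_topFrame_mul_rootMat {q m : ℕ} (h : m ≤ q) {s : Mat m m} (hs : s.PosSemidef) :
    (topFrame q m * rootMat s).transpose * (topFrame q m * rootMat s) = s := by
  rw [gram_frame_mul (topFrame_mem h), transpose_rootMat, rootMat_mul_self hs]

/-- The given $u_0$ is unconstrained off the cone. Evaluating $\tilde w$ at $[s^{1/2};0]$ recovers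
it on the cone by a formula that is measurable and bounded everywhere. -/
theorem coneProfile_eq {q m : ℕ} (h : m ≤ q) {w : Mat q m → ℂ} {u₀ : Mat m m → ℂ}
    (hu : ∀ y : Mat q m, y.rank = m → fourierMat w y = u₀ (y.transpose * y)) {s : Mat m m}
    (hs : s.PosDef) : coneProfile w s = u₀ s := by
  have hg := gram_topFrame_mul_rootMat h hs.posSemidef
  rw [coneProfile, hu _ (rank_eq_of_posDef_gram (by rwa [hg])), hg]

/-- A matrix function with a symmetric profile on the cone. -/
structure HasSymmetricProfile {q m : ℕ} (w : Mat q m → ℂ) : Prop where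
  fourierMat_eq : ∀ η : Mat q m, (η.transpose * η).PosDef →
    fourierMat w η = coneProfile w (η.transpose * η)
  symmetric : IsSymmetricOnCone (coneProfile w)

theorem posDef_rootMat_conj {m : ℕ} {r s : Mat m m} (hr : r.PosDef) (hs : s.PosDef) :
    (rootMat s * r * rootMat s).PosDef := by
  simpa only [transpose_rootMat] using posDef_conj hr (det_rootMat_ne_zero hs)

theorem hasSymmetricProfile {q m : ℕ} (h : m ≤ q) {w : Mat q m → ℂ} {u₀ : Mat m m → ℂ}
    (hsym : IsSymmetricOnCone u₀)
    (hu : ∀ y : Mat q m, y.rank = m → fourierMat w y = u₀ (y.transpose * y)) :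
    HasSymmetricProfile w := by
  refine ⟨fun η hη => ?_, fun r s hr hs => ?_⟩
  · rw [coneProfile_eq h hu hη, hu η (rank_eq_of_posDef_gram hη)]
  · rw [coneProfile_eq h hu (posDef_rootMat_conj hr hs),
      coneProfile_eq h hu (posDef_rootMat_conj hs hr), hsym r s hr hs]

/-- The integrand `|s|^{-k/2} u(s)`. -/
noncomputable def profileDensity {q m : ℕ} (k : ℕ) (w : Mat q m → ℂ) (s : Mat m m) : ℂ :=
  ((s.det ^ (-(k : ℝ) / 2) : ℝ) : ℂ) * coneProfile w s

theorem measurable_profileDensity {q m : ℕ} (k : ℕ) {w : Mat q m → ℂ} (hw : Integrable w) :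
    Measurable (profileDensity k w) :=
  (Complex.measurable_ofReal.comp ((measurable_det m).pow_const _)).mul (measurable_coneProfile hw)

theorem det_rpow_smul_profile {n k m : ℕ} (hkn : k ≤ n) (w : Mat (n - k) m → ℂ) {s : Mat m m}
    (hs : s.PosDef) :
    s.det ^ (((n - k : ℕ) : ℝ) / 2) • (coneProfile w s / ((Real.sqrt s.det ^ n : ℝ) : ℂ)) =
      profileDensity k w s := by
  rw [profileDensity, Complex.real_smul, mul_div_left_comm, mul_comm, ← Complex.ofReal_div]
  congr 2
  rw [Real.sqrt_eq_rpow, ← Real.rpow_natCast, ← Real.rpow_mul hs.det_pos.le,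
    ← Real.rpow_sub hs.det_pos, Nat.cast_sub hkn]
  congr 1
  ring

/-- The integrand of $c_w$ is a function of $s=\zeta'\zeta$ almost everywhere. The passage to the
cone contributes $|s|^{(n-k)/2}$, which with $|\zeta|_m^{-n}=|s|^{-n/2}$ leaves $|s|^{-k/2}$. -/
theorem profile_integral {n k m : ℕ} (hkn : k + m ≤ n) {w : Mat (n - k) m → ℂ}
    (hw : Integrable w) (hp : HasSymmetricProfile w)
    (hfin : Integrable fun ζ : Mat (n - k) m => fourierMat w ζ / ((volNorm ζ ^ n : ℝ) : ℂ)) :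
    Integrable (profileDensity k w) (coneMeasure m) ∧
    ∫ ζ : Mat (n - k) m, fourierMat w ζ / ((volNorm ζ ^ n : ℝ) : ℂ) =
      (gramConst (n - k) m : ℂ) * ∫ s, profileDensity k w s ∂coneMeasure m := by
  have hmq : m ≤ n - k := by omega
  have hk : k ≤ n := by omega
  have hc := gramConst_pos hmq
  set H : Mat m m → ℂ := fun s => coneProfile w s / ((Real.sqrt s.det ^ n : ℝ) : ℂ) with hH
  have hHm : Measurable H := (measurable_coneProfile hw).div
    (Complex.measurable_ofReal.comp ((measurable_det m).sqrt.pow_const n))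
  have hae : (fun ζ : Mat (n - k) m => fourierMat w ζ / ((volNorm ζ ^ n : ℝ) : ℂ)) =ᵐ[volume]
      fun ζ => H (ζ.transpose * ζ) := by
    filter_upwards [ae_posDef_gram hmq] with ζ hζ
    rw [hH, hp.fourierMat_eq ζ hζ, volNorm]
  have hmap := map_gram_volume hmq
  have hdm : Measurable fun s : Mat m m => ENNReal.ofReal (s.det ^ (((n - k : ℕ) : ℝ) / 2)) :=
    measurable_ofReal_det_rpow _
  have hdt : ∀ᵐ s ∂coneMeasure m, ENNReal.ofReal (s.det ^ (((n - k : ℕ) : ℝ) / 2)) < ⊤ :=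
    ae_of_all _ fun s => ENNReal.ofReal_lt_top
  have hden : ∀ᵐ s ∂coneMeasure m,
      (ENNReal.ofReal (s.det ^ (((n - k : ℕ) : ℝ) / 2))).toReal • H s = profileDensity k w s := by
    filter_upwards [ae_posDef_coneMeasure m] with s hs
    rw [ENNReal.toReal_ofReal (Real.rpow_nonneg hs.det_pos.le _), hH]
    exact det_rpow_smul_profile hk w hs
  constructor
  · have h1 : Integrable H (Measure.map (fun y : Mat (n - k) m => y.transpose * y) volume) :=
      (integrable_map_measure hHm.aestronglyMeasurable (measurable_gram _ m).aemeasurable).2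
        (hfin.congr hae)
    rw [hmap, integrable_smul_measure (ENNReal.ofReal_pos.2 hc).ne' ENNReal.ofReal_ne_top,
      integrable_withDensity_iff_integrable_smul' hdm hdt] at h1
    exact h1.congr hden
  · rw [integral_congr_ae hae, ← integral_map (μ := (volume : Measure (Mat (n - k) m)))
      (measurable_gram (n - k) m).aemeasurable hHm.aestronglyMeasurable, hmap,
      integral_smul_measure, integral_withDensity_eq_integral_toReal_smul hdm hdt,
      integral_congr_ae hden, ENNReal.toReal_ofReal hc.le, Complex.real_smul]

/-! ### The multiplier -/

/-- The constant `(2π)^{km} c_{n-k} / c_n`. -/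
noncomputable def multiplierConst (n k m : ℕ) : ℝ :=
  (2 * Real.pi) ^ (k * m) * (gramConst (n - k) m / gramConst n m)

/-- The Fourier multiplier of the truncated inversion operator. -/
noncomputable def multiplier {n k m : ℕ} (w : Mat (n - k) m → ℂ) (ε ρ : ℝ) (y : Mat n m) : ℂ :=
  multiplierConst n k m * ((((y.transpose * y).det ^ (-(k : ℝ) / 2) : ℝ) : ℂ) *
    ∫ a in coneInterval m ε ρ, ((a.det ^ (-(k : ℝ) / 2) : ℝ) : ℂ) *
      coneProfile w (rootMat a * (y.transpose * y) * rootMat a) ∂coneMeasure m)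

/-- The constants match because $\sigma_{n,m}=2^m\,\pi^{nm/2}/\Gamma_m(n/2)$, so
$2^{m(k+1)}\pi^{km}/\sigma_{n,m}=(2\pi)^{km}\,\Gamma_m(n/2)/\pi^{nm/2}$. -/
theorem waveletConst_eq {n k m : ℕ} (hkn : k + m ≤ n) {w : Mat (n - k) m → ℂ}
    (hw : Integrable w) (hp : HasSymmetricProfile w)
    (hfin : Integrable fun ζ : Mat (n - k) m => fourierMat w ζ / ((volNorm ζ ^ n : ℝ) : ℂ)) :
    waveletConst n k m w =
      multiplierConst n k m * ∫ s, profileDensity k w s ∂coneMeasure m := by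
  rw [waveletConst, (profile_integral hkn hw hp hfin).2, ← mul_assoc, ← Complex.ofReal_mul]
  congr 2
  have h0 : stiefelVolume n m = 2 ^ m * gramConst n m := by
    rw [stiefelVolume, gramConst, mul_div_assoc]
  rw [multiplierConst, h0]
  have h1 := (gramConst_pos (N := n) (m := m) (by omega)).ne'
  field_simp
  ring

theorem measurable_multiplier {n k m : ℕ} {w : Mat (n - k) m → ℂ} (hw : Integrable w) (ε ρ : ℝ) :
    Measurable (multiplier w ε ρ : Mat n m → ℂ) := by
  have hg : Measurable fun p : Mat n m × Mat m m => p.1.transpose * p.1 :=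
    (measurable_gram n m).comp measurable_fst
  have hr : Measurable fun p : Mat n m × Mat m m => rootMat p.2 :=
    (measurable_rootMat m).comp measurable_snd
  have h1 : Measurable fun p : Mat n m × Mat m m =>
      coneProfile w (rootMat p.2 * (p.1.transpose * p.1) * rootMat p.2) :=
    (measurable_coneProfile hw).comp (measurable_mul (measurable_mul hr hg) hr)
  have h2 : Measurable fun p : Mat n m × Mat m m => ((p.2.det ^ (-(k : ℝ) / 2) : ℝ) : ℂ) :=
    Complex.measurable_ofReal.comp (((measurable_det m).comp measurable_snd).pow_const _)
  have h3 := (h2.fun_mul h1).stronglyMeasurable.integral_prod_right'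
    (ν := (coneMeasure m).restrict (coneInterval m ε ρ))
  have h4 : Measurable fun y : Mat n m => (((y.transpose * y).det ^ (-(k : ℝ) / 2) : ℝ) : ℂ) :=
    Complex.measurable_ofReal.comp (((measurable_det m).comp (measurable_gram n m)).pow_const _)
  exact (h4.fun_mul h3.measurable).const_mul _

/-- The conjugated cone interval `ε r < s < ρ r`, in the form `ε I < r^{-1/2} s r^{-1/2} < ρ I`. -/
def coneSection {m : ℕ} (r : Mat m m) (ε ρ : ℝ) : Set (Mat m m) :=
  {s | (rootMat r)⁻¹ * s * (rootMat r)⁻¹ ∈ coneInterval m ε ρ}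

theorem measurableSet_coneSection {m : ℕ} (r : Mat m m) (ε ρ : ℝ) :
    MeasurableSet (coneSection r ε ρ) := by
  have h : Measurable fun s : Mat m m => (rootMat r)⁻¹ * s * (rootMat r)⁻¹ :=
    measurable_mul (measurable_mul measurable_const measurable_id) measurable_const
  exact h (measurableSet_coneInterval m ε ρ)

theorem integral_conj_coneMeasure {m : ℕ} {g : Mat m m} (hg : g.det ≠ 0) {F : Mat m m → ℂ}
    (hF : Measurable F) :
    ∫ s, F (g * s * g.transpose) ∂coneMeasure m = ∫ s, F s ∂coneMeasure m := by
  have hm := measurable_conj g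
  have h : Measure.map (fun s => g * s * g.transpose) (coneMeasure m) = coneMeasure m := by
    refine Measure.ext_of_lintegral _ fun G hG => ?_
    rw [lintegral_map hG hm]
    exact (isConeInvariant_coneMeasure m).conj g hg G hG
  rw [← integral_map hm.aemeasurable hF.aestronglyMeasurable, h]

/-- This is where symmetry of the profile enters: $u(a^{1/2}ra^{1/2})=u(r^{1/2}ar^{1/2})$, after
which the invariant substitution $s=r^{1/2}ar^{1/2}$ removes $r$ from the integrand, with
$|r|^{-k/2}|a|^{-k/2}=|s|^{-k/2}$. Only the domain still depends on $y$. -/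
theorem multiplier_eq {n k m : ℕ} {w : Mat (n - k) m → ℂ} (hw : Integrable w)
    (hp : HasSymmetricProfile w) {ε : ℝ} (hε : 0 < ε) (ρ : ℝ) {y : Mat n m}
    (hy : (y.transpose * y).PosDef) :
    multiplier w ε ρ y = multiplierConst n k m *
      ∫ s in coneSection (y.transpose * y) ε ρ, profileDensity k w s ∂coneMeasure m := by
  set r := y.transpose * y with hr
  have hd := det_rootMat_ne_zero hy
  have hu : IsUnit (rootMat r).det := hd.isUnit
  rw [multiplier, ← hr]
  congr 1
  rw [← integral_indicator (measurableSet_coneSection r ε ρ), ← integral_conj_coneMeasure hd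
    ((measurable_profileDensity k hw).indicator (measurableSet_coneSection r ε ρ)),
    ← integral_indicator (measurableSet_coneInterval m ε ρ), ← integral_const_mul]
  refine integral_congr_ae (ae_of_all _ fun a => ?_)
  have h1 : (rootMat r)⁻¹ * (rootMat r * a * rootMat r) * (rootMat r)⁻¹ = a := by
    rw [Matrix.mul_assoc, Matrix.mul_assoc, Matrix.mul_nonsing_inv _ hu, Matrix.mul_one,
      ← Matrix.mul_assoc, Matrix.nonsing_inv_mul _ hu, Matrix.one_mul]
  simp only [transpose_rootMat]
  by_cases ha : a ∈ coneInterval m ε ρ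
  · have hs : rootMat r * a * rootMat r ∈ coneSection r ε ρ := by
      rw [coneSection, Set.mem_ofPred_eq, h1]; exact ha
    have hap := posDef_of_mem_coneInterval hε ha
    rw [Set.indicator_of_mem ha, Set.indicator_of_mem hs, profileDensity,
      hp.symmetric r a hy hap, ← mul_assoc, ← Complex.ofReal_mul,
      ← Real.mul_rpow hy.det_pos.le hap.det_pos.le]
    congr 4
    rw [Matrix.det_mul, Matrix.det_mul, ← det_rootMat_sq hy.posSemidef]
    ring
  · have hs : rootMat r * a * rootMat r ∉ coneSection r ε ρ := by
      rw [coneSection, Set.mem_ofPred_eq, h1]; exact ha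
    rw [Set.indicator_of_notMem ha, Set.indicator_of_notMem hs, mul_zero]

theorem norm_multiplier_le {n k m : ℕ} {w : Mat (n - k) m → ℂ} (hw : Integrable w)
    (hp : HasSymmetricProfile w) (hi : Integrable (profileDensity k w) (coneMeasure m)) {ε : ℝ}
    (hε : 0 < ε) (ρ : ℝ) {y : Mat n m} (hy : (y.transpose * y).PosDef) :
    ‖multiplier w ε ρ y‖ ≤
      |multiplierConst n k m| * ∫ s, ‖profileDensity k w s‖ ∂coneMeasure m := by
  rw [multiplier_eq hw hp hε ρ hy, norm_mul, Complex.norm_real, Real.norm_eq_abs]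
  refine mul_le_mul_of_nonneg_left ((norm_integral_le_integral_norm _).trans ?_) (abs_nonneg _)
  exact setIntegral_le_integral hi.norm (ae_of_all _ fun _ => norm_nonneg _)

theorem eventually_mem_coneSection {m : ℕ} {r s : Mat m m} (hr : r.PosDef) (hs : s.PosDef) :
    ∀ᶠ p : ℝ × ℝ in 𝓝[>] (0 : ℝ) ×ˢ atTop, s ∈ coneSection r p.1 p.2 := by
  have hb : ((rootMat r)⁻¹ * s * (rootMat r)⁻¹).PosDef := by
    have := posDef_conj hs (det_inv_ne_zero (det_rootMat_ne_zero hr))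
    rwa [Matrix.transpose_nonsing_inv, transpose_rootMat] at this
  obtain ⟨δ, hδ, h1⟩ := PosDef.exists_sub_smul hb
  obtain ⟨R, h2⟩ := PosDef.exists_smul_sub hb
  have e1 : ∀ᶠ ε in 𝓝[>] (0 : ℝ), ε < δ :=
    mem_nhdsWithin_of_mem_nhds (Iio_mem_nhds hδ)
  filter_upwards [e1.prod_mk (eventually_gt_atTop R)] with p hp
  exact ⟨h1 _ hp.1, h2 _ hp.2⟩

theorem eventually_pos_fst : ∀ᶠ p : ℝ × ℝ in 𝓝[>] (0 : ℝ) ×ˢ atTop, 0 < p.1 :=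
  (eventually_mem_nhdsWithin : ∀ᶠ ε in 𝓝[>] (0 : ℝ), 0 < ε).prod_inl _

/-- The sections eventually contain each point of the cone and the full density is integrable, so
dominated convergence applies; the limit no longer depends on $y$. -/
theorem tendsto_multiplier {n k m : ℕ} {w : Mat (n - k) m → ℂ} (hw : Integrable w)
    (hp : HasSymmetricProfile w) (hi : Integrable (profileDensity k w) (coneMeasure m))
    {y : Mat n m} (hy : (y.transpose * y).PosDef) :
    Tendsto (fun p : ℝ × ℝ => multiplier w p.1 p.2 y) (𝓝[>] (0 : ℝ) ×ˢ atTop)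
      (𝓝 (multiplierConst n k m * ∫ s, profileDensity k w s ∂coneMeasure m)) := by
  have h1 : Tendsto (fun p : ℝ × ℝ => (multiplierConst n k m : ℂ) *
      ∫ s, (coneSection (y.transpose * y) p.1 p.2).indicator (profileDensity k w) s
        ∂coneMeasure m) (𝓝[>] (0 : ℝ) ×ˢ atTop)
      (𝓝 (multiplierConst n k m * ∫ s, profileDensity k w s ∂coneMeasure m)) := by
    refine Tendsto.const_mul _ (tendsto_integral_filter_of_dominated_convergence
      (fun s => ‖profileDensity k w s‖) (Eventually.of_forall fun p => ?_)
      (Eventually.of_forall fun p => ae_of_all _ fun s => norm_indicator_le_norm_self _ _)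
      hi.norm ?_)
    · exact ((measurable_profileDensity k hw).indicator
        (measurableSet_coneSection _ _ _)).aestronglyMeasurable
    · filter_upwards [ae_posDef_coneMeasure m] with s hs
      refine tendsto_const_nhds.congr' ?_
      filter_upwards [eventually_mem_coneSection hy hs] with p hps
      rw [Set.indicator_of_mem hps]
  refine h1.congr' ?_
  filter_upwards [eventually_pos_fst] with p hp0
  rw [multiplier_eq hw hp hp0 p.2 hy, integral_indicator (measurableSet_coneSection _ _ _)]

/-! ### The truncated inversion operator as a Fourier multiplier -/

/-- Shifting $s$ by $t$ modulates $B$ by a character, and the multiplication formula moves the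
transform from $B$ to $W$. -/
theorem integral_translate_mul_fourierMat {q m : ℕ} {W B : Mat q m → ℂ} (hW : Integrable W)
    (hB : Integrable B) (t : Mat q m) :
    ∫ s, W (s - t) * fourierMat B s = fourierMat (fun η => fourierMat W η * B η) t := by
  have hB' : Integrable fun η : Mat q m =>
      Complex.exp (Complex.I * (((t.transpose * η).trace : ℝ) : ℂ)) * B η := by
    refine hB.bdd_mul (c := 1) ?_ (ae_of_all _ fun p => ?_)
    · exact (Complex.continuous_exp.comp (continuous_const.mul (Complex.continuous_ofReal.comp
        ((continuous_trace_mul q m).comp (continuous_const.prodMk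
          continuous_id))))).aestronglyMeasurable
    · rw [mul_comm Complex.I, Complex.norm_exp_ofReal_mul_I]
  have h1 : ∀ z : Mat q m, fourierMat B (z + t) = fourierMat (fun η : Mat q m =>
      Complex.exp (Complex.I * (((t.transpose * η).trace : ℝ) : ℂ)) * B η) z := by
    intro z
    refine integral_congr_ae (ae_of_all _ fun η => ?_)
    dsimp only
    rw [← mul_assoc, ← Complex.exp_add, ← mul_add, ← Complex.ofReal_add, ← Matrix.trace_add,
      ← Matrix.add_mul, ← Matrix.transpose_add]
  rw [← integral_add_right_eq_self (fun s : Mat q m => W (s - t) * fourierMat B s) t]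
  simp only [add_sub_cancel_right, h1]
  rw [← integral_fourierMat_mul hW hB', fourierMat]
  congr 1; ext η; ring

theorem integral_mul_translate_mul_fourierMat {q m : ℕ} {A W B : Mat q m → ℂ} (hA : Integrable A)
    (hW : Integrable W) (hB : Integrable B) :
    ∫ t, A t * (∫ s, W (s - t) * fourierMat B s) =
      ∫ η, fourierMat A η * (fourierMat W η * B η) := by
  have h : Integrable fun η : Mat q m => fourierMat W η * B η :=
    hB.bdd_mul (c := ∫ x, ‖W x‖) (continuous_fourierMat hW).aestronglyMeasurable
      (ae_of_all _ (norm_fourierMat_le W))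
  simp only [integral_translate_mul_fourierMat hW hB]
  exact (integral_fourierMat_mul hA h).symm

theorem integrable_scaled {q m : ℕ} {w : Mat q m → ℂ} (hw : Measurable w) (hwi : Integrable w)
    {a : Mat m m} (ha : a.PosDef) : Integrable (scaled w a) := by
  refine ⟨(measurable_scaled_comp hw measurable_const measurable_id).aestronglyMeasurable, ?_⟩
  have h := lintegral_scaled hw ha 0
  simp only [sub_zero] at h
  rw [HasFiniteIntegral, h]
  exact hwi.2

/-- Hypotheses on a rapidly decreasing test function. -/
structure IsTest {n m : ℕ} (r : ℝ) (ψ : Mat n m → ℂ) (B B' : ℝ) : Prop where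
  lt : (n : ℝ) * m < r
  continuous : Continuous ψ
  le_decay : ∀ x, ‖ψ x‖ ≤ B * decay r x
  fourier_le_decay : ∀ y, ‖fourierMat ψ y‖ ≤ B' * decay r y

namespace IsTest

variable {n k m : ℕ} {r B B' : ℝ} {ψ : Mat n m → ℂ}

theorem nonneg (h : IsTest r ψ B B') : 0 ≤ r := le_trans (by positivity) h.lt.le

theorem integrable (h : IsTest r ψ B B') : Integrable ψ :=
  integrable_of_le_decay h.lt h.continuous h.le_decay

theorem sub_lt (h : IsTest r ψ B B') : ((n - k : ℕ) : ℝ) * m < r := by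
  refine lt_of_le_of_lt ?_ h.lt
  gcongr
  exact Nat.sub_le n k

theorem le_lt (h : IsTest r ψ B B') (hkn : k ≤ n) : (k : ℝ) * m < r := by
  refine lt_of_le_of_lt ?_ h.lt
  gcongr

theorem neg_frame_le (h : IsTest r ψ B B') (ξ : Stiefel n (n - k)) (η : Mat (n - k) m) :
    ‖fourierMat ψ (-((ξ : Mat n (n - k)) * η))‖ ≤ B' * decay r η := by
  have := h.fourier_le_decay ((ξ : Mat n (n - k)) * (-η))
  rw [decay_frame_mul r ξ.2, Matrix.mul_neg] at this
  refine this.trans (le_of_eq ?_)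
  rw [decay, decay, map_neg, norm_neg]

theorem integral_mul_scaled (h : IsTest r ψ B B') (hk : 1 ≤ k) (hkn : k ≤ n)
    {w : Mat (n - k) m → ℂ} (hw : Measurable w) (hwi : Integrable w) {a : Mat m m} (ha : a.PosDef)
    (ξ : Stiefel n (n - k)) (t : Mat (n - k) m) :
    ∫ x, ψ x * scaled w a ((ξ : Mat n (n - k)).transpose * x - t) =
      ∫ s, scaled w a (s - t) * radon ψ ξ s := by
  have hm : Measurable fun x : Mat n m =>
      scaled w a ((ξ : Mat n (n - k)).transpose * x - t) * ψ x :=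
    (measurable_scaled_frame_sub hw measurable_const measurable_const measurable_id
      measurable_const).fun_mul h.continuous.measurable
  have hi : Integrable fun x : Mat n m =>
      scaled w a ((ξ : Mat n (n - k)).transpose * x - t) * ψ x := by
    refine ⟨hm.aestronglyMeasurable, ?_⟩
    have hle : ∀ x : Mat n m, ‖scaled w a ((ξ : Mat n (n - k)).transpose * x - t) * ψ x‖ₑ ≤
        ENNReal.ofReal B * (‖scaled w a ((ξ : Mat n (n - k)).transpose * x - t)‖ₑ *
          ENNReal.ofReal (decay r x)) := by
      intro x
      rw [enorm_mul, mul_left_comm]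
      refine mul_le_mul' le_rfl ?_
      rw [← ENNReal.ofReal_mul' (decay_pos r _).le, ← ofReal_norm]
      exact ENNReal.ofReal_le_ofReal (h.le_decay x)
    refine (lintegral_mono hle).trans_lt ?_
    rw [lintegral_const_mul' _ _ ENNReal.ofReal_ne_top]
    refine ENNReal.mul_lt_top ENNReal.ofReal_lt_top
      ((lintegral_scaled_mul_decay_le hk hkn hw h.nonneg ha ξ t).trans_lt ?_)
    exact ENNReal.mul_lt_top (lintegral_decay_lt_top (h.le_lt hkn)) hwi.2
  rw [integral_mul_radon hk hkn ξ (v := fun s => scaled w a (s - t)) hi]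
  congr 1; ext x; ring

/-- The core computation for fixed $a$ and $\xi$. The plane integrals of $\psi$ are written by
Fourier inversion on the slice; two uses of the multiplication formula and the slice theorem for $f$
then put everything on the frequency side. -/
theorem integral_radon_mul (h : IsTest r ψ B B') (hk : 1 ≤ k) (hkn : k ≤ n) {f : Mat n m → ℂ}
    (hf : Measurable f) (hfi : Integrable f)
    {w : Mat (n - k) m → ℂ} (hw : Measurable w) (hwi : Integrable w) {a : Mat m m} (ha : a.PosDef)
    (ξ : Stiefel n (n - k)) :
    ∫ t, radon f ξ t * (∫ x, ψ x * scaled w a ((ξ : Mat n (n - k)).transpose * x - t)) =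
      (((2 * Real.pi) ^ ((n - k) * m))⁻¹ : ℝ) *
      ∫ η : Mat (n - k) m, fourierMat f ((ξ : Mat n (n - k)) * η) * (fourierMat w (η * rootMat a) *
        fourierMat ψ (-((ξ : Mat n (n - k)) * η))) := by
  have hBi : Integrable fun η : Mat (n - k) m => fourierMat ψ (-((ξ : Mat n (n - k)) * η)) := by
    refine integrable_of_le_decay h.sub_lt ?_ (h.neg_frame_le ξ)
    exact (continuous_fourierMat h.integrable).comp
      (continuous_const.matrix_mul continuous_id).fun_neg
  have h1 : ∀ t, ∫ x, ψ x * scaled w a ((ξ : Mat n (n - k)).transpose * x - t) =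
      (((2 * Real.pi) ^ ((n - k) * m))⁻¹ : ℝ) * ∫ s, scaled w a (s - t) *
        fourierMat (fun η => fourierMat ψ (-((ξ : Mat n (n - k)) * η))) s := by
    intro t
    rw [h.integral_mul_scaled hk hkn hw hwi ha, ← integral_const_mul]
    congr 1; ext s
    rw [radon_inversion hk hkn h.lt h.continuous h.le_decay h.fourier_le_decay]
    ring
  simp only [h1, mul_left_comm _ ((((2 * Real.pi) ^ ((n - k) * m))⁻¹ : ℝ) : ℂ)]
  rw [integral_const_mul, integral_mul_translate_mul_fourierMat
    (integrable_radon hk hkn hf hfi ξ) (integrable_scaled hw hwi ha) hBi]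
  simp only [fourierMat_radon hk hkn hfi, fourierMat_scaled w ha]

end IsTest

/-- The frequency side integrand of the inversion formula. -/
noncomputable def frequencyKernel {n k m : ℕ} (f : Mat n m → ℂ) (w : Mat (n - k) m → ℂ)
    (ψ : Mat n m → ℂ) (a : Mat m m) (y : Mat n m) : ℂ :=
  (fourierMat f y * fourierMat ψ (-y)) * (((a.det ^ (-(k : ℝ) / 2) : ℝ) : ℂ) *
    coneProfile w (rootMat a * (y.transpose * y) * rootMat a))

theorem measurable_frequencyKernel {n k m : ℕ} {f : Mat n m → ℂ} (hf : Integrable f)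
    {w : Mat (n - k) m → ℂ} (hw : Integrable w) {ψ : Mat n m → ℂ} (hψ : Integrable ψ) :
    Measurable fun p : Mat m m × Mat n m => frequencyKernel f w ψ p.1 p.2 := by
  have hg : Measurable fun p : Mat m m × Mat n m => p.2.transpose * p.2 :=
    (measurable_gram n m).comp measurable_snd
  have hr : Measurable fun p : Mat m m × Mat n m => rootMat p.1 :=
    (measurable_rootMat m).comp measurable_fst
  have h1 : Measurable fun p : Mat m m × Mat n m =>
      coneProfile w (rootMat p.1 * (p.2.transpose * p.2) * rootMat p.1) :=
    (measurable_coneProfile hw).comp (measurable_mul (measurable_mul hr hg) hr)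
  have h2 : Measurable fun p : Mat m m × Mat n m => ((p.1.det ^ (-(k : ℝ) / 2) : ℝ) : ℂ) :=
    Complex.measurable_ofReal.comp (((measurable_det m).comp measurable_fst).pow_const _)
  have h3 : Measurable fun p : Mat m m × Mat n m => fourierMat f p.2 :=
    (continuous_fourierMat hf).measurable.comp measurable_snd
  have h4 : Measurable fun p : Mat m m × Mat n m => fourierMat ψ (-p.2) :=
    ((continuous_fourierMat hψ).comp continuous_neg).measurable.comp measurable_snd
  exact (h3.fun_mul h4).fun_mul (h2.fun_mul h1)

theorem integrable_det_rpow_coneInterval (m : ℕ) (α : ℝ) {ε : ℝ} (hε : 0 < ε) (ρ : ℝ) :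
    Integrable (fun a : Mat m m => a.det ^ α)
      ((coneMeasure m).restrict (coneInterval m ε ρ)) := by
  refine ⟨((measurable_det m).pow_const α).aestronglyMeasurable, ?_⟩
  refine lt_of_le_of_lt (le_of_eq ?_) (lintegral_det_rpow_coneInterval m α hε ρ)
  refine setLIntegral_congr_fun (measurableSet_coneInterval m ε ρ) fun a ha => ?_
  exact Real.enorm_of_nonneg
    (Real.rpow_nonneg (posDef_of_mem_coneInterval hε ha).det_pos.le _)

/-- The transforms of $f$ and $w$ are bounded by their $L^1$ norms, that of $\psi$ decays in $\eta$
uniformly in $\xi$ because $\|\xi\eta\|=\|\eta\|$, and $|a|^{-k/2}$ is integrable over the cone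
interval. -/
theorem integrable_frequencyKernel {n k m : ℕ} {f : Mat n m → ℂ} (hf : Integrable f)
    {w : Mat (n - k) m → ℂ} (hw : Integrable w) {ψ : Mat n m → ℂ} {r B B' : ℝ}
    (hψ : IsTest r ψ B B') {ε : ℝ} (hε : 0 < ε) (ρ : ℝ) :
    Integrable (fun p : Mat m m × (Stiefel n (n - k) × Mat (n - k) m) =>
      frequencyKernel f w ψ p.1 ((p.2.1 : Mat n (n - k)) * p.2.2)) (paramMeasure n k m ε ρ) := by
  have hdec : Integrable (fun p : Stiefel n (n - k) × Mat (n - k) m => decay r p.2)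
      ((stiefelMeasure n k).prod volume) := (integrable_decay hψ.sub_lt).comp_snd _
  have hdom := ((integrable_det_rpow_coneInterval m (-(k : ℝ) / 2) hε ρ).norm.mul_prod
    hdec).const_mul ((∫ x, ‖f x‖) * B' * ∫ x, ‖w x‖)
  have hm : Measurable fun p : Mat m m × (Stiefel n (n - k) × Mat (n - k) m) =>
      (p.1, (p.2.1 : Mat n (n - k)) * p.2.2) :=
    measurable_fst.prodMk ((measurable_frame_mul n (n - k) m).comp measurable_snd)
  refine hdom.mono' ((measurable_frequencyKernel hf hw hψ.integrable).comp
    hm).aestronglyMeasurable (ae_of_all _ fun p => ?_)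
  rw [frequencyKernel, norm_mul, norm_mul, norm_mul, Complex.norm_real]
  have h1 := norm_fourierMat_le f ((p.2.1 : Mat n (n - k)) * p.2.2)
  have h2 := hψ.neg_frame_le p.2.1 p.2.2
  have h3 := norm_coneProfile_le w (rootMat p.1 * (((p.2.1 : Mat n (n - k)) * p.2.2).transpose *
    ((p.2.1 : Mat n (n - k)) * p.2.2)) * rootMat p.1)
  have h4 : 0 ≤ B' * decay r p.2.2 := (norm_nonneg _).trans h2
  have h5 : 0 ≤ ∫ x, ‖f x‖ := integral_nonneg fun _ => norm_nonneg _
  calc _ ≤ ((∫ x, ‖f x‖) * (B' * decay r p.2.2)) *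
        (‖p.1.det ^ (-(k : ℝ) / 2)‖ * ∫ x, ‖w x‖) := by gcongr
    _ = _ := by ring

theorem integral_slice_eq {n k m : ℕ} (hk : 1 ≤ k) (hkn : k + m ≤ n) {f : Mat n m → ℂ}
    (hf : Measurable f) (hfi : Integrable f) {w : Mat (n - k) m → ℂ} (hw : Measurable w)
    (hwi : Integrable w) (hp : HasSymmetricProfile w) {ψ : Mat n m → ℂ} {r B B' : ℝ}
    (hψ : IsTest r ψ B B') {a : Mat m m} (ha : a.PosDef) (ξ : Stiefel n (n - k)) :
    ∫ t, ∫ x, ψ x * inversionKernel f w x (a, ξ, t) =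
      (((2 * Real.pi) ^ ((n - k) * m))⁻¹ : ℝ) *
        ∫ η : Mat (n - k) m, frequencyKernel f w ψ a ((ξ : Mat n (n - k)) * η) := by
  have h1 : ∀ t, ∫ x, ψ x * inversionKernel f w x (a, ξ, t) =
      ((a.det ^ (-(k : ℝ) / 2) : ℝ) : ℂ) * (radon f ξ t *
        ∫ x, ψ x * scaled w a ((ξ : Mat n (n - k)).transpose * x - t)) := by
    intro t
    rw [← integral_const_mul, ← integral_const_mul]
    congr 1; ext x
    rw [inversionKernel]; ring
  simp only [h1]
  rw [integral_const_mul, hψ.integral_radon_mul hk (by omega) hf hfi hw hwi ha, mul_left_comm,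
    ← integral_const_mul]
  congr 1
  refine integral_congr_ae ?_
  filter_upwards [ae_posDef_gram (n := n - k) (m := m) (by omega)] with η hη
  have hg : (η * rootMat a).transpose * (η * rootMat a) =
      rootMat a * (η.transpose * η) * rootMat a := by
    rw [Matrix.transpose_mul, transpose_rootMat]; simp only [Matrix.mul_assoc]
  rw [frequencyKernel, gram_frame_mul ξ.2, hp.fourierMat_eq _ (by
    rw [hg]; exact posDef_rootMat_conj hη ha), hg]
  ring

theorem integral_param {n k m : ℕ} {ε ρ : ℝ}
    {G : Mat m m × (Stiefel n (n - k) × Mat (n - k) m) → ℂ}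
    (hG : Integrable G (paramMeasure n k m ε ρ)) :
    ∫ q, G q ∂paramMeasure n k m ε ρ =
      ∫ a in coneInterval m ε ρ, (∫ ξ, (∫ t : Mat (n - k) m, G (a, ξ, t)) ∂stiefelMeasure n k)
        ∂coneMeasure m := by
  rw [paramMeasure, integral_prod _ hG]
  refine integral_congr_ae ?_
  filter_upwards [hG.prod_right_ae] with a ha
  rw [integral_prod _ ha]

/-- The integrand depends on $(\xi,\eta)$ through $y=\xi\eta$ only. The push-forward density
supplies $|y'y|^{-k/2}$, and the inner $a$-integral completes the multiplier up to the factor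
$(2\pi)^{km}$ of its definition. -/
theorem integral_frequencyKernel {n k m : ℕ} (hkn : k + m ≤ n) {f : Mat n m → ℂ}
    (hf : Integrable f) {w : Mat (n - k) m → ℂ} (hw : Integrable w) {ψ : Mat n m → ℂ}
    {r B B' : ℝ} (hψ : IsTest r ψ B B') {ε : ℝ} (hε : 0 < ε) (ρ : ℝ) :
    ∫ q, frequencyKernel f w ψ q.1 ((q.2.1 : Mat n (n - k)) * q.2.2) ∂paramMeasure n k m ε ρ =
      (((2 * Real.pi) ^ (k * m))⁻¹ : ℝ) *
        ∫ y, multiplier w ε ρ y * (fourierMat f y * fourierMat ψ (-y)) := by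
  have hi := integrable_frequencyKernel hf hw hψ hε ρ
  have hc : 0 ≤ gramConst (n - k) m / gramConst n m :=
    (div_pos (gramConst_pos (by omega)) (gramConst_pos (by omega))).le
  have hF : Measurable fun y : Mat n m =>
      ∫ a in coneInterval m ε ρ, frequencyKernel f w ψ a y ∂coneMeasure m :=
    ((measurable_frequencyKernel hf hw hψ.integrable).stronglyMeasurable.integral_prod_left'
      (μ := (coneMeasure m).restrict (coneInterval m ε ρ))).measurable
  have hd : Measurable fun y : Mat n m =>
      ENNReal.ofReal ((y.transpose * y).det ^ (-(k : ℝ) / 2)) :=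
    (measurable_ofReal_det_rpow _).comp (measurable_gram n m)
  rw [paramMeasure] at hi ⊢
  rw [integral_prod_symm _ hi]
  have h1 := integral_map (μ := (stiefelMeasure n k).prod (volume : Measure (Mat (n - k) m)))
    (measurable_frame_mul n (n - k) m).aemeasurable hF.aestronglyMeasurable
  refine h1.symm.trans ?_
  rw [map_frame_mul hkn, integral_smul_measure, integral_withDensity_eq_integral_toReal_smul hd
    (ae_of_all _ fun _ => ENNReal.ofReal_lt_top), ENNReal.toReal_ofReal hc, Complex.real_smul,
    ← integral_const_mul, ← integral_const_mul]
  refine integral_congr_ae ?_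
  filter_upwards [ae_posDef_gram (n := n) (m := m) (by omega)] with y hy
  have hpi : ((2 * Real.pi) ^ (k * m) : ℝ) ≠ 0 := by positivity
  rw [ENNReal.toReal_ofReal (Real.rpow_nonneg hy.det_pos.le _), Complex.real_smul]
  simp only [frequencyKernel]
  rw [integral_const_mul, multiplier, multiplierConst, Complex.ofReal_mul, Complex.ofReal_inv]
  have hpi' : (((2 * Real.pi) ^ (k * m) : ℝ) : ℂ) ≠ 0 := by exact_mod_cast hpi
  field_simp

/-- The truncated inversion integral, tested against a rapidly decreasing function. -/
theorem integral_mul_inversion {n k m : ℕ} (hk : 1 ≤ k) (hkn : k + m ≤ n) {f : Mat n m → ℂ}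
    (hf : Measurable f) (hfi : Integrable f) {w : Mat (n - k) m → ℂ} (hw : Measurable w)
    (hwi : Integrable w) (hp : HasSymmetricProfile w) {ψ : Mat n m → ℂ} {r B B' : ℝ}
    (hψ : IsTest r ψ B B') {ε : ℝ} (hε : 0 < ε) (ρ : ℝ) :
    ∫ x, ψ x * (∫ q, inversionKernel f w x q ∂paramMeasure n k m ε ρ) =
      (((2 * Real.pi) ^ (n * m))⁻¹ : ℝ) *
        ∫ y, multiplier w ε ρ y * (fourierMat f y * fourierMat ψ (-y)) := by
  have hkn' : k ≤ n := by omega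
  have hJ := integrable_mul_inversionKernel hk hkn' hf hfi hw hwi hψ.lt hε ρ
    hψ.continuous.measurable hψ.le_decay
  simp only [← integral_const_mul]
  refine (integral_integral_swap hJ).trans ?_
  rw [integral_param hJ.integral_prod_right]
  have h1 : ∫ a in coneInterval m ε ρ, (∫ ξ, (∫ t : Mat (n - k) m, ∫ x : Mat n m,
      ψ x * inversionKernel f w x (a, ξ, t)) ∂stiefelMeasure n k) ∂coneMeasure m =
      ∫ a in coneInterval m ε ρ, (((2 * Real.pi) ^ ((n - k) * m))⁻¹ : ℝ) *
        (∫ ξ, (∫ η : Mat (n - k) m, frequencyKernel f w ψ a ((ξ : Mat n (n - k)) * η))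
          ∂stiefelMeasure n k) ∂coneMeasure m := by
    refine setIntegral_congr_fun (measurableSet_coneInterval m ε ρ) fun a ha => ?_
    rw [← integral_const_mul]
    refine integral_congr_ae (ae_of_all _ fun ξ => ?_)
    exact integral_slice_eq hk hkn hf hfi hw hwi hp hψ (posDef_of_mem_coneInterval hε ha) ξ
  refine h1.trans ?_
  rw [integral_const_mul]
  have h2 := integral_param (integrable_frequencyKernel hfi hwi hψ hε ρ)
  dsimp only at h2
  -- The factor $(2\pi)^{-(n-k)m}$ from inversion on the slices and $(2\pi)^{-km}$ from the
  -- multiplier combine to $(2\pi)^{-nm}$.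
  rw [← h2, integral_frequencyKernel hkn hfi hwi hψ hε, ← mul_assoc, ← Complex.ofReal_mul,
    integral_const_mul, ← mul_inv, ← pow_add, ← add_mul, Nat.sub_add_cancel hkn']

/-! ### Convergence in the mean -/

theorem tendsto_eLpNorm_two_zero {α ι : Type*} [MeasurableSpace α] {μ : Measure α} {l : Filter ι}
    [l.IsCountablyGenerated] {F : ι → α → ℂ} {g : α → ℂ} (hg : MemLp g 2 μ)
    (hF : ∀ᶠ i in l, AEStronglyMeasurable (F i) μ)
    (hb : ∀ᶠ i in l, ∀ᵐ a ∂μ, ‖F i a‖ ≤ ‖g a‖)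
    (hlim : ∀ᵐ a ∂μ, Tendsto (fun i => F i a) l (𝓝 0)) :
    Tendsto (fun i => eLpNorm (F i) 2 μ) l (𝓝 0) := by
  have h1 : Tendsto (fun i => ∫⁻ a, ‖F i a‖ₑ ^ (2 : ℝ) ∂μ) l (𝓝 (∫⁻ _, 0 ∂μ)) := by
    refine tendsto_lintegral_filter_of_dominated_convergence' (fun a => ‖g a‖ₑ ^ (2 : ℝ))
      (hF.mono fun i hi => hi.enorm.pow_const _) (hb.mono fun i hi => hi.mono fun a ha => ?_)
      ?_ (hlim.mono fun a ha => ?_)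
    · gcongr
      exact enorm_le_iff_norm_le.2 ha
    · have := lintegral_rpow_enorm_lt_top_of_eLpNorm_lt_top (p := 2) (by norm_num) (by norm_num)
        hg.2
      simpa using this.ne
    · have h2 := (ENNReal.continuous_rpow_const (y := 2)).tendsto _ |>.comp ha.enorm
      simpa [Function.comp_def] using h2
  have h2 := (ENNReal.continuous_rpow_const (y := 1 / 2)).tendsto _ |>.comp h1
  simp only [lintegral_zero] at h2
  rw [ENNReal.zero_rpow_of_pos (by norm_num)] at h2
  refine h2.congr fun i => ?_
  rw [eLpNorm_eq_lintegral_rpow_enorm_toReal (by norm_num) (by norm_num)]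
  simp

section

open scoped FourierTransform SchwartzMap ContDiff

theorem measurePreserving_toE_symm (n m : ℕ) : MeasurePreserving (toE n m).symm :=
  (measurePreserving_toE n m).symm (toE n m).toHomeomorph.toMeasurableEquiv

theorem exists_isTest {n m : ℕ} (ψ : 𝓢(EMat n m, ℂ)) :
    ∃ r B B' : ℝ, IsTest r (fun x : Mat n m => ψ (toE n m x)) B B' := by
  obtain ⟨B, hB⟩ := exists_schwartz_le_decay ψ (n * m + 1)
  obtain ⟨B', hB'⟩ := exists_fourierMat_schwartz_le_decay ψ (n * m + 1)
  exact ⟨_, B, B', by push_cast; linarith, ψ.continuous.comp (toE n m).continuous, hB, hB'⟩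

theorem integral_frequency_eq {n m : ℕ} (f κ : Mat n m → ℂ) (ψ : EMat n m → ℂ) :
    (((2 * Real.pi) ^ (n * m))⁻¹ : ℝ) * ∫ y, κ y * (fourierMat f y *
        fourierMat (fun x => ψ (toE n m x)) (-y)) =
      ∫ v, 𝓕⁻ ψ v * (κ (-((2 * Real.pi) • (toE n m).symm v)) *
        𝓕 (fun v => f ((toE n m).symm v)) v) := by
  have hpi : (0 : ℝ) < 2 * Real.pi := by positivity
  rw [← integral_neg_eq_self, ← Complex.real_smul, ← integral_comp_smul_toE_symm _ hpi]
  refine integral_congr_ae (ae_of_all _ fun v => ?_)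
  dsimp only
  rw [neg_neg, fourierMat_eq, fourierMat_eq, map_neg, map_smul,
    ContinuousLinearEquiv.apply_symm_apply, smul_neg, neg_neg, smul_smul,
    inv_mul_cancel₀ hpi.ne', one_smul, ← Real.fourierInv_eq_fourier_neg]
  simp only [ContinuousLinearEquiv.apply_symm_apply]
  ring

theorem ae_posDef_gram_frequency {n m : ℕ} (h : m ≤ n) : ∀ᵐ v : EMat n m,
    ((-((2 * Real.pi) • (toE n m).symm v)).transpose *
      (-((2 * Real.pi) • (toE n m).symm v))).PosDef := by
  filter_upwards [(measurePreserving_toE_symm n m).quasiMeasurePreserving.ae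
    (ae_posDef_gram h)] with v hv
  rw [Matrix.transpose_neg, Matrix.neg_mul, Matrix.mul_neg, neg_neg, Matrix.transpose_smul,
    Matrix.smul_mul, Matrix.mul_smul]
  exact (hv.smul (by positivity)).smul (by positivity)

/-- The inversion integral is locally integrable. -/
theorem locallyIntegrable_inversion {n k m : ℕ} (hk : 1 ≤ k) (hkn : k ≤ n) {f : Mat n m → ℂ}
    (hf : Measurable f) (hfi : Integrable f) {w : Mat (n - k) m → ℂ} (hw : Measurable w)
    (hwi : Integrable w) {ε : ℝ} (hε : 0 < ε) (ρ : ℝ) :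
    LocallyIntegrable fun v : EMat n m =>
      ∫ q, inversionKernel f w ((toE n m).symm v) q ∂paramMeasure n k m ε ρ := by
  set r : ℝ := (n : ℝ) * m + 1 with hrdef
  set h : Mat n m → ℂ := fun x => ∫ q, inversionKernel f w x q ∂paramMeasure n k m ε ρ with hh
  have hψ : Measurable fun x : Mat n m => ((decay r x : ℝ) : ℂ) :=
    Complex.measurable_ofReal.comp (measurable_decay n m r)
  have hJ := integrable_mul_inversionKernel hk hkn hf hfi hw hwi (r := r) (by simp [hrdef]) hε ρ
    (ψ := fun x => ((decay r x : ℝ) : ℂ)) hψ (B := 1) (fun x => by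
      rw [one_mul, Complex.norm_real, Real.norm_of_nonneg (decay_pos r x).le])
  have h1 : Integrable fun x : Mat n m => ((decay r x : ℝ) : ℂ) * h x := by
    simpa only [integral_const_mul] using hJ.integral_prod_left
  have h2 := integrable_comp_toE_symm.2 h1
  have hc : Continuous fun v : EMat n m => ((((1 + ‖v‖) ^ r : ℝ)) : ℂ) :=
    Complex.continuous_ofReal.comp ((continuous_const.add continuous_norm).rpow_const
      fun v => Or.inl (add_pos_of_pos_of_nonneg one_pos (norm_nonneg v)).ne')
  refine (locallyIntegrable_iff).2 fun K hK => ?_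
  refine (IntegrableOn.continuousOn_mul hc.continuousOn h2.integrableOn hK).congr_fun
    (fun v _ => ?_) hK.measurableSet
  dsimp only
  have hp : (0 : ℝ) < 1 + ‖v‖ := by positivity
  rw [decay, ContinuousLinearEquiv.apply_symm_apply, ← mul_assoc, ← Complex.ofReal_mul,
    ← Real.rpow_add hp, add_neg_cancel, Real.rpow_zero, Complex.ofReal_one, one_mul]

/-- The truncated inversion is square integrable, and its distance to a multiple of `f` is given by
the multiplier. -/
theorem inversion_l2 {n k m : ℕ} (hk : 1 ≤ k) (hkn : k + m ≤ n) {f : Mat n m → ℂ}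
    (hf : Measurable f) (hfi : Integrable f) (hf2 : MemLp f 2) {w : Mat (n - k) m → ℂ}
    (hw : Measurable w) (hwi : Integrable w) (hp : HasSymmetricProfile w)
    (hi : Integrable (profileDensity k w) (coneMeasure m)) {ε : ℝ} (hε : 0 < ε) (ρ : ℝ) :
    MemLp (truncatedInversion k w f ε ρ) 2 ∧ ∀ c : ℂ,
      eLpNorm (fun x => truncatedInversion k w f ε ρ x - c * f x) 2 volume =
      eLpNorm (fun v : EMat n m => (multiplier w ε ρ (-((2 * Real.pi) • (toE n m).symm v)) - c) *
        𝓕 (fun v => f ((toE n m).symm v)) v) 2 volume := by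
  have hkn' : k ≤ n := by omega
  have hmp := measurePreserving_toE n m
  have hms := measurePreserving_toE_symm n m
  have hfE1 : Integrable fun v => f ((toE n m).symm v) := integrable_comp_toE_symm.2 hfi
  have hfE2 : MemLp (fun v => f ((toE n m).symm v)) 2 := hf2.comp_measurePreserving hms
  have hκm : Measurable fun v : EMat n m =>
      multiplier w ε ρ (-((2 * Real.pi) • (toE n m).symm v)) := by
    have : Continuous fun v : EMat n m => -((2 * Real.pi) • (toE n m).symm v) :=
      ((toE n m).symm.continuous.fun_const_smul _).fun_neg
    exact (measurable_multiplier hwi ε ρ).comp this.measurable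
  obtain ⟨h, hh2, hhψ, hhc⟩ := exists_fourierMultiplier hfE1 hfE2 hκm.aestronglyMeasurable
    ((ae_posDef_gram_frequency (by omega)).mono fun v hv => norm_multiplier_le hwi hp hi hε ρ hv)
  set H : EMat n m → ℂ := fun v =>
    ∫ q, inversionKernel f w ((toE n m).symm v) q ∂paramMeasure n k m ε ρ with hH
  -- `H` is the pointwise integral, known only to be locally integrable, and `h` the $L^2$ function
  -- produced by the multiplier; equal integrals against smooth compactly supported functions force
  -- them to agree almost everywhere.
  have hae : H =ᵐ[volume] h := by
    refine ae_eq_of_integral_contDiff_smul_eq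
      (locallyIntegrable_inversion hk hkn' hf hfi hw hwi hε ρ)
      (hh2.locallyIntegrable (by norm_num)) fun g hg hgc => ?_
    have hg1 : HasCompactSupport (Complex.ofRealCLM ∘ g) := hgc.comp_left rfl
    have hg2 : ContDiff ℝ ∞ (Complex.ofRealCLM ∘ g) := by fun_prop
    set ψ : 𝓢(EMat n m, ℂ) := hg1.toSchwartzMap hg2 with hψ
    obtain ⟨r, B, B', hT⟩ := exists_isTest ψ
    have h1 := integral_mul_inversion hk hkn hf hfi hw hwi hp hT hε ρ
    rw [integral_frequency_eq, ← hhψ] at h1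
    have h2 : ∫ x : Mat n m, ψ (toE n m x) * H (toE n m x) = ∫ v, ψ v * H v :=
      integral_comp_toE fun v => ψ v * H v
    simp only [hH, ContinuousLinearEquiv.symm_apply_apply] at h2
    rw [h1] at h2
    simpa [hψ] using h2.symm
  have haeM : truncatedInversion k w f ε ρ =ᵐ[volume] fun x => h (toE n m x) := by
    filter_upwards [ae_truncatedInversion_eq hk hkn' hf hfi hw hwi hε ρ,
      hmp.quasiMeasurePreserving.ae hae] with x h1 h2
    rw [h1, ← h2, hH]
    simp only [ContinuousLinearEquiv.symm_apply_apply]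
  refine ⟨(memLp_congr_ae haeM).2 (hh2.comp_measurePreserving hmp), fun c => ?_⟩
  have hm : AEStronglyMeasurable (fun v => h v - c * f ((toE n m).symm v)) :=
    hh2.1.sub (hfE2.1.const_mul c)
  rw [← hhc c, ← eLpNorm_comp_measurePreserving hm hmp]
  refine eLpNorm_congr_ae ?_
  filter_upwards [haeM] with x hx
  simp [hx]

theorem tendsto_inversion {n k m : ℕ} (hk : 1 ≤ k) (hkn : k + m ≤ n) {f : Mat n m → ℂ}
    (hf : Measurable f) (hfi : Integrable f) (hf2 : MemLp f 2) {w : Mat (n - k) m → ℂ}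
    (hw : Measurable w) (hwi : Integrable w) (hp : HasSymmetricProfile w)
    (hfin : Integrable fun ζ : Mat (n - k) m => fourierMat w ζ / ((volNorm ζ ^ n : ℝ) : ℂ)) :
    Tendsto (fun p : ℝ × ℝ => eLpNorm (fun x => truncatedInversion k w f p.1 p.2 x -
      waveletConst n k m w * f x) 2 volume) (𝓝[>] (0 : ℝ) ×ˢ atTop) (𝓝 0) := by
  have hi := (profile_integral hkn hwi hp hfin).1
  have hc := waveletConst_eq hkn hwi hp hfin
  set c := waveletConst n k m w with hcdef
  have hfE1 : Integrable fun v => f ((toE n m).symm v) := integrable_comp_toE_symm.2 hfi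
  have hfE2 : MemLp (fun v => f ((toE n m).symm v)) 2 :=
    hf2.comp_measurePreserving (measurePreserving_toE_symm n m)
  have hF := memLp_fourier hfE1 hfE2
  set C : ℝ := |multiplierConst n k m| * ∫ s, ‖profileDensity k w s‖ ∂coneMeasure m with hC
  have hC0 : 0 ≤ C := by positivity
  have hae := ae_posDef_gram_frequency (n := n) (m := m) (by omega)
  -- On the frequency side the difference is $(\kappa-c)\mathcal Ff$, dominated by
  -- $(C+|c|)\,|\mathcal Ff|\in L^2$ with $C$ independent of $\varepsilon$ and $\rho$.
  have key := tendsto_eLpNorm_two_zero (l := 𝓝[>] (0 : ℝ) ×ˢ atTop)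
    (F := fun (p : ℝ × ℝ) (v : EMat n m) =>
      (multiplier w p.1 p.2 (-((2 * Real.pi) • (toE n m).symm v)) - c) *
        𝓕 (fun v => f ((toE n m).symm v)) v)
    (hF.const_mul ((C + ‖c‖ : ℝ) : ℂ)) (Eventually.of_forall fun p => ?_)
    (eventually_pos_fst.mono fun p hp0 => hae.mono fun v hv => ?_) (hae.mono fun v hv => ?_)
  · refine key.congr' ?_
    filter_upwards [eventually_pos_fst] with p hp0
    exact ((inversion_l2 hk hkn hf hfi hf2 hw hwi hp hi hp0 p.2).2 c).symm
  · have h0 : Continuous fun v : EMat n m => -((2 * Real.pi) • (toE n m).symm v) :=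
      ((toE n m).symm.continuous.fun_const_smul _).fun_neg
    exact (((measurable_multiplier hwi p.1 p.2).comp h0.measurable).sub_const
      c).aestronglyMeasurable.mul hF.1
  · rw [norm_mul, norm_mul, Complex.norm_real, Real.norm_of_nonneg (by positivity)]
    refine mul_le_mul_of_nonneg_right ((norm_sub_le _ _).trans ?_) (norm_nonneg _)
    exact add_le_add (norm_multiplier_le hwi hp hi hp0 p.2 hv) le_rfl
  · have h1 := ((tendsto_multiplier hwi hp hi hv).sub_const c).mul_const
      (𝓕 (fun v => f ((toE n m).symm v)) v)
    rwa [← hc, sub_self, zero_mul] at h1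

end

/-! ### Independence of almost everywhere representatives -/

theorem exists_null_of_ae_eq {q m : ℕ} {w w' : Mat q m → ℂ} (h : w =ᵐ[volume] w') :
    ∃ N : Set (Mat q m), MeasurableSet N ∧ volume N = 0 ∧ ∀ x ∉ N, w x = w' x := by
  refine ⟨toMeasurable volume {x | w x ≠ w' x}, measurableSet_toMeasurable _ _, ?_,
    fun x hx => ?_⟩
  · rw [measure_toMeasurable]; exact h
  · by_contra hne; exact hx (subset_toMeasurable _ _ hne)

theorem radon_eq_of_planeLIntegral_indicator_eq_zero {n k m : ℕ} {f f' : Mat n m → ℂ}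
    {N : Set (Mat n m)}
    (hN : MeasurableSet N) (hff' : ∀ x ∉ N, f x = f' x) {ξ : Stiefel n (n - k)}
    {t : Mat (n - k) m} (hk : k ≤ n) (h : planeLIntegral (N.indicator 1) ξ t = 0) :
    radon f ξ t = radon f' ξ t := by
  have hm : Measurable fun ω : Mat k m =>
      (N.indicator 1 (rotationOf ξ * stack ω t) : ENNReal) := by
    have : Measurable fun ω : Mat k m => rotationOf ξ * stack ω t :=
      measurable_mul measurable_const ((measurable_stack n k m hk).comp
        (measurable_id.prodMk measurable_const))
    exact (measurable_one.indicator hN).comp this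
  refine integral_congr_ae ?_
  filter_upwards [(lintegral_eq_zero_iff hm).1 h] with ω hω
  refine hff' _ fun hmem => ?_
  rw [Set.indicator_of_mem hmem] at hω
  exact one_ne_zero hω

/-- By Tonelli a null set meets, for every $\xi$, almost every plane of that direction in a null
set. Measurability of plane integrals of indicators gives the joint statement even when the Radon
transforms themselves are not measurable. -/
theorem ae_radon_eq {n k m : ℕ} (hk : 1 ≤ k) (hkn : k ≤ n) {f f' : Mat n m → ℂ}
    (h : f =ᵐ[volume] f') :
    (∀ ξ : Stiefel n (n - k), ∀ᵐ t, radon f ξ t = radon f' ξ t) ∧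
    ∀ᵐ p ∂(stiefelMeasure n k).prod volume, radon f p.1 p.2 = radon f' p.1 p.2 := by
  obtain ⟨N, hN, hN0, hff'⟩ := exists_null_of_ae_eq h
  have hNm : Measurable (N.indicator 1 : Mat n m → ENNReal) := measurable_one.indicator hN
  have hm := measurable_planeLIntegral hk hkn hNm
  have h1 : ∀ ξ : Stiefel n (n - k), ∀ᵐ t, planeLIntegral (N.indicator 1) ξ t = 0 := by
    intro ξ
    refine (lintegral_eq_zero_iff (hm.comp measurable_prodMk_left)).1 ?_
    refine (lintegral_planeLIntegral hk hkn hNm ξ).trans ?_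
    rw [lintegral_indicator_one hN, hN0]
  refine ⟨fun ξ => (h1 ξ).mono fun t ht =>
    radon_eq_of_planeLIntegral_indicator_eq_zero hN hff' hkn ht, ?_⟩
  have h2 : ∀ᵐ p ∂(stiefelMeasure n k).prod (volume : Measure (Mat (n - k) m)),
      planeLIntegral (N.indicator 1) p.1 p.2 = 0 :=
    (Measure.ae_prod_iff_ae_ae (hm (measurableSet_singleton 0))).2 (ae_of_all _ h1)
  exact h2.mono fun p hp => radon_eq_of_planeLIntegral_indicator_eq_zero hN hff' hkn hp

theorem ae_mul_right_notMem {q m : ℕ} {N : Set (Mat q m)} (hN : MeasurableSet N)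
    (hN0 : volume N = 0) {p : Mat m m} (hp : p.det ≠ 0) : ∀ᵐ z : Mat q m, z * p ∉ N := by
  have hNm : Measurable (N.indicator 1 : Mat q m → ENNReal) := measurable_one.indicator hN
  have h := lintegral_mul_right (n := q) p hp (N.indicator 1)
  have hm : Measurable fun z : Mat q m => (N.indicator 1 (z * p) : ENNReal) :=
    hNm.comp (measurable_mul measurable_id measurable_const)
  rw [lintegral_indicator_one hN, hN0, mul_zero, lintegral_eq_zero_iff hm] at h
  filter_upwards [h] with z hz hmem
  rw [Set.indicator_of_mem hmem] at hz
  exact one_ne_zero hz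

theorem measurable_frame_sub_mul {α : Type*} [MeasurableSpace α] {n q m : ℕ}
    {A : α → Mat m m} (hA : Measurable A) {ξ : α → Mat n q} (hξ : Measurable ξ) {x : α → Mat n m}
    (hx : Measurable x) {t : α → Mat q m} (ht : Measurable t) :
    Measurable fun p => ((ξ p).transpose * x p - t p) * (rootMat (A p))⁻¹ := by
  have h0 : Measurable fun p => (rootMat (A p))⁻¹ :=
    (measurable_inv m).comp ((measurable_rootMat m).comp hA)
  have h1 : Measurable fun p => (ξ p).transpose := measurable_transpose.comp hξ
  have h2 : Measurable fun p => (ξ p).transpose * x p := measurable_mul h1 hx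
  exact measurable_mul (measurable_sub_mat h2 ht) h0

theorem ae_sub_mul_notMem {q m : ℕ} {N : Set (Mat q m)} (hN : MeasurableSet N)
    (hN0 : volume N = 0) {a : Mat m m} (ha : a.PosDef) (c : Mat q m) :
    ∀ᵐ t, (c - t) * (rootMat a)⁻¹ ∉ N :=
  (Measure.measurePreserving_sub_left volume c).quasiMeasurePreserving.ae
    (ae_mul_right_notMem hN hN0 (det_inv_ne_zero (det_rootMat_ne_zero ha)))

theorem ae_param_notMem {n k m : ℕ} {N : Set (Mat (n - k) m)} (hN : MeasurableSet N)
    (hN0 : volume N = 0) {ε : ℝ} (hε : 0 < ε) (ρ : ℝ) (x : Mat n m) :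
    ∀ᵐ p ∂paramMeasure n k m ε ρ,
      ((p.2.1 : Mat n (n - k)).transpose * x - p.2.2) * (rootMat p.1)⁻¹ ∉ N := by
  have hm : Measurable fun p : Mat m m × (Stiefel n (n - k) × Mat (n - k) m) =>
      ((p.2.1 : Mat n (n - k)).transpose * x - p.2.2) * (rootMat p.1)⁻¹ :=
    measurable_frame_sub_mul measurable_fst measurable_snd.fst.subtype_val measurable_const
      measurable_snd.snd
  have hset : MeasurableSet {p : Mat m m × (Stiefel n (n - k) × Mat (n - k) m) |
      ((p.2.1 : Mat n (n - k)).transpose * x - p.2.2) * (rootMat p.1)⁻¹ ∉ N} := hm hN.compl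
  rw [paramMeasure, Measure.ae_prod_iff_ae_ae hset]
  filter_upwards [ae_restrict_mem (measurableSet_coneInterval m ε ρ)] with a ha
  have hset' : MeasurableSet {p : Stiefel n (n - k) × Mat (n - k) m |
      ((p.1 : Mat n (n - k)).transpose * x - p.2) * (rootMat a)⁻¹ ∉ N} :=
    measurable_prodMk_left hset
  rw [Measure.ae_prod_iff_ae_ae hset']
  have hap := posDef_of_mem_coneInterval hε ha
  have h : ∀ ξ : Stiefel n (n - k), ∀ᵐ t : Mat (n - k) m,
      ((ξ : Mat n (n - k)).transpose * x - t) * (rootMat a)⁻¹ ∉ N := fun ξ =>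
    ae_sub_mul_notMem hN hN0 hap ((ξ : Mat n (n - k)).transpose * x)
  exact ae_of_all _ h

theorem scaled_eq_of_notMem {q m : ℕ} {w w' : Mat q m → ℂ} {N : Set (Mat q m)}
    (hww' : ∀ x ∉ N, w x = w' x) {a : Mat m m} {z : Mat q m} (h : z * (rootMat a)⁻¹ ∉ N) :
    scaled w a z = scaled w' a z := by
  rw [scaled, scaled, hww' _ h]

theorem ae_scaled_sub_eq {q m : ℕ} {w w' : Mat q m → ℂ} (h : w =ᵐ[volume] w') {a : Mat m m}
    (ha : a.PosDef) (c : Mat q m) : ∀ᵐ t, scaled w a (c - t) = scaled w' a (c - t) := by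
  obtain ⟨N, hN, hN0, hww'⟩ := exists_null_of_ae_eq h
  exact (ae_sub_mul_notMem hN hN0 ha c).mono fun t ht => scaled_eq_of_notMem hww' ht

theorem ae_param_scaled_eq {n k m : ℕ} {w w' : Mat (n - k) m → ℂ} (h : w =ᵐ[volume] w') {ε : ℝ}
    (hε : 0 < ε) (ρ : ℝ) (x : Mat n m) : ∀ᵐ p ∂paramMeasure n k m ε ρ,
      scaled w p.1 ((p.2.1 : Mat n (n - k)).transpose * x - p.2.2) =
        scaled w' p.1 ((p.2.1 : Mat n (n - k)).transpose * x - p.2.2) := by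
  obtain ⟨N, hN, hN0, hww'⟩ := exists_null_of_ae_eq h
  exact (ae_param_notMem hN hN0 hε ρ x).mono fun p hp => scaled_eq_of_notMem hww' hp

/-- Equality holds at every $x$: for all $a$ and $\xi$ the integrands in $t$ differ only on a null
set, since invertible right multiplication, reflection and translation preserve null sets. -/
theorem truncatedInversion_congr {n k m : ℕ} (hk : 1 ≤ k) (hkn : k ≤ n) {f f' : Mat n m → ℂ}
    (hf : f =ᵐ[volume] f') {w w' : Mat (n - k) m → ℂ} (hw : w =ᵐ[volume] w') {ε : ℝ} (hε : 0 < ε)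
    (ρ : ℝ) : truncatedInversion k w f ε ρ = truncatedInversion k w' f' ε ρ := by
  ext x
  refine setIntegral_congr_fun (measurableSet_coneInterval m ε ρ) fun a ha => ?_
  congr 1
  refine integral_congr_ae (ae_of_all _ fun ξ => integral_congr_ae ?_)
  filter_upwards [(ae_radon_eq hk hkn hf).1 ξ,
    ae_scaled_sub_eq hw (posDef_of_mem_coneInterval hε ha) _] with t h1 h2
  rw [h1, h2]

theorem ae_inversionKernel_eq {n k m : ℕ} (hk : 1 ≤ k) (hkn : k ≤ n) {f f' : Mat n m → ℂ}
    (hf : f =ᵐ[volume] f') {w w' : Mat (n - k) m → ℂ} (hw : w =ᵐ[volume] w') {ε : ℝ} (hε : 0 < ε)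
    (ρ : ℝ) (x : Mat n m) :
    inversionKernel f w x =ᵐ[paramMeasure n k m ε ρ] inversionKernel f' w' x := by
  have h1 : ∀ᵐ p ∂paramMeasure n k m ε ρ, radon f p.2.1 p.2.2 = radon f' p.2.1 p.2.2 :=
    Measure.quasiMeasurePreserving_snd.ae (ae_radon_eq hk hkn hf).2
  filter_upwards [h1, ae_param_scaled_eq hw hε ρ x] with p h1 h2
  rw [inversionKernel, inversionKernel, h1, h2]

theorem fourierMat_congr {n m : ℕ} {f f' : Mat n m → ℂ} (h : f =ᵐ[volume] f') :
    fourierMat f = fourierMat f' := by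
  ext y
  exact integral_congr_ae (h.mono fun x hx => by dsimp only; rw [hx])

end MatrixRadon

/-! ### The inversion theorem -/

theorem mainTheorem4 (n m k : ℕ) (hm : 1 ≤ m) (hk : 1 ≤ k) (hkn : k + m ≤ n)
    (f : Matrix (Fin n) (Fin m) ℝ → ℂ) (hf1 : MemLp f 1) (hf2 : MemLp f 2)
    (w : Matrix (Fin (n - k)) (Fin m) ℝ → ℂ) (hw : MatrixRadon.IsAdmissible n k m w) :
    (∀ ε ρ : ℝ, 0 < ε → ε < ρ →
      (∀ᵐ x : Matrix (Fin n) (Fin m) ℝ,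
        Integrable
          (fun q : Matrix (Fin m) (Fin m) ℝ ×
              (MatrixRadon.Stiefel n (n - k) × Matrix (Fin (n - k)) (Fin m) ℝ) =>
            MatrixRadon.radon f q.2.1 q.2.2 *
              MatrixRadon.scaled w q.1
                ((q.2.1 : Matrix (Fin n) (Fin (n - k)) ℝ).transpose * x - q.2.2) *
              ((q.1.det ^ (-(k : ℝ) / 2) : ℝ) : ℂ))
          (((MatrixRadon.coneMeasure m).restrict (MatrixRadon.coneInterval m ε ρ)).prod
            ((MatrixRadon.stiefelMeasure n k).prod volume))) ∧
      MemLp (MatrixRadon.truncatedInversion k w f ε ρ) 2) ∧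
    Tendsto
      (fun p : ℝ × ℝ =>
        eLpNorm (fun x => MatrixRadon.truncatedInversion k w f p.1 p.2 x -
          MatrixRadon.waveletConst n k m w * f x) 2 volume)
      (𝓝[>] (0 : ℝ) ×ˢ atTop) (𝓝 0) := by
  have hkn' : k ≤ n := by omega
  have hfi : Integrable f := memLp_one_iff_integrable.1 hf1
  obtain ⟨u₀, hsym, hu⟩ := hw.symmetric
  have hfae := hfi.1.ae_eq_mk
  have hwae := hw.integrable.1.ae_eq_mk
  -- The analysis above needs Borel functions. Replacing $f$ and $w$ by Borel representatives leaves
  -- $\tilde w$ unchanged, hence also its profile on the cone, the convergence condition and $c_w$.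
  set f' := hfi.1.mk f with hf'
  set w' := hw.integrable.1.mk w with hw'
  have hfm : Measurable f' := hfi.1.stronglyMeasurable_mk.measurable
  have hwm : Measurable w' := hw.integrable.1.stronglyMeasurable_mk.measurable
  have hfi' : Integrable f' := hfi.congr hfae
  have hwi' : Integrable w' := hw.integrable.congr hwae
  have hf2' : MemLp f' 2 := (memLp_congr_ae hfae).1 hf2
  have hF : MatrixRadon.fourierMat w = MatrixRadon.fourierMat w' :=
    MatrixRadon.fourierMat_congr hwae
  have hfin := hw.finite
  have hc : MatrixRadon.waveletConst n k m w = MatrixRadon.waveletConst n k m w' := by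
    rw [MatrixRadon.waveletConst, MatrixRadon.waveletConst, hF]
  rw [hF] at hu hfin
  have hp : MatrixRadon.HasSymmetricProfile w' :=
    MatrixRadon.hasSymmetricProfile (by omega) hsym hu
  have hi := (MatrixRadon.profile_integral hkn hwi' hp hfin).1
  refine ⟨fun ε ρ hε _ => ⟨?_, ?_⟩, ?_⟩
  · filter_upwards [MatrixRadon.ae_integrable_inversionKernel hk hkn' hfm hfi' hwm hwi' hε ρ]
      with x hx
    exact hx.congr (MatrixRadon.ae_inversionKernel_eq hk hkn' hfae hwae hε ρ x).symm
  · rw [MatrixRadon.truncatedInversion_congr hk hkn' hfae hwae hε ρ]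
    exact (MatrixRadon.inversion_l2 hk hkn hfm hfi' hf2' hwm hwi' hp hi hε ρ).1
  · refine (MatrixRadon.tendsto_inversion hk hkn hfm hfi' hf2' hwm hwi' hp hfin).congr' ?_
    filter_upwards [MatrixRadon.eventually_pos_fst] with p hp0
    refine eLpNorm_congr_ae ?_
    filter_upwards [hfae] with x hx
    rw [hx, hc, MatrixRadon.truncatedInversion_congr hk hkn' hfae hwae hp0 p.2]
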